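/- Let $G=(V,E)$ be a finite connected undirected (simple) graph, $V=V_\partial\sqcup V_b$ with boundary $V_\partial\neq\emptyset$ and bulk $V_b$, and let $A\subseteq V_\partial$. **Network.** Consider a family of link states indexed by a parameter $D\to\infty$ (along an arbitrary sequence). Each edge $e=(xy)$ has a bond dimension $D_e$ and a normalized link state $|\phi_e\rangle=\sum_{i=1}^{D_e}\sqrt{\lambda_{e,i}}\,|ii\rangle\in\mathcal H_{e,x}\otimes\mathcal H_{e,y}$, where $\mathcal H_{e,x}=\mathcal H_{e,y}=\mathbb C^{D_e}$, $\lambda_{e,i}\ge 0$, $\sum_i\lambda_{e,i}=1$; $D_e$ and $\lambda_{e,i}$ depend on $D$. Put $|\phi\rangle=\bigotimes_e|\phi_e\rangle$ and $\mathcal H_x=\bigotimes_{e\ni x}\mathcal H_{e,x}$. At the bulk vertices place independent random vectors $|\psi_x\rangle\in\mathcal H_x$ with independent standard complex Gaussian entries ($\tfrac1{\sqrt2}(X+iY)$ with $X,Y$ independent real standard Gaussians). Let $|\rho\rangle=(I_{V_\partial}\otimes\langle\psi|)|\phi\rangle$ with $|\psi\rangle=\bigotimes_{x\in V_b}|\psi_x\rangle$,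 let $\rho=|\rho\rangle\langle\rho|$, and let $\rho_A$ be its partial trace over $V_\partial\setminus A$. **Bounded spectral variation.** Assume that $D_e=\Theta(D)$ for every edge $e$ and that for every $k$ the $k$-th moment of $\mu_e^{(D)}=\frac1{D_e}\sum_{i=1}^{D_e}\delta_{D_e\lambda_{e,i}}$ converges, as $D\to\infty$, to the $k$-th moment of a compactly supported probability measure $\mu_e$ on $\mathbb R$. **Cuts.** A cut for $A$ is a set $\Gamma\subseteq V$ with $\Gamma\cap V_\partial=A$; $\gamma$ denotes the set of edges between $\Gamma$ and $V\setminus\Gamma$. The cut is minimal if $|\gamma|$ is minimal among the cuts for $A$. Put $D_\gamma=\prod_{e\in\gamma}D_e$, let $\mu_\gamma$ be the law of $\prod_{e\in\gamma}X_e$ for independent $X_e\sim\mu_e$, and let $m_{\gamma,k}=\int z^k\,d\mu_\gamma(z)$. **Moments.** Let $D_{\gamma_A}$ be the smallest value of $D_\gamma$ among the minimal cuts for $A$, let $\lambda_{A,1}\ge\lambda_{A,2}\ge\cdots$ be the eigenvalues of $\rho_A$ with multiplicity, extended by zeros, and define $$\mu_A^{(D)}=\frac1{D_{\gamma_A}}\sum_{i=1}^{D_{\gamma_A}}\delta_{D_{\gamma_A}\lambda_{A,i}},\qquad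 m_{A,k}^{(D)}=\int z^k\,d\mu_A^{(D)}(z)=D_{\gamma_A}^{k-1}\sum_{i=1}^{D_{\gamma_A}}\lambda_{A,i}^k .$$ **Permutations.** For $\pi\in S_k$ let $C(\pi)$ be the multiset of its cycle lengths (fixed points included), $f_\pi=\prod_{l\in C(\pi)}f_l$ for a sequence $(f_l)$, and $d(\pi,\sigma)=k-|C(\pi^{-1}\sigma)|$. Let $\tau=(1\,2\cdots k)$, and let $NC(k)\subseteq S_k$ be the set of non-crossing partitions of $\{1,\dots,k\}$, a partition being identified with the permutation whose cycles are its blocks in increasing order. **Claim.** For every $k\ge 1$ the random variables $m_{A,k}^{(D)}$ are square integrable, and: 1. If $A$ has a unique minimal cut $\gamma_A$, then $\lim_{D\to\infty}\mathbb E\,m_{A,k}^{(D)}=m_{\gamma_A,k}$. 2. If $A$ has exactly two minimal cuts $\gamma_{A,1},\gamma_{A,2}$, if $\gamma_{A,1}\cap\gamma_{A,2}=\emptyset$, and if $D_{\gamma_{A,1}}/D_{\gamma_{A,2}}\to t$ with $t\le 1$, then $$\lim_{D\to\infty}\mathbb E\,m_{A,k}^{(D)}=\sum_{\pi\in NC(k)}t^{d(\pi,\mathrm{id})}\,m_{\gamma_{A,1},\tau^{-1}\pi}\,m_{\gamma_{A,2},\pi}.$$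 3. In both cases, $\mathbb E\big[(m_{A,k}^{(D)}-\mathbb E\,m_{A,k}^{(D)})^2\big]=O(1/D)$ as $D\to\infty$, for each fixed $k$. -/

import Mathlib

open MeasureTheory ProbabilityTheory Filter Topology Asymptotics
open scoped ENNReal

namespace RTN

/-! ### Permutations and non-crossing partitions -/

/-- `f_π = ∏_{l ∈ C(π)} f_l`, where `C(π)` is the multiset of lengths of all cycles of `π`
(fixed points count as cycles of length one). -/
def permProd {k : ℕ} (f : ℕ → ℝ) (π : Equiv.Perm (Fin k)) : ℝ :=
  (π.partition.parts.map f).prod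

/-- The Cayley distance `d(π, σ) = ∑_{l ∈ C(π⁻¹ σ)} (l - 1)`. Every `l` is at least one. -/
def cayleyDist {k : ℕ} (π σ : Equiv.Perm (Fin k)) : ℕ :=
  ((π⁻¹ * σ).partition.parts.map (fun l => l - 1)).sum

/-- A partition of `{1, …, k}`, given as an equivalence relation, is non-crossing: there are no
`a < b < c < d` with `a, c` in one block and `b, d` in a different block. -/
def IsNonCrossing {k : ℕ} (r : Setoid (Fin k)) : Prop :=
  ∀ a b c d : Fin k, a < b → b < c → c < d → r a c → r b d → r a b

/-- Every cycle of `π` has the form `(i₁, …, iₗ)` with `i₁ < ⋯ < iₗ`: each `i` is sent to the next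
larger element of its cycle or, if `i` is the largest element, to the smallest one. -/
def HasIncreasingCycles {k : ℕ} (π : Equiv.Perm (Fin k)) : Prop :=
  ∀ i : Fin k,
    (i < π i ∧ ∀ j, π.SameCycle i j → i < j → π i ≤ j) ∨
    (∀ j, π.SameCycle i j → π i ≤ j ∧ j ≤ i)

open scoped Classical in
/-- `NC(k)` as a set of permutations: a non-crossing partition is identified with the permutation
that has its blocks, each in increasing order, as cycles. -/
noncomputable def NC (k : ℕ) : Finset (Equiv.Perm (Fin k)) :=
  Finset.univ.filter fun π =>
    IsNonCrossing (Equiv.Perm.SameCycle.setoid π) ∧ HasIncreasingCycles π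

/-! ### Cuts -/

section Graph

variable {V : Type*} [Fintype V] [DecidableEq V] (G : SimpleGraph V) [DecidableRel G.Adj]

/-- The set of edges joining a vertex in `Γ` to a vertex outside `Γ`. -/
def cutEdges (Γ : Finset V) : Finset G.edgeSet :=
  Finset.univ.filter fun e => ∃ x ∈ Γ, ∃ y ∈ Γᶜ, (e : Sym2 V) = s(x, y)

/-- `Γ` is a cut for the set `A` of boundary vertices. -/
def IsCut (bdry A Γ : Finset V) : Prop := Γ ∩ bdry = A

/-- `Γ` is a cut for `A` that is crossed by the least number of edges. -/
def IsMinCut (bdry A Γ : Finset V) : Prop :=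
  IsCut bdry A Γ ∧
    ∀ Γ' : Finset V, IsCut bdry A Γ' → (cutEdges G Γ).card ≤ (cutEdges G Γ').card

/-! ### Link states -/

/-- For every edge `e`, a bond dimension `D_e` and the coefficients `λ_{e,i}` of the normalized
link state `|φ_e⟩ = ∑ᵢ √λ_{e,i} |ii⟩`. -/
structure LinkStates where
  dim : G.edgeSet → ℕ
  coeff : (e : G.edgeSet) → Fin (dim e) → ℝ
  coeff_nonneg : ∀ e i, 0 ≤ coeff e i
  sum_coeff : ∀ e, ∑ i, coeff e i = 1

variable {G}

/-- The standard basis of `H_x = ⨂_{e ∋ x} ℂ^{D_e}`. -/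
abbrev Leg (L : LinkStates G) (x : V) : Type _ :=
  (e : G.incidenceSet x) → Fin (L.dim ⟨e.1, e.2.1⟩)

/-- The standard basis of `H_S = ⨂_{x ∈ S} H_x`. -/
abbrev Idx (L : LinkStates G) (S : Finset V) : Type _ := (x : S) → Leg L x.1

/-- Combines basis labels on `A` and on `S \ A` into a basis label on `S`. -/
def join (L : LinkStates G) {S A : Finset V} (a : Idx L A) (c : Idx L (S \ A)) : Idx L S :=
  fun x => if h : x.1 ∈ A then a ⟨x.1, h⟩ else c ⟨x.1, Finset.mem_sdiff.2 ⟨x.2, h⟩⟩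

/-- The amplitude of `|φ_e⟩` at a basis label: `√λ_{e,j}` if both ends of `e` carry the label `j`,
and `0` if the labels differ. -/
noncomputable def linkAmp (L : LinkStates G) (e : G.edgeSet) (i : Idx L Finset.univ) : ℂ :=
  ∑ j : Fin (L.dim e),
    if ∀ (x : V) (h : x ∈ e.1), i ⟨x, Finset.mem_univ x⟩ ⟨e.1, e.2, h⟩ = j
    then ((Real.sqrt (L.coeff e j) : ℝ) : ℂ) else 0

/-- The vector `|φ⟩ = ⨂ₑ |φ_e⟩`. -/
noncomputable def linkVec (L : LinkStates G) (i : Idx L Finset.univ) : ℂ :=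
  ∏ e : G.edgeSet, linkAmp L e i

/-! ### Random tensors -/

/-- The law of `(X + iY)/√2` with `X, Y` independent real standard Gaussians. -/
noncomputable def stdComplexGaussian : Measure ℂ :=
  ((gaussianReal 0 1).prod (gaussianReal 0 1)).map
    fun p => ((p.1 : ℂ) + (p.2 : ℂ) * Complex.I) / ((Real.sqrt 2 : ℝ) : ℂ)

instance : IsProbabilityMeasure stdComplexGaussian := by
  unfold stdComplexGaussian
  exact Measure.isProbabilityMeasure_map (by fun_prop)

/-- A choice of a vector `|ψ_x⟩ ∈ H_x` at every bulk vertex `x`. -/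
abbrev BulkTensors (L : LinkStates G) (bdry : Finset V) : Type _ :=
  (x : ↥(Finset.univ \ bdry : Finset V)) → Leg L x.1 → ℂ

/-- The law of the bulk vectors: all entries are independent standard complex Gaussians. -/
noncomputable def tensorLaw (L : LinkStates G) (bdry : Finset V) :
    Measure (BulkTensors L bdry) :=
  Measure.pi fun _ => Measure.pi fun _ => stdComplexGaussian

/-! ### The random tensor network state -/

/-- The vector `|ρ⟩ = (I ⊗ ⟨ψ|) |φ⟩`. -/
noncomputable def rtnVec (L : LinkStates G) (bdry : Finset V) (ψ : BulkTensors L bdry)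
    (a : Idx L bdry) : ℂ :=
  ∑ b : Idx L (Finset.univ \ bdry), (∏ x, star (ψ x (b x))) * linkVec L (join L a b)

/-- The random tensor network state `ρ = |ρ⟩⟨ρ|` (not normalized). -/
noncomputable def rtnState (L : LinkStates G) (bdry : Finset V) (ψ : BulkTensors L bdry) :
    Matrix (Idx L bdry) (Idx L bdry) ℂ :=
  Matrix.vecMulVec (rtnVec L bdry ψ) (star (rtnVec L bdry ψ))

/-- The reduced state `ρ_A`, the partial trace of `ρ` over the boundary vertices not in `A`. -/
noncomputable def reducedState (L : LinkStates G) (bdry A : Finset V) (ψ : BulkTensors L bdry) :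
    Matrix (Idx L A) (Idx L A) ℂ :=
  fun a a' => ∑ c : Idx L (bdry \ A), rtnState L bdry ψ (join L a c) (join L a' c)

theorem reducedState_isHermitian (L : LinkStates G) (bdry A : Finset V)
    (ψ : BulkTensors L bdry) : (reducedState L bdry A ψ).IsHermitian := by
  ext a a'
  simp [reducedState, rtnState, Matrix.vecMulVec_apply, Matrix.conjTranspose_apply, mul_comm]

/-- The eigenvalues of `ρ_A` in non-increasing order, with multiplicity, extended by zeros
(the index starts at `0`). -/
noncomputable def spec (L : LinkStates G) (bdry A : Finset V) (ψ : BulkTensors L bdry)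
    (i : ℕ) : ℝ :=
  if h : i < Fintype.card (Idx L A) then
    (reducedState_isHermitian L bdry A ψ).eigenvalues₀ ⟨i, h⟩ else 0

/-! ### Spectral distributions and their moments -/

/-- `D_γ = ∏_{e ∈ γ} D_e` for the edge set `γ` of the cut `Γ`. -/
def cutDim (L : LinkStates G) (Γ : Finset V) : ℕ := ∏ e ∈ cutEdges G Γ, L.dim e

/-- The smallest value of `D_γ` among the minimal cuts for `A`. -/
noncomputable def minCutDim (L : LinkStates G) (bdry A : Finset V) : ℕ :=
  sInf {d : ℕ | ∃ Γ : Finset V, IsMinCut G bdry A Γ ∧ d = cutDim L Γ}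

/-- The empirical distribution `(1/d) ∑_{i < d} δ_{d sᵢ}`. -/
noncomputable def empirical (d : ℕ) (s : ℕ → ℝ) : Measure ℝ :=
  (d : ℝ≥0∞)⁻¹ • ∑ i ∈ Finset.range d, Measure.dirac ((d : ℝ) * s i)

/-- The rescaled entanglement spectrum `μ_e = (1/D_e) ∑ᵢ δ_{D_e λ_{e,i}}` of a link state. -/
noncomputable def linkMeasure (L : LinkStates G) (e : G.edgeSet) : Measure ℝ :=
  empirical (L.dim e) fun i => if h : i < L.dim e then L.coeff e ⟨i, h⟩ else 0

/-- The rescaled spectral distribution `μ_A` of `ρ_A`. -/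
noncomputable def boundaryMeasure (L : LinkStates G) (bdry A : Finset V)
    (ψ : BulkTensors L bdry) : Measure ℝ :=
  empirical (minCutDim L bdry A) (spec L bdry A ψ)

/-- The random moment `m_{A,k} = ∫ z^k dμ_A(z)`. -/
noncomputable def boundaryMoment (L : LinkStates G) (bdry A : Finset V) (k : ℕ)
    (ψ : BulkTensors L bdry) : ℝ :=
  ∫ z, z ^ k ∂(boundaryMeasure L bdry A ψ)

/-- `E[m_{A,k}]`. -/
noncomputable def meanMoment (L : LinkStates G) (bdry A : Finset V) (k : ℕ) : ℝ :=
  ∫ ψ, boundaryMoment L bdry A k ψ ∂(tensorLaw L bdry)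

/-- `E[(m_{A,k} - E[m_{A,k}])²]`. -/
noncomputable def varMoment (L : LinkStates G) (bdry A : Finset V) (k : ℕ) : ℝ :=
  ∫ ψ, (boundaryMoment L bdry A k ψ - meanMoment L bdry A k) ^ 2 ∂(tensorLaw L bdry)

/-- `μ_γ = ⨂_{e ∈ γ} μ_e`: the law of the product of independent random variables `X_e` with laws
`μ_e`, where `e` runs through the edges crossing the cut `Γ`. -/
noncomputable def cutMeasure (μ : G.edgeSet → Measure ℝ) (Γ : Finset V) : Measure ℝ :=
  (Measure.pi fun e : cutEdges G Γ => μ e.1).map fun z => ∏ e, z e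

/-- The moment `m_{γ,k}` of `μ_γ`. -/
noncomputable def cutMoment (μ : G.edgeSet → Measure ℝ) (Γ : Finset V) (k : ℕ) : ℝ :=
  ∫ z, z ^ k ∂(cutMeasure μ Γ)

/-- The link states `L n` have bounded spectral variation with effective bond dimension `D n` and
limiting distributions `μ e`: for every edge, `D_e = Θ(D)`, and all moments of the rescaled
entanglement spectrum converge to those of the compactly supported probability measure `μ e`. -/
structure BoundedSpectralVariation (L : ℕ → LinkStates G) (D : ℕ → ℝ)
    (μ : G.edgeSet → Measure ℝ) : Prop where
  dim_theta : ∀ e, (fun n => ((L n).dim e : ℝ)) =Θ[atTop] D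
  prob : ∀ e, IsProbabilityMeasure (μ e)
  compact : ∀ e, ∃ K : Set ℝ, IsCompact K ∧ μ e Kᶜ = 0
  moments : ∀ e, ∀ k : ℕ,
    Tendsto (fun n => ∫ z, z ^ k ∂(linkMeasure (L n) e)) atTop (𝓝 (∫ z, z ^ k ∂(μ e)))

end Graph

end RTN

/-!
The moments are computed with replicas. By the rank bound `rank_reducedState_le` the reduced state
has at most `D_{γ_A}` nonzero eigenvalues, so that `m_{A,k} = D_{γ_A}^{k-1} tr ρ_A^k`, and `tr
ρ_A^k` is the contraction of `k` copies of `ρ_A` along the long cycle `τ` (`boundaryMoment_eq`).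
It is a polynomial of degree `k` in the bulk tensors and of degree `k` in their conjugates. Wick's
formula `integral_prod_star_mul` at every bulk vertex turns its average into the partition
function of a spin model (`integral_replicaTrace`). The spins are permutations of the replicas,
equal to `τ` on `A` and to the identity on the other boundary vertices. An edge whose ends carry
`p` and `q` contributes the product of `tr Λ_e^l` over the cycle lengths `l` of `p⁻¹ q`. This is
`D_e^{-|p⁻¹ q|}` times a product of moments of the rescaled link spectrum (`cycProd_coeff`), where
the Cayley length `|π|` is the number of points minus the number of cycles. A configuration is
therefore of order `D^{-energy}`, where `energy` is the sum of the Cayley distances over the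
edges.

With boundary value `σ` on `A`, the distance from the identity and the distance from `σ` are
height functions on the graph. Their `|σ|` superlevel sets are cuts for `A`, and an edge crosses
at most as many of them as its Cayley distance. So the energy is at least `|σ|` times the size of
a minimal cut, with equality only if all these cuts are minimal (`isMinCut_level_of_sum_le`). The
other configurations contribute `O(1/D)` after rescaling (`term_isBigO`).

* If the minimal cut `Γ` is unique, equality forces the spin to be `σ` on `Γ` and the identity
  elsewhere (`eq_of_energy_le_of_unique`). This one configuration gives `m_{γ_A,k}`.
* Two minimal cuts are nested, `S ⊂ B`, because minimal cuts are closed under union and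
  intersection. Equality forces the spin to be `σ` on `S`, the identity outside `B`, and constant
  in between, with a value `π` on a geodesic from the identity to `σ`
  (`exists_geodesic_of_energy_le`). For `σ = τ` the geodesics are the non-crossing partitions
  (`mem_NC_iff`), and the domain wall with value `π` contributes the summand of `π` in the limit.
  If the second of the two given cuts is the inner one, the sum appears with the roles of `π` and
  `τ⁻¹ π` exchanged, which is undone by the Kreweras complement (`sum_NC_kreweras`).

For the second moment there are `2k` replicas and the boundary value is `τ ⊕ τ`. The
configurations with spins in `S_k × S_k` sum up to the square of the mean and cancel in the
variance (`varMoment_eq`). In a configuration of minimal energy all spins lie on geodesics from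
the identity to `τ ⊕ τ`, so that their cycles are contained in those of `τ ⊕ τ` and they do lie in
`S_k × S_k`. Hence the variance is `O(1/D)` (`varMoment_isBigO`).

The geometry of the Cayley graph is reduced to linear algebra. The number of cycles of `π` is the
dimension of the space `fixSub π` of functions invariant under `π`. The triangle inequality for
`|π|` is then the dimension formula for `fixSub α ⊓ fixSub β`, which lies in `fixSub (α β)`, and
equality means that the two spaces are equal and that `fixSub α` and `fixSub β` span all
functions.
-/

namespace RTN

/-! ### Permutations: invariant functions and the Cayley length -/

section Perm

variable {N : Type*}

/-- The functions on `N` that are constant on the cycles of `π`. -/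
def fixSub (π : Equiv.Perm N) : Submodule ℝ (N → ℝ) where
  carrier := {f | ∀ i, f (π i) = f i}
  add_mem' hf hg i := by simp [hf i, hg i]
  zero_mem' i := rfl
  smul_mem' c f hf i := by simp [hf i]

theorem mem_fixSub {π : Equiv.Perm N} {f : N → ℝ} : f ∈ fixSub π ↔ ∀ i, f (π i) = f i := Iff.rfl

theorem fixSub_inv (π : Equiv.Perm N) : fixSub π⁻¹ = fixSub π := by
  ext f
  simp only [mem_fixSub]
  constructor <;> intro h i
  · have := h (π i); simpa using this.symm
  · have := h (π⁻¹ i); simpa using this.symm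

theorem fixSub_inf_le (α β : Equiv.Perm N) : fixSub α ⊓ fixSub β ≤ fixSub (α * β) := by
  rintro f ⟨ha, hb⟩ i
  rw [Equiv.Perm.mul_apply, ha, hb]

theorem fixSub_one : fixSub (1 : Equiv.Perm N) = ⊤ := by
  ext f; simp [mem_fixSub]

theorem apply_eq_of_sameCycle {π : Equiv.Perm N} {f : N → ℝ} (hf : f ∈ fixSub π) {i j : N}
    (h : π.SameCycle i j) : f i = f j := by
  have hpow : ∀ (n : ℕ) (i : N), f ((π ^ n) i) = f i := by
    intro n
    induction n with
    | zero => intro i; simp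
    | succ n ih => intro i; rw [pow_succ', Equiv.Perm.mul_apply, hf, ih]
  obtain ⟨z, rfl⟩ := h
  cases z with
  | ofNat n => simp [hpow]
  | negSucc n =>
    rw [zpow_negSucc, ← hpow (n + 1) ((π ^ (n + 1))⁻¹ i), ← Equiv.Perm.mul_apply, mul_inv_cancel,
      Equiv.Perm.one_apply]

theorem sameCycle_setoid_inv (π : Equiv.Perm N) :
    Equiv.Perm.SameCycle.setoid π⁻¹ = Equiv.Perm.SameCycle.setoid π := by
  ext i j
  exact Equiv.Perm.sameCycle_inv

variable [Fintype N]

/-- The Cayley length `|π|`: the number of points minus the number of cycles of `π`, the latter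
being the dimension of the space of invariant functions. -/
noncomputable def permLen (π : Equiv.Perm N) : ℕ :=
  Fintype.card N - Module.finrank ℝ (fixSub π)

theorem finrank_fixSub_le (π : Equiv.Perm N) :
    Module.finrank ℝ (fixSub π) ≤ Fintype.card N := by
  simpa using Submodule.finrank_le (fixSub π)

theorem permLen_add (π : Equiv.Perm N) :
    permLen π + Module.finrank ℝ (fixSub π) = Fintype.card N :=
  Nat.sub_add_cancel (finrank_fixSub_le π)

theorem permLen_inv (π : Equiv.Perm N) : permLen π⁻¹ = permLen π := by
  rw [permLen, fixSub_inv, permLen]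

theorem permLen_one : permLen (1 : Equiv.Perm N) = 0 := by
  rw [permLen, fixSub_one, finrank_top, Module.finrank_fintype_fun_eq_card, Nat.sub_self]

theorem permLen_eq_zero {π : Equiv.Perm N} (h : permLen π = 0) : π = 1 := by
  classical
  have h1 := permLen_add π
  have h2 : fixSub π = ⊤ := by
    apply Submodule.eq_top_of_finrank_eq
    simp; omega
  ext i
  have h3 : (Pi.single i 1 : N → ℝ) ∈ fixSub π := by rw [h2]; trivial
  by_contra hne
  have := h3 i
  rw [Pi.single_eq_of_ne (by simpa using hne), Pi.single_eq_same] at this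
  norm_num at this

/-- The triangle inequality: functions invariant under `α` and `β` are invariant under `α * β`, and
the spaces `U`, `W` of functions invariant under `α` and `β` satisfy
`dim U + dim W ≤ dim (U ⊓ W) + |N|`. -/
theorem permLen_mul_le (α β : Equiv.Perm N) : permLen (α * β) ≤ permLen α + permLen β := by
  have h1 := Submodule.finrank_sup_add_finrank_inf_eq (fixSub α) (fixSub β)
  have h2 := Submodule.finrank_mono (fixSub_inf_le α β)
  have h3 : Module.finrank ℝ ↥(fixSub α ⊔ fixSub β) ≤ Fintype.card N := by
    simpa using Submodule.finrank_le (fixSub α ⊔ fixSub β)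
  have := permLen_add α
  have := permLen_add β
  have := permLen_add (α * β)
  omega

/-- If `α` lies on a geodesic from `1` to `α * β`, then its cycles are contained in the cycles of
`α * β`. -/
theorem fixSub_le_of_permLen_mul {α β : Equiv.Perm N}
    (h : permLen α + permLen β ≤ permLen (α * β)) : fixSub (α * β) ≤ fixSub α := by
  have h1 := Submodule.finrank_sup_add_finrank_inf_eq (fixSub α) (fixSub β)
  have h3 : Module.finrank ℝ ↥(fixSub α ⊔ fixSub β) ≤ Fintype.card N := by
    simpa using Submodule.finrank_le (fixSub α ⊔ fixSub β)
  have h4 := permLen_add α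
  have h5 := permLen_add β
  have h6 := permLen_add (α * β)
  have := Submodule.eq_of_le_of_finrank_le (fixSub_inf_le α β) (by omega)
  rw [← this]
  exact inf_le_left

/-- The dimension formula when the two spaces of invariant functions span all functions; this is the
case of equality in the triangle inequality if their intersection is `fixSub (α * β)`. -/
theorem permLen_mul_of_sup {α β : Equiv.Perm N} (h : fixSub α ⊔ fixSub β = ⊤) :
    permLen α + permLen β = Fintype.card N - Module.finrank ℝ ↥(fixSub α ⊓ fixSub β) := by
  have h1 := Submodule.finrank_sup_add_finrank_inf_eq (fixSub α) (fixSub β)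
  rw [h, finrank_top, Module.finrank_fintype_fun_eq_card] at h1
  have := permLen_add α
  have := permLen_add β
  omega

/-! ### Products over cycles -/

open scoped Classical in
/-- The product of `f l` over the lengths `l` of all cycles of `π`, fixed points included. -/
noncomputable def cycProd {M : Type*} [CommMonoid M] (f : ℕ → M) (π : Equiv.Perm N) : M :=
  ∏ q : Quotient (Equiv.Perm.SameCycle.setoid π),
    f (Finset.univ.filter fun i => Quotient.mk _ i = q).card

theorem cycProd_mul {M : Type*} [CommMonoid M] (f g : ℕ → M) (π : Equiv.Perm N) :
    cycProd (fun l => f l * g l) π = cycProd f π * cycProd g π := by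
  simp [cycProd, Finset.prod_mul_distrib]

theorem cycProd_finset_prod {M ι : Type*} [CommMonoid M] (s : Finset ι) (f : ι → ℕ → M)
    (π : Equiv.Perm N) : cycProd (fun l => ∏ e ∈ s, f e l) π = ∏ e ∈ s, cycProd (f e) π := by
  simp only [cycProd]
  exact Finset.prod_comm

theorem cycProd_inv {M : Type*} [CommMonoid M] (f : ℕ → M) (π : Equiv.Perm N) :
    cycProd f π⁻¹ = cycProd f π := by
  unfold cycProd
  rw [sameCycle_setoid_inv]

/-- The space of invariant functions has one dimension for every cycle. -/
theorem finrank_fixSub (π : Equiv.Perm N) :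
    Module.finrank ℝ (fixSub π) = Nat.card (Quotient (Equiv.Perm.SameCycle.setoid π)) := by
  classical
  let F : (Quotient (Equiv.Perm.SameCycle.setoid π) → ℝ) ≃ₗ[ℝ] fixSub π :=
    { toFun := fun g => ⟨fun i => g (Quotient.mk _ i), fun i => by
        exact congrArg g (Quotient.sound
          (Equiv.Perm.sameCycle_apply_left.2 (Equiv.Perm.SameCycle.refl _ _)))⟩
      map_add' := fun _ _ => rfl
      map_smul' := fun _ _ => rfl
      invFun := fun f q => Quotient.lift f.1 (fun _ _ h => apply_eq_of_sameCycle f.2 h) q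
      left_inv := fun g => by ext q; induction q using Quotient.ind; rfl
      right_inv := fun f => by ext i; rfl }
  rw [← F.finrank_eq, Module.finrank_fintype_fun_eq_card, Nat.card_eq_fintype_card]

/-- Multiplying over the cycles the factors `c ^ (l - 1)` gives `c ^ |π|`. -/
theorem cycProd_pow {M : Type*} [CommMonoid M] (c : M) (π : Equiv.Perm N) :
    cycProd (fun l => c ^ (l - 1)) π = c ^ permLen π := by
  classical
  unfold cycProd
  rw [Finset.prod_pow_eq_pow_sum]
  congr 1
  have h1 : ∀ q : Quotient (Equiv.Perm.SameCycle.setoid π),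
      1 ≤ (Finset.univ.filter fun i => Quotient.mk _ i = q).card := by
    intro q
    induction q using Quotient.ind with
    | _ i => exact Finset.card_pos.2 ⟨i, by simp⟩
  have h2 : ∑ q : Quotient (Equiv.Perm.SameCycle.setoid π),
      (Finset.univ.filter fun i => Quotient.mk _ i = q).card = Fintype.card N := by
    rw [← Finset.card_univ]
    exact (Finset.card_eq_sum_card_fiberwise (fun _ _ => Finset.mem_coe.2 (Finset.mem_univ _))).symm
  have h3 : ∑ q : Quotient (Equiv.Perm.SameCycle.setoid π),
      ((Finset.univ.filter fun i => Quotient.mk _ i = q).card - 1)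
      + Fintype.card (Quotient (Equiv.Perm.SameCycle.setoid π)) = Fintype.card N := by
    rw [← h2, ← Finset.card_univ, Finset.card_eq_sum_ones, ← Finset.sum_add_distrib]
    exact Finset.sum_congr rfl fun q _ => Nat.sub_add_cancel (h1 q)
  have h4 := permLen_add π
  rw [finrank_fixSub, Nat.card_eq_fintype_card] at h4
  omega

theorem cycProd_one {M : Type*} [CommMonoid M] (f : ℕ → M) (hf : f 1 = 1) :
    cycProd f (1 : Equiv.Perm N) = 1 := by
  classical
  unfold cycProd
  apply Finset.prod_eq_one
  intro q _
  induction q using Quotient.ind with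
  | _ i =>
    convert hf
    rw [Finset.card_eq_one]
    refine ⟨i, ?_⟩
    ext j
    simp only [Finset.mem_filter, Finset.mem_univ, true_and, Finset.mem_singleton]
    rw [Quotient.eq]
    exact Equiv.Perm.sameCycle_one

/-- The trace of a permutation operator weighted with a diagonal tensor power factorizes over the
cycles. -/
theorem sum_prod_fixed {R ι : Type*} [CommSemiring R] [Fintype ι] [DecidableEq ι]
    [DecidableEq N] (w : ι → R) (π : Equiv.Perm N) :
    ∑ i : N → ι, (if ∀ j, i (π j) = i j then ∏ j, w (i j) else 0)
      = cycProd (fun l => ∑ m, w m ^ l) π := by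
  classical
  unfold cycProd
  rw [Finset.prod_univ_sum, ← Finset.sum_filter]
  symm
  have hinv : ∀ (i : N → ι), (∀ j, i (π j) = i j) → ∀ a b, π.SameCycle a b → i a = i b := by
    intro i hi a b hab
    by_contra hne
    have := apply_eq_of_sameCycle (π := π) (f := fun j => if i j = i a then 1 else 0)
      (fun j => by simp only [hi]) hab
    simp [Ne.symm hne] at this
  refine Finset.sum_bij' (i := fun g _ j => g (Quotient.mk _ j))
    (j := fun i hi q => Quotient.lift i
      (fun a b h => hinv i (Finset.mem_filter.1 hi).2 a b h) q) ?_ ?_ ?_ ?_ ?_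
  · intro g _
    simp only [Finset.mem_filter, Finset.mem_univ, true_and]
    intro j
    exact congrArg g (Quotient.sound
      (Equiv.Perm.sameCycle_apply_left.2 (Equiv.Perm.SameCycle.refl _ _)))
  · intro i _
    simp
  · intro g _
    ext q
    induction q using Quotient.ind
    rfl
  · intro i _
    rfl
  · intro g _
    rw [← Finset.prod_fiberwise Finset.univ
      (fun j => (Quotient.mk (Equiv.Perm.SameCycle.setoid π) j)) (fun j => w (g (Quotient.mk _ j)))]
    refine Finset.prod_congr rfl fun q _ => ?_
    rw [Finset.prod_congr rfl (g := fun _ => w (g q)), Finset.prod_const]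
    intro j hj
    rw [(Finset.mem_filter.1 hj).2]

/-- `Equiv.Perm.partition` lists the cycle lengths of `Equiv.Perm.cycleType` together with a `1` for
each fixed point, so that its parts correspond to the classes of `Equiv.Perm.SameCycle`. -/
theorem cycProd_eq_parts [DecidableEq N] {M : Type*} [CommMonoid M] (f : ℕ → M)
    (π : Equiv.Perm N) : cycProd f π = (π.partition.parts.map f).prod := by
  classical
  rw [Equiv.Perm.parts_partition, Multiset.map_add, Multiset.prod_add, Multiset.map_replicate,
    Multiset.prod_replicate]
  unfold cycProd
  set Q := Quotient (Equiv.Perm.SameCycle.setoid π)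
  rw [← Finset.prod_filter_mul_prod_filter_not Finset.univ (fun q : Q => q.out ∈ π.support)]
  have hout : ∀ q : Q, (Quotient.mk _ q.out : Q) = q := fun q => q.out_eq
  have hfib : ∀ q : Q, (Finset.univ.filter fun i => (Quotient.mk _ i : Q) = q)
      = Finset.univ.filter fun i => π.SameCycle i q.out := by
    intro q
    ext i
    simp only [Finset.mem_filter, Finset.mem_univ, true_and]
    conv_lhs => rw [← hout q]
    rw [Quotient.eq]
    rfl
  congr 1
  · rw [Equiv.Perm.cycleType_def, Multiset.map_map, ← Finset.prod_eq_multiset_prod]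
    refine Finset.prod_bij (fun q _ => π.cycleOf q.out) ?_ ?_ ?_ ?_
    · intro q hq
      exact Equiv.Perm.cycleOf_mem_cycleFactorsFinset_iff.2 (Finset.mem_filter.1 hq).2
    · intro q hq q' hq' h
      rw [← hout q, ← hout q']
      apply Quotient.sound
      have h1 : q'.out ∈ (π.cycleOf q.out).support := by
        rw [h, Equiv.Perm.mem_support_cycleOf_iff]
        exact ⟨Equiv.Perm.SameCycle.refl _ _, (Finset.mem_filter.1 hq').2⟩
      exact (Equiv.Perm.mem_support_cycleOf_iff.1 h1).1
    · intro c hc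
      obtain ⟨i, hi, hc'⟩ : ∃ i, i ∈ π.support ∧ c = π.cycleOf i := by
        have h1 := (Equiv.Perm.mem_cycleFactorsFinset_iff.1 hc).1
        obtain ⟨i, hi, -⟩ := h1
        have his : i ∈ c.support := Equiv.Perm.mem_support.2 hi
        exact ⟨i, Equiv.Perm.mem_cycleFactorsFinset_support_le hc his,
          Equiv.Perm.cycle_is_cycleOf his hc⟩
      have hs : π.SameCycle (Quotient.mk _ i : Q).out i := Quotient.exact (hout (Quotient.mk _ i))
      refine ⟨Quotient.mk _ i, ?_, ?_⟩
      · simp only [Finset.mem_filter, Finset.mem_univ, true_and]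
        exact hs.mem_support_iff.2 hi
      · rw [hc', hs.cycleOf_eq]
    · intro q hq
      rw [hfib]
      simp only [Function.comp_apply]
      congr 2
      ext i
      rw [Equiv.Perm.mem_support_cycleOf_iff]
      simp only [Finset.mem_filter, Finset.mem_univ, true_and]
      constructor
      · exact fun h => ⟨h.symm, (Finset.mem_filter.1 hq).2⟩
      · exact fun h => h.1.symm
  · rw [Finset.prod_congr rfl (g := fun _ => f 1), Finset.prod_const]
    · congr 1
      rw [← Finset.card_compl]
      refine Finset.card_bij (fun q _ => q.out) ?_ ?_ ?_
      · intro q hq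
        simpa using hq
      · intro q _ q' _ h
        rw [← hout q, ← hout q', h]
      · intro i hi
        have hi' : π i = i := by simpa using hi
        have hs : (Quotient.mk _ i : Q).out = i := by
          have : π.SameCycle i (Quotient.mk _ i : Q).out :=
            (Quotient.exact (hout (Quotient.mk _ i))).symm
          exact (this.eq_of_left hi').symm
        exact ⟨Quotient.mk _ i, by simpa [hs] using hi', hs⟩
    · intro q hq
      have hq' : π q.out = q.out := by simpa using hq
      rw [hfib]
      congr 1
      rw [Finset.card_eq_one]
      refine ⟨q.out, ?_⟩
      ext i
      simp only [Finset.mem_filter, Finset.mem_univ, true_and, Finset.mem_singleton]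
      constructor
      · intro h
        exact h.eq_of_right hq'
      · rintro rfl
        exact Equiv.Perm.SameCycle.refl _ _

theorem permLen_eq_parts [DecidableEq N] (π : Equiv.Perm N) :
    permLen π = (π.partition.parts.map fun l => l - 1).sum := by
  have h := cycProd_eq_parts (fun l => Multiplicative.ofAdd (1 : ℕ) ^ (l - 1)) π
  rw [cycProd_pow] at h
  have h2 := congrArg Multiplicative.toAdd h
  have h3 : Multiplicative.toAdd (Multiset.map
      (fun l => Multiplicative.ofAdd (1 : ℕ) ^ (l - 1)) π.partition.parts).prod
      = (π.partition.parts.map fun l => l - 1).sum := by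
    generalize π.partition.parts = s
    induction s using Multiset.induction with
    | empty => simp
    | cons a s ih => simp [ih]
  rw [h3] at h2
  simpa using h2

theorem permProd_eq_cycProd {k : ℕ} (f : ℕ → ℝ) (π : Equiv.Perm (Fin k)) :
    permProd f π = cycProd f π := (cycProd_eq_parts f π).symm

theorem cayleyDist_eq_permLen {k : ℕ} (π σ : Equiv.Perm (Fin k)) :
    cayleyDist π σ = permLen (π⁻¹ * σ) := (permLen_eq_parts _).symm

theorem cycProd_conj {M : Type*} [CommMonoid M] (f : ℕ → M) {π ρ : Equiv.Perm N}
    (h : IsConj π ρ) : cycProd f π = cycProd f ρ := by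
  classical
  rw [cycProd_eq_parts, cycProd_eq_parts, Equiv.Perm.partition_eq_of_isConj.1 h]

theorem permLen_conj {π ρ : Equiv.Perm N} (h : IsConj π ρ) : permLen π = permLen ρ := by
  classical
  rw [permLen_eq_parts, permLen_eq_parts, Equiv.Perm.partition_eq_of_isConj.1 h]

theorem sign_eq_permLen [DecidableEq N] (π : Equiv.Perm N) :
    Equiv.Perm.sign π = (-1) ^ permLen π := by
  rw [Equiv.Perm.sign_of_cycleType, permLen_eq_parts, Equiv.Perm.parts_partition]
  simp only [Multiset.map_add, Multiset.sum_add, Multiset.map_replicate, Nat.sub_self,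
    Multiset.sum_replicate, smul_zero, add_zero]
  have h : ∀ s : Multiset ℕ, (∀ l ∈ s, 2 ≤ l) →
      s.sum + s.card = (s.map fun l => l - 1).sum + 2 * s.card := by
    intro s
    induction s using Multiset.induction with
    | empty => simp
    | cons a s ih =>
      intro hs
      have := ih fun l hl => hs l (Multiset.mem_cons_of_mem hl)
      have := hs a (Multiset.mem_cons_self a s)
      simp only [Multiset.sum_cons, Multiset.card_cons, Multiset.map_cons]
      omega
  rw [h _ fun l hl => Equiv.Perm.two_le_of_mem_cycleType hl, pow_add, pow_mul]
  simp

/-- A transposition of two points of one cycle of `π` splits this cycle. -/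
theorem permLen_swap_mul_lt [DecidableEq N] {π : Equiv.Perm N} {p q : N} (hpq : p ≠ q)
    (h : π.SameCycle p q) : permLen (Equiv.swap p q * π) < permLen π := by
  have h1 : fixSub π ≤ fixSub (Equiv.swap p q * π) := by
    intro f hf i
    have hf' := apply_eq_of_sameCycle hf h
    rw [← hf i, Equiv.Perm.mul_apply]
    by_cases h1 : π i = p
    · rw [h1, Equiv.swap_apply_left, hf']
    by_cases h2 : π i = q
    · rw [h2, Equiv.swap_apply_right, hf']
    rw [Equiv.swap_apply_of_ne_of_ne h1 h2]
  have h2 := Submodule.finrank_mono h1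
  have h3 := permLen_add π
  have h4 := permLen_add (Equiv.swap p q * π)
  -- multiplying by a transposition changes the sign, hence the parity of the length
  have h5 : permLen (Equiv.swap p q * π) ≠ permLen π := by
    intro h5
    have h6 := sign_eq_permLen (Equiv.swap p q * π)
    rw [h5, ← sign_eq_permLen, Equiv.Perm.sign_mul, Equiv.Perm.sign_swap hpq] at h6
    rcases Int.units_eq_one_or (Equiv.Perm.sign π) with h7 | h7 <;> rw [h7] at h6 <;>
      exact absurd h6 (by decide)
  omega

theorem permLen_swap_le [DecidableEq N] (p q : N) : permLen (Equiv.swap p q) ≤ 1 := by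
  rcases eq_or_ne p q with rfl | hpq
  · rw [Equiv.swap_self]
    exact (permLen_one (N := N)).le.trans zero_le_one
  · rw [permLen_eq_parts, Equiv.Perm.parts_partition, (Equiv.Perm.isCycle_swap hpq).cycleType,
      Equiv.Perm.card_support_swap hpq]
    simp

end Perm

/-! ### Non-crossing partitions and geodesics -/

section NonCrossing

variable {m : ℕ}

theorem fixSub_finRotate : fixSub (finRotate (m + 1)) = Submodule.span ℝ {fun _ => (1 : ℝ)} := by
  apply le_antisymm
  · intro f hf
    rw [Submodule.mem_span_singleton]
    refine ⟨f 0, ?_⟩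
    ext i
    have h : ∀ n : ℕ, ∀ h : n < m + 1, f 0 = f ⟨n, h⟩ := by
      intro n
      induction n with
      | zero => intro _; rfl
      | succ n ih =>
        intro h
        rw [ih (by omega), ← hf ⟨n, by omega⟩]
        congr 1
        ext
        rw [coe_finRotate_of_ne_last (by intro hh; rw [Fin.ext_iff] at hh; simp at hh; omega)]
    simpa using h i i.2
  · rw [Submodule.span_singleton_le_iff_mem]
    intro i
    rfl

theorem permLen_finRotate : permLen (finRotate (m + 1)) = m := by
  have h := permLen_add (finRotate (m + 1))
  rw [fixSub_finRotate, finrank_span_singleton] at h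
  · simpa using h
  · intro h0
    simpa using congrFun h0 0

theorem cycProd_finRotate {M : Type*} [CommMonoid M] (f : ℕ → M) :
    cycProd f (finRotate (m + 1)) = f (m + 1) := by
  classical
  have h1 : ∀ i : Fin (m + 1), (finRotate (m + 1)).SameCycle 0 i := by
    intro i
    have h2 : (fun j => if (finRotate (m + 1)).SameCycle 0 j then (1 : ℝ) else 0)
        ∈ fixSub (finRotate (m + 1)) := fun j => by
      simp only [Equiv.Perm.sameCycle_apply_right]
    rw [fixSub_finRotate, Submodule.mem_span_singleton] at h2
    obtain ⟨c, hc⟩ := h2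
    by_contra hn
    have h3 := congrFun hc 0
    have h4 := congrFun hc i
    simp only [Pi.smul_apply, Equiv.Perm.SameCycle.refl, if_true] at h3
    simp only [Pi.smul_apply, hn, if_false] at h4
    rw [h3] at h4
    norm_num at h4
  have h2 : ∀ i : Fin (m + 1), (Quotient.mk (Equiv.Perm.SameCycle.setoid (finRotate (m + 1))) i)
      = Quotient.mk _ 0 := fun i => Quotient.sound (h1 i).symm
  unfold cycProd
  rw [Fintype.prod_eq_single (Quotient.mk _ 0)]
  · congr 1
    simp [h2]
  · intro q hq
    induction q using Quotient.ind with
    | _ i => exact absurd (h2 i) hq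

/-- The indicator function of the interval `[p, q)`. -/
noncomputable def icoInd (p q : Fin (m + 1)) : Fin (m + 1) → ℝ :=
  fun i => if p ≤ i ∧ i < q then 1 else 0

/-- Multiplying the long cycle by `(p q)` splits off the cycle formed by the interval `[p, q)`. -/
theorem icoInd_mem_fixSub {p q : Fin (m + 1)} (hpq : p < q) :
    icoInd p q ∈ fixSub (Equiv.swap p q * finRotate (m + 1)) := by
  intro i
  rw [Equiv.Perm.mul_apply]
  have key : (p ≤ Equiv.swap p q (finRotate (m + 1) i) ∧
      Equiv.swap p q (finRotate (m + 1) i) < q) ↔ (p ≤ i ∧ i < q) := by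
    have hi := i.2
    have hq := q.2
    have hlast : ((finRotate (m + 1) i : Fin (m + 1)) : ℕ) = 0 ∧ (i : ℕ) = m ∨
        ((finRotate (m + 1) i : Fin (m + 1)) : ℕ) = i + 1 := by
      rcases eq_or_ne i (Fin.last m) with rfl | h
      · left; simp
      · right; exact coe_finRotate_of_ne_last h
    generalize finRotate (m + 1) i = j at hlast
    by_cases h1 : j = p
    · rw [h1, Equiv.swap_apply_left]
      subst h1
      simp only [Fin.lt_def, Fin.le_def] at *
      rcases hlast with ⟨h, h'⟩ | h
      · omega
      · omega
    by_cases h2 : j = q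
    · rw [h2, Equiv.swap_apply_right]
      subst h2
      simp only [Fin.lt_def, Fin.le_def] at *
      rcases hlast with ⟨h, h'⟩ | h
      · omega
      · omega
    rw [Equiv.swap_apply_of_ne_of_ne h1 h2]
    simp only [Fin.lt_def, Fin.le_def, Fin.ext_iff] at *
    rcases hlast with ⟨h, h'⟩ | h
    · omega
    · omega
  simp only [icoInd, key]

/-- The cycles of a geodesic permutation, cut by `(p q)`, do not straddle the interval `[p, q)`. -/
theorem icoInd_mem_fixSub_of_geodesic {π : Equiv.Perm (Fin (m + 1))}
    (h : permLen π + permLen (π⁻¹ * finRotate (m + 1)) ≤ m) {p q : Fin (m + 1)} (hpq : p < q)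
    (hs : π.SameCycle p q) : icoInd p q ∈ fixSub (Equiv.swap p q * π) := by
  have h1 := permLen_swap_mul_lt hpq.ne hs
  have h2 : (Equiv.swap p q * π) * (π⁻¹ * finRotate (m + 1))
      = Equiv.swap p q * finRotate (m + 1) := by group
  have h3 : m ≤ 1 + permLen (Equiv.swap p q * finRotate (m + 1)) := by
    have h4 := permLen_mul_le (Equiv.swap p q) (Equiv.swap p q * finRotate (m + 1))
    rw [← mul_assoc, Equiv.swap_mul_self, one_mul, permLen_finRotate] at h4
    have := permLen_swap_le p q
    omega
  have h5 := fixSub_le_of_permLen_mul (α := Equiv.swap p q * π)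
    (β := π⁻¹ * finRotate (m + 1)) (by rw [h2]; omega)
  rw [h2] at h5
  exact h5 (icoInd_mem_fixSub hpq)

/-- Crossings and descents inside a cycle are both excluded by cutting the cycle at two of its
points and testing with the indicator of the interval between them. -/
theorem mem_NC_of_geodesic {π : Equiv.Perm (Fin (m + 1))}
    (h : permLen π + permLen (π⁻¹ * finRotate (m + 1)) ≤ m) : π ∈ NC (m + 1) := by
  classical
  simp only [NC, Finset.mem_filter, Finset.mem_univ, true_and]
  constructor
  · intro a b c d hab hbc hcd hac hbd
    have hac' : π.SameCycle a c := hac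
    have hbd' : π.SameCycle b d := hbd
    change π.SameCycle a b
    by_contra hn
    have h1 := icoInd_mem_fixSub_of_geodesic h (hab.trans hbc) hac'
    -- the indicator of the cycle of `b`, cut by the interval `[a, c)`, is invariant under `π`
    let f : Fin (m + 1) → ℝ := fun i => if π.SameCycle i b then icoInd a c i else 0
    have hf : f ∈ fixSub π := by
      intro i
      simp only [f, Equiv.Perm.sameCycle_apply_left]
      split_ifs with hi
      · rw [← h1 i, Equiv.Perm.mul_apply, Equiv.swap_apply_of_ne_of_ne]
        · rintro h2
          apply hn
          rw [← h2]
          exact Equiv.Perm.sameCycle_apply_left.2 hi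
        · rintro h2
          apply hn
          refine hac'.trans ?_
          rw [← h2]
          exact Equiv.Perm.sameCycle_apply_left.2 hi
      · rfl
    have h2 := apply_eq_of_sameCycle hf hbd'
    simp only [f, icoInd, Equiv.Perm.SameCycle.refl, hbd'.symm, if_true, hab.le, hbc, true_and,
      hcd.not_gt, and_false, if_false] at h2
    norm_num at h2
  · -- `swap (π i) j * π` sends `i` to `j`, so both or neither lie in the interval between `π i`
    -- and `j`; this says that `π` permutes each cycle in increasing order
    have key : ∀ i j : Fin (m + 1), π.SameCycle i j →
        (j < π i → j ≤ i ∧ i < π i) ∧ (π i < j → i < π i ∨ j ≤ i) := by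
      intro i j hij
      have hij' : π.SameCycle (π i) j := Equiv.Perm.sameCycle_apply_left.2 hij
      have h3 : (Equiv.swap (π i) j * π) i = j := by simp
      constructor
      · intro hlt
        have h1 := icoInd_mem_fixSub_of_geodesic h hlt hij'.symm
        rw [Equiv.swap_comm] at h1
        have h2 := h1 i
        rw [h3] at h2
        simp only [icoInd, le_refl, hlt, and_self, if_true] at h2
        by_contra hn
        rw [if_neg hn] at h2
        norm_num at h2
      · intro hlt
        have h1 := icoInd_mem_fixSub_of_geodesic h hlt hij'
        have h2 := h1 i
        rw [h3] at h2
        simp only [icoInd, lt_irrefl, and_false, if_false] at h2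
        by_contra hn
        push Not at hn
        rw [if_pos hn] at h2
        norm_num at h2
    intro i
    rcases lt_or_ge i (π i) with hi | hi
    · left
      refine ⟨hi, fun j hij hlt => ?_⟩
      by_contra hn
      exact absurd ((key i j hij).1 (not_le.1 hn)).1 (not_le.2 hlt)
    · right
      intro j hij
      have h1 : π i ≤ j := by
        by_contra hn
        exact absurd ((key i j hij).1 (not_le.1 hn)).2 (not_lt.2 hi)
      refine ⟨h1, ?_⟩
      rcases h1.eq_or_lt with h2 | h2
      · exact h2 ▸ hi
      · exact ((key i j hij).2 h2).resolve_left (not_lt.2 hi)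

/-- For a non-crossing partition, the invariant functions of `π` and of its Kreweras complement span
all functions: they contain every `δ_i`. -/
theorem sup_fixSub_eq_top_of_mem_NC {π : Equiv.Perm (Fin (m + 1))} (h : π ∈ NC (m + 1)) :
    fixSub π ⊔ fixSub (π⁻¹ * finRotate (m + 1)) = ⊤ := by
  classical
  simp only [NC, Finset.mem_filter, Finset.mem_univ, true_and] at h
  obtain ⟨hnc, hinc⟩ := h
  have hnc' : ∀ a b c d : Fin (m + 1), a < b → b < c → c < d → π.SameCycle a c →
    π.SameCycle b d → π.SameCycle a b := hnc
  set S := fixSub π ⊔ fixSub (π⁻¹ * finRotate (m + 1)) with hS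
  -- `δ_i` is the difference of the indicators of `[i, π i)` and of the open interval `(i, π i)`
  have h1 : ∀ i, i < π i → (Pi.single i 1 : Fin (m + 1) → ℝ) ∈ S := by
    intro i hi
    have hsucc := ((hinc i).resolve_right fun hh =>
      absurd ((hh i (Equiv.Perm.SameCycle.refl _ _)).1) (not_le.2 hi)).2
    let f : Fin (m + 1) → ℝ := fun j => if i < j ∧ j < π i then 1 else 0
    have hf : f ∈ fixSub π := by
      -- a block meeting the gap between `i` and its successor `π i` cannot leave it
      have hstep : ∀ a b, π.SameCycle a b → (i < a ∧ a < π i) → (i < b ∧ b < π i) := by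
        intro a b hab ha
        have hna : ¬ π.SameCycle i a := fun hh => absurd (hsucc a hh ha.1) (not_le.2 ha.2)
        have hnb : ¬ π.SameCycle i b := fun hh => hna (hh.trans hab.symm)
        have hii : π.SameCycle i (π i) :=
          Equiv.Perm.sameCycle_apply_right.2 (Equiv.Perm.SameCycle.refl _ _)
        rcases lt_trichotomy b i with h | h | h
        · exact absurd ((hnc' b i a (π i) h ha.1 ha.2 hab.symm hii).symm) hnb
        · exact absurd (h ▸ Equiv.Perm.SameCycle.refl _ _) hnb
        · refine ⟨h, ?_⟩
          rcases lt_trichotomy b (π i) with h' | h' | h'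
          · exact h'
          · exact absurd (h' ▸ hii) hnb
          · exact absurd (hnc' i a (π i) b ha.1 ha.2 h' hii hab) hna
      intro j
      have hj : π.SameCycle (π j) j :=
        Equiv.Perm.sameCycle_apply_left.2 (Equiv.Perm.SameCycle.refl _ _)
      have : (i < π j ∧ π j < π i) ↔ (i < j ∧ j < π i) :=
        ⟨hstep _ _ hj, hstep _ _ hj.symm⟩
      simp only [f, this]
    have hg : icoInd i (π i) ∈ fixSub (π⁻¹ * finRotate (m + 1)) := by
      rw [← fixSub_inv]
      intro j
      have hj : (π⁻¹ * finRotate (m + 1))⁻¹ j = (finRotate (m + 1))⁻¹ (π j) := by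
        simp [mul_inv_rev]
      rw [hj]
      set l := (finRotate (m + 1))⁻¹ (π j) with hl
      have hl' : finRotate (m + 1) l = π j := by simp [hl]
      have hfj : f (π j) = f j := hf j
      have hlast : ((π j : Fin (m + 1)) : ℕ) = 0 ∧ (l : ℕ) = m ∨
          ((π j : Fin (m + 1)) : ℕ) = l + 1 := by
        rw [← hl']
        rcases eq_or_ne l (Fin.last m) with h | h
        · left; simp [h]
        · right; exact coe_finRotate_of_ne_last h
      have hb := (π i).2
      have hlb := l.2
      have key : (i ≤ l ∧ l < π i) ↔ (i ≤ j ∧ j < π i) := by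
        by_cases hji : j = i
        · subst hji
          simp only [Fin.lt_def, Fin.le_def] at *
          rcases hlast with ⟨h, h'⟩ | h
          · omega
          · omega
        · have hne : π j ≠ π i := fun hh => hji (π.injective hh)
          have hfj' : (i < π j ∧ π j < π i) ↔ (i < j ∧ j < π i) := by
            simp only [f] at hfj
            by_cases ha : (i < π j ∧ π j < π i) <;> by_cases hb : (i < j ∧ j < π i) <;>
              simp [ha, hb] at hfj ⊢
          simp only [Fin.lt_def, Fin.le_def, Fin.ext_iff, ne_eq] at *
          rcases hlast with ⟨h, h'⟩ | h
          · omega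
          · omega
      simp only [icoInd, key]
    have hsub : (Pi.single i 1 : Fin (m + 1) → ℝ) = icoInd i (π i) - f := by
      ext j
      simp only [Pi.single_apply, icoInd, f, Pi.sub_apply]
      rcases lt_trichotomy i j with h | h | h
      · simp [h, h.le, h.ne']
      · subst h; simp [hi]
      · simp [h.ne, h.not_ge, h.not_gt]
    rw [hsub]
    exact S.sub_mem (Submodule.mem_sup_right hg) (Submodule.mem_sup_left hf)
  -- at the largest element of a block, subtract the other `δ_l` from the indicator of the block
  have h2 : ∀ i, (Pi.single i 1 : Fin (m + 1) → ℝ) ∈ S := by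
    intro i
    by_cases hi : i < π i
    · exact h1 i hi
    have hmax := (hinc i).resolve_left fun hh => hi hh.1
    have hB : (fun j => if π.SameCycle i j then (1 : ℝ) else 0) ∈ fixSub π := by
      intro j
      simp only [Equiv.Perm.sameCycle_apply_right]
    have hsum : (fun j => if π.SameCycle i j then (1 : ℝ) else 0)
        = ∑ l ∈ Finset.univ.filter (fun l => π.SameCycle i l),
            (Pi.single l 1 : Fin (m + 1) → ℝ) := by
      ext j
      simp [Finset.sum_apply, Pi.single_apply, Finset.sum_ite_eq]
    rw [hsum, ← Finset.add_sum_erase _ _ (a := i)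
      (by simp [Equiv.Perm.SameCycle.refl])] at hB
    have hrest : ∑ l ∈ (Finset.univ.filter (fun l => π.SameCycle i l)).erase i,
        (Pi.single l 1 : Fin (m + 1) → ℝ) ∈ S := by
      apply Submodule.sum_mem
      intro l hl
      rw [Finset.mem_erase, Finset.mem_filter] at hl
      apply h1
      have hll := hl.2.2
      by_contra hn
      have hmax' := (hinc l).resolve_left fun hh => hn hh.1
      exact hl.1 (le_antisymm (hmax l hll).2 (hmax' i hll.symm).2)
    have := S.sub_mem (Submodule.mem_sup_left hB) hrest
    simpa using this
  rw [eq_top_iff]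
  intro f _
  rw [pi_eq_sum_univ' f]
  apply Submodule.sum_mem
  intro i _
  apply Submodule.smul_mem
  exact h2 i

/-- The non-crossing partitions are the permutations on a geodesic from the identity to the long
cycle. -/
theorem mem_NC_iff {π : Equiv.Perm (Fin (m + 1))} :
    π ∈ NC (m + 1) ↔ permLen π + permLen (π⁻¹ * finRotate (m + 1)) = m := by
  constructor
  · intro h
    have h1 := permLen_mul_of_sup (sup_fixSub_eq_top_of_mem_NC h)
    have h2 := permLen_mul_le π (π⁻¹ * finRotate (m + 1))
    rw [mul_inv_cancel_left, permLen_finRotate] at h2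
    -- both permutations leave the constant functions invariant
    have h3 : 1 ≤ Module.finrank ℝ ↥(fixSub π ⊓ fixSub (π⁻¹ * finRotate (m + 1))) := by
      have h4 : (Submodule.span ℝ {fun _ : Fin (m + 1) => (1 : ℝ)})
          ≤ fixSub π ⊓ fixSub (π⁻¹ * finRotate (m + 1)) := by
        rw [Submodule.span_singleton_le_iff_mem]
        exact ⟨fun i => rfl, fun i => rfl⟩
      have h5 := Submodule.finrank_mono h4
      rw [finrank_span_singleton] at h5
      · exact h5
      · intro h0
        simpa using congrFun h0 0
    rw [Fintype.card_fin] at h1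
    omega
  · exact fun h => mem_NC_of_geodesic h.le

end NonCrossing

/-! ### Moments of complex Gaussian variables -/

section Gaussian

theorem measurable_stdComplexGaussian_map : Measurable fun p : ℝ × ℝ =>
    ((p.1 : ℂ) + (p.2 : ℂ) * Complex.I) / ((Real.sqrt 2 : ℝ) : ℂ) := by
  fun_prop

/-- The law has the density `exp (-|z|²) / π` on the complex plane. -/
theorem integral_stdComplexGaussian (f : ℂ → ℂ) (hf : Continuous f) :
    ∫ z, f z ∂stdComplexGaussian
      = ((Real.pi⁻¹ : ℝ) : ℂ) * ∫ z : ℂ, ((Real.exp (-‖z‖ ^ (2 : ℝ)) : ℝ) : ℂ) * f z := by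
  unfold stdComplexGaussian
  rw [integral_map measurable_stdComplexGaussian_map.aemeasurable hf.aestronglyMeasurable,
    gaussianReal_of_var_ne_zero 0 one_ne_zero,
    prod_withDensity (measurable_gaussianPDF 0 1) (measurable_gaussianPDF 0 1),
    integral_withDensity_eq_integral_toReal_smul
      (f := fun p : ℝ × ℝ => gaussianPDF 0 1 p.1 * gaussianPDF 0 1 p.2)
      (((measurable_gaussianPDF 0 1).comp measurable_fst).mul
        ((measurable_gaussianPDF 0 1).comp measurable_snd))
      (ae_of_all _ fun p => ENNReal.mul_lt_top gaussianPDF_lt_top gaussianPDF_lt_top),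
    ← Measure.volume_eq_prod,
    ← Complex.volume_preserving_equiv_real_prod.symm.symm.integral_comp
      (MeasurableEquiv.measurableEmbedding _)]
  have h2 : (0 : ℝ) < Real.sqrt 2 := Real.sqrt_pos.2 (by norm_num)
  have h2' : ((Real.sqrt 2 : ℝ) : ℂ) ≠ 0 := by exact_mod_cast h2.ne'
  have hcomp := Measure.integral_comp_inv_smul_of_nonneg (volume : Measure ℂ)
    (fun z : ℂ => ((Real.exp (-‖z‖ ^ (2 : ℝ)) : ℝ) : ℂ) * f z) h2.le
  rw [Complex.finrank_real_complex, Real.sq_sqrt (by norm_num)] at hcomp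
  -- the substitution `z ↦ z / √2` has Jacobian `1 / 2` on the plane
  have h3 : ∫ z : ℂ, ((Real.exp (-‖z‖ ^ (2 : ℝ)) : ℝ) : ℂ) * f z
      = (2 : ℂ)⁻¹ * ∫ z : ℂ, ((Real.exp (-‖(Real.sqrt 2)⁻¹ • z‖ ^ (2 : ℝ)) : ℝ) : ℂ)
          * f ((Real.sqrt 2)⁻¹ • z) := by
    rw [hcomp, Complex.real_smul]
    push_cast
    ring
  rw [h3, ← mul_assoc, ← integral_const_mul]
  congr 1
  ext z
  simp only [MeasurableEquiv.symm_symm, Complex.measurableEquivRealProd_apply, Complex.re_add_im]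
  have h4 : z / ((Real.sqrt 2 : ℝ) : ℂ) = (Real.sqrt 2)⁻¹ • z := by
    rw [Complex.real_smul]
    push_cast
    field_simp
  rw [h4, Complex.real_smul, ← mul_assoc]
  congr 1
  rw [ENNReal.toReal_mul, toReal_gaussianPDF, toReal_gaussianPDF, gaussianPDFReal,
    gaussianPDFReal, norm_smul, Real.rpow_two, mul_pow, Real.norm_of_nonneg (by positivity),
    inv_pow, Real.sq_sqrt (by norm_num), Complex.sq_norm, Complex.normSq_apply]
  have h5 : (Real.sqrt (2 * Real.pi * ((1 : NNReal) : ℝ)))⁻¹ *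
      (Real.sqrt (2 * Real.pi * ((1 : NNReal) : ℝ)))⁻¹ = Real.pi⁻¹ * 2⁻¹ := by
    rw [← mul_inv, Real.mul_self_sqrt (by positivity)]
    simp [mul_comm]
  rw [mul_mul_mul_comm, h5, ← Real.exp_add]
  push_cast
  congr 2
  ring

theorem memLp_id_stdComplexGaussian (p : ℕ) : MemLp id p stdComplexGaussian := by
  unfold stdComplexGaussian
  rw [memLp_map_measure_iff (by fun_prop) measurable_stdComplexGaussian_map.aemeasurable]
  have h1 : MemLp (id : ℝ → ℝ) p (gaussianReal 0 1) :=
    memLp_id_gaussianReal' _ (ENNReal.natCast_ne_top p)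
  have hf : MemLp (fun q : ℝ × ℝ => q.1) p ((gaussianReal 0 1).prod (gaussianReal 0 1)) :=
    h1.comp_measurePreserving measurePreserving_fst
  have hs : MemLp (fun q : ℝ × ℝ => q.2) p ((gaussianReal 0 1).prod (gaussianReal 0 1)) :=
    h1.comp_measurePreserving measurePreserving_snd
  have := ((hf.ofReal (K := ℂ)).add ((hs.ofReal (K := ℂ)).mul_const Complex.I)).mul_const
    (((Real.sqrt 2 : ℝ) : ℂ)⁻¹)
  refine this.congr_norm (by fun_prop) (ae_of_all _ fun q => ?_)
  simp [div_eq_mul_inv]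

theorem integrable_pow_mul_star_pow (n m : ℕ) :
    Integrable (fun z : ℂ => z ^ n * star z ^ m) stdComplexGaussian := by
  refine ((memLp_id_stdComplexGaussian (n + m)).integrable_norm_pow').mono'
    (by fun_prop) (ae_of_all _ fun z => ?_)
  simp [pow_add]

theorem integral_pow_mul_star_pow_self (n : ℕ) :
    ∫ z : ℂ, z ^ n * star z ^ n ∂stdComplexGaussian = n.factorial := by
  rw [integral_stdComplexGaussian _ (by fun_prop)]
  have h := Complex.integral_rpow_mul_exp_neg_rpow (p := 2) (q := 2 * n) (by norm_num)
    (by have : (0 : ℝ) ≤ n := n.cast_nonneg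
        linarith)
  have h1 : ∀ z : ℂ, ((Real.exp (-‖z‖ ^ (2 : ℝ)) : ℝ) : ℂ) * (z ^ n * star z ^ n)
      = ((‖z‖ ^ (2 * n : ℝ) * Real.exp (-‖z‖ ^ (2 : ℝ)) : ℝ) : ℂ) := by
    intro z
    rw [← mul_pow, Complex.star_def, Complex.mul_conj, Complex.normSq_eq_norm_sq,
      Real.rpow_mul (norm_nonneg z), Real.rpow_two, Real.rpow_natCast]
    push_cast
    ring
  simp_rw [h1]
  rw [integral_complex_ofReal, h, show ((2 : ℝ) * n + 2) / 2 = n + 1 by ring,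
    Real.Gamma_nat_eq_factorial]
  have : (Real.pi : ℂ) ≠ 0 := by exact_mod_cast Real.pi_ne_zero
  push_cast
  field_simp

/-- The law is invariant under multiplication by `u = exp(iπ/(n - m))`, which changes the sign of
`zⁿ z̄ᵐ`. -/
theorem integral_pow_mul_star_pow_of_ne {n m : ℕ} (h : n ≠ m) :
    ∫ z : ℂ, z ^ n * star z ^ m ∂stdComplexGaussian = 0 := by
  rw [integral_stdComplexGaussian _ (by fun_prop)]
  apply mul_eq_zero_of_right
  set g : ℂ → ℂ := fun z => ((Real.exp (-‖z‖ ^ (2 : ℝ)) : ℝ) : ℂ) * (z ^ n * star z ^ m) with hg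
  let u : Circle := Circle.exp (Real.pi / ((n : ℝ) - m))
  have hu : (u : ℂ) ^ n * star (u : ℂ) ^ m = -1 := by
    have hnm : ((n : ℂ) - m) ≠ 0 := sub_ne_zero.2 (by exact_mod_cast h)
    simp only [u, Circle.coe_exp, Complex.star_def, ← Complex.exp_conj, ← Complex.exp_nat_mul]
    rw [← Complex.exp_add, ← Complex.exp_pi_mul_I]
    congr 1
    simp
    field_simp
    ring
  have h1 : ∫ z, g z = ∫ z, g (rotation u z) :=
    ((rotation u).measurePreserving.integral_comp
      (rotation u).toHomeomorph.measurableEmbedding g).symm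
  have h2 : ∀ z, g (rotation u z) = - g z := by
    intro z
    simp only [hg, rotation_apply, star_mul', mul_pow, norm_mul, Circle.norm_coe, one_mul]
    linear_combination (((Real.exp (-‖z‖ ^ (2 : ℝ)) : ℝ) : ℂ) * (z ^ n * star z ^ m)) * hu
  simp_rw [h2, integral_neg] at h1
  exact self_eq_neg.1 h1

variable {K N : Type*} [DecidableEq K] [Fintype N]

/-- Two families with equally large fibres differ by a permutation of the index set. -/
theorem exists_perm_of_card_fiber {b b' : N → K}
    (h : ∀ v, (Finset.univ.filter fun j => b' j = v).card
      = (Finset.univ.filter fun j => b j = v).card) :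
    ∃ g : Equiv.Perm N, ∀ j, b (g j) = b' j := by
  have e : ∀ v, Nonempty ({j // b' j = v} ≃ {j // b j = v}) := fun v => by
    rw [← Fintype.card_eq, Fintype.card_subtype, Fintype.card_subtype, h v]
  let e' := fun v => (e v).some
  refine ⟨(Equiv.sigmaFiberEquiv b').symm.trans
    ((Equiv.sigmaCongrRight e').trans (Equiv.sigmaFiberEquiv b)), fun j => ?_⟩
  exact (e' (b' j) ⟨j, rfl⟩).2

variable [Fintype K]

/-- Collecting the factors that belong to the same basis vector `v`. -/
theorem prod_star_mul_eq_prod_pow (b b' : N → K) (ψ : K → ℂ) :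
    ∏ j, (star (ψ (b j)) * ψ (b' j)) = ∏ v, (ψ v ^ (Finset.univ.filter fun j => b' j = v).card *
      star (ψ v) ^ (Finset.univ.filter fun j => b j = v).card) := by
  rw [Finset.prod_mul_distrib, Finset.prod_mul_distrib, mul_comm,
    ← Finset.prod_fiberwise Finset.univ b (fun j => star (ψ (b j))),
    ← Finset.prod_fiberwise Finset.univ b' (fun j => ψ (b' j))]
  congr 1 <;> refine Finset.prod_congr rfl fun v _ => ?_
  · rw [Finset.prod_congr rfl (g := fun _ => ψ v), Finset.prod_const]
    intro j hj
    rw [(Finset.mem_filter.1 hj).2]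
  · rw [Finset.prod_congr rfl (g := fun _ => star (ψ v)), Finset.prod_const]
    intro j hj
    rw [(Finset.mem_filter.1 hj).2]

theorem integrable_prod_star_mul (b b' : N → K) :
    Integrable (fun ψ : K → ℂ => ∏ j, (star (ψ (b j)) * ψ (b' j)))
      (Measure.pi fun _ => stdComplexGaussian) := by
  simp_rw [prod_star_mul_eq_prod_pow]
  exact Integrable.fintype_prod (f := fun v z => z ^ (Finset.univ.filter fun j => b' j = v).card *
      star z ^ (Finset.univ.filter fun j => b j = v).card)
    fun v => integrable_pow_mul_star_pow _ _

/-- Wick's formula for a vector of independent standard complex Gaussian variables. -/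
theorem integral_prod_star_mul [DecidableEq N] (b b' : N → K) :
    ∫ ψ : K → ℂ, ∏ j, (star (ψ (b j)) * ψ (b' j)) ∂(Measure.pi fun _ => stdComplexGaussian)
      = ∑ g : Equiv.Perm N, if ∀ j, b' j = b (g⁻¹ j) then 1 else 0 := by
  simp_rw [prod_star_mul_eq_prod_pow]
  rw [integral_fintype_prod_eq_prod (f := fun v z =>
    z ^ (Finset.univ.filter fun j => b' j = v).card *
      star z ^ (Finset.univ.filter fun j => b j = v).card)]
  by_cases h : ∀ v, (Finset.univ.filter fun j => b' j = v).card
      = (Finset.univ.filter fun j => b j = v).card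
  · -- the solutions `g` form a coset of the stabilizer of `b`, whose order is the product of the
    -- factorials of the fibre sizes
    obtain ⟨g₀, hg₀⟩ := exists_perm_of_card_fiber h
    simp_rw [h, integral_pow_mul_star_pow_self]
    rw [Finset.sum_boole]
    have h1 := DomMulAct.stabilizer_card b
    simp_rw [Fintype.card_subtype] at h1
    rw [← Nat.cast_prod, ← h1]
    congr 1
    refine Finset.card_bij' (fun g _ => g₀⁻¹ * g⁻¹) (fun g _ => (g₀ * g)⁻¹) ?_ ?_ ?_ ?_
    · intro g hg
      simp only [Finset.mem_filter, Finset.mem_univ, true_and] at hg ⊢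
      intro j
      rw [← hg₀, mul_inv_rev, inv_inv, inv_inv, Equiv.Perm.mul_apply]
      exact (congrFun hg (g₀ j)).symm
    · intro g hg
      simp only [Finset.mem_filter, Finset.mem_univ, true_and] at hg ⊢
      ext j
      rw [Function.comp_apply, mul_inv_rev, Equiv.Perm.mul_apply, ← hg, ← hg₀,
        ← Equiv.Perm.mul_apply, mul_inv_cancel, Equiv.Perm.one_apply]
    · intro g _
      simp
    · intro g _
      simp
  · push Not at h
    obtain ⟨v, hv⟩ := h
    rw [Finset.prod_eq_zero (Finset.mem_univ v) (integral_pow_mul_star_pow_of_ne hv)]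
    symm
    apply Finset.sum_eq_zero
    intro g _
    rw [if_neg]
    intro hg
    apply hv
    refine Finset.card_bij (fun j _ => g⁻¹ j) ?_ ?_ ?_
    · intro j hj
      simpa [hg] using hj
    · intro _ _ _ _ hh
      exact g⁻¹.injective hh
    · intro j hj
      refine ⟨g j, ?_, by simp⟩
      simpa [hg] using hj

end Gaussian

/-! ### Replicated networks -/

section Replica

theorem prod_sum_eq_sum_prod {R ι : Type*} [CommSemiring R] [Fintype ι] [DecidableEq ι]
    {κ : ι → Type*} [∀ i, Fintype (κ i)] (f : ∀ i, κ i → R) :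
    ∏ i, ∑ j, f i j = ∑ g : (∀ i, κ i), ∏ i, f i (g i) := by
  rw [Finset.prod_univ_sum, Fintype.piFinset_univ]

variable {V : Type*} {G : SimpleGraph V}

/-- One endpoint of an edge. -/
noncomputable def src (e : G.edgeSet) : V := (Quot.out e.1).1

/-- The other endpoint of an edge. -/
noncomputable def tgt (e : G.edgeSet) : V := (Quot.out e.1).2

theorem edge_eq (e : G.edgeSet) : (e : Sym2 V) = s(src e, tgt e) :=
  (Quot.out_eq e.1).symm

variable [DecidableEq V]

/-- Basis labels for all edges of the network. -/
abbrev Lab (L : LinkStates G) : Type _ := (e : G.edgeSet) → Fin (L.dim e)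

/-- The basis label on the vertices in `S` in which both ends of every edge `e` carry `J e`. -/
def lift (L : LinkStates G) (S : Finset V) (J : Lab L) : Idx L S :=
  fun _ e => J ⟨e.1, e.2.1⟩

/-- The coefficient `∏ₑ √λ_{e,J e}` of the link state vector. -/
noncomputable def sqrtWeight [Fintype G.edgeSet] (L : LinkStates G) (J : Lab L) : ℂ :=
  ∏ e, ((Real.sqrt (L.coeff e (J e)) : ℝ) : ℂ)

variable {N : Type*}

/-- The replicated basis labels `I`, permuted at every vertex `x` by `p x`. -/
def permute {L : LinkStates G} {S : Finset V} (p : V → Equiv.Perm N) (I : N → Idx L S) :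
    N → Idx L S :=
  fun j x => I ((p x.1)⁻¹ j) x

theorem join_permute {L : LinkStates G} {S A : Finset V} {p : V → Equiv.Perm N}
    (a : N → Idx L A) (c : N → Idx L (S \ A)) (j : N) :
    join L (permute p a j) (permute p c j) = permute p (fun j => join L (a j) (c j)) j := by
  funext x
  by_cases h : x.1 ∈ A <;> simp [join, permute, h]

variable [Fintype V] [DecidableRel G.Adj]

/-- The link state vector is supported on the labels that agree at the two ends of every edge. -/
theorem linkVec_eq (L : LinkStates G) (i : Idx L Finset.univ) :
    linkVec L i = ∑ J : Lab L, if i = lift L Finset.univ J then sqrtWeight L J else 0 := by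
  classical
  unfold linkVec linkAmp
  rw [prod_sum_eq_sum_prod]
  refine Finset.sum_congr rfl fun J _ => ?_
  split_ifs with h
  · subst h
    refine Finset.prod_congr rfl fun e _ => ?_
    rw [if_pos]
    intro x h
    rfl
  · have : ∃ e : G.edgeSet, ¬ ∀ (x : V) (h : x ∈ e.1),
        i ⟨x, Finset.mem_univ x⟩ ⟨e.1, e.2, h⟩ = J e := by
      by_contra hn
      push Not at hn
      apply h
      ext x e
      rw [hn ⟨e.1, e.2.1⟩ x.1 e.2.2]
      rfl
    obtain ⟨e, he⟩ := this
    exact Finset.prod_eq_zero (Finset.mem_univ e) (if_neg he)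

theorem star_linkVec (L : LinkStates G) (i : Idx L Finset.univ) :
    star (linkVec L i) = linkVec L i := by
  unfold linkVec linkAmp
  rw [star_prod]
  refine Finset.prod_congr rfl fun e _ => ?_
  rw [star_sum]
  refine Finset.sum_congr rfl fun j _ => ?_
  split_ifs
  · exact Complex.conj_ofReal _
  · exact star_zero _

variable [Fintype N]

theorem integrable_prod_bulk (L : LinkStates G) (bdry : Finset V)
    (b b' : N → Idx L (Finset.univ \ bdry)) :
    Integrable (fun ψ : BulkTensors L bdry => ∏ x, ∏ j, (star (ψ x (b j x)) * ψ x (b' j x)))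
      (tensorLaw L bdry) :=
  Integrable.fintype_prod_dep (f := fun x (φ : Leg L x.1 → ℂ) =>
    ∏ j, (star (φ (b j x)) * φ (b' j x))) fun x =>
      integrable_prod_star_mul (fun j => b j x) (fun j => b' j x)

variable [DecidableEq N]

/-- The contribution `∏ₑ ∏_l tr(Λₑ^l)` of an assignment `p` of permutations to the vertices, where
`l` runs over the cycle lengths of the relative permutation of the two ends of `e`. -/
noncomputable def configWeight (L : LinkStates G) (p : V → Equiv.Perm N) : ℝ :=
  ∏ e, cycProd (fun l => ∑ m, L.coeff e m ^ l) ((p (src e))⁻¹ * p (tgt e))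

/-- The overlap of the replicated link states with their copies permuted by `p` factorizes over
the edges, and at each edge over the cycles. -/
theorem sum_linkVec_permute (L : LinkStates G) (p : V → Equiv.Perm N) :
    ∑ I : N → Idx L Finset.univ, ∏ j, (linkVec L (I j) * linkVec L (permute p I j))
      = (configWeight L p : ℂ) := by
  classical
  have h1 : ∀ I : N → Idx L Finset.univ, ∏ j, (linkVec L (I j) * linkVec L (permute p I j))
      = ∑ J : N → Lab L, if I = fun j => lift L Finset.univ (J j) then
          ∏ j, (sqrtWeight L (J j) *
            linkVec L (permute p (fun j => lift L Finset.univ (J j)) j)) else 0 := by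
    intro I
    rw [Finset.prod_mul_distrib]
    conv_lhs => rw [Finset.prod_congr rfl fun j _ => linkVec_eq L (I j)]
    rw [prod_sum_eq_sum_prod, Finset.sum_mul]
    refine Finset.sum_congr rfl fun J _ => ?_
    split_ifs with h
    · subst h
      rw [Finset.prod_mul_distrib]
      simp
    · have : ∃ j, I j ≠ lift L Finset.univ (J j) := by
        by_contra hn
        push Not at hn
        exact h (funext hn)
      obtain ⟨j, hj⟩ := this
      rw [Finset.prod_eq_zero (Finset.mem_univ j) (if_neg hj), zero_mul]
  simp_rw [h1]
  rw [Finset.sum_comm]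
  simp only [Finset.sum_ite_eq', Finset.mem_univ, if_true]
  -- the labels at the two ends of `e`, permuted by `p (src e)` and `p (tgt e)`, agree exactly when
  -- the labels on `e` are invariant under the relative permutation
  let F : ∀ e : G.edgeSet, (N → Fin (L.dim e)) → ℂ := fun e i =>
    if ∀ j, i (((p (src e))⁻¹ * p (tgt e)) j) = i j then
      ∏ j, (L.coeff e (i j) : ℂ) else 0
  have h2 : ∀ J : N → Lab L, ∏ j, (sqrtWeight L (J j) *
      linkVec L (permute p (fun j => lift L Finset.univ (J j)) j))
        = ∏ e, F e (fun j => J j e) := by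
    intro J
    unfold sqrtWeight linkVec
    simp_rw [← Finset.prod_mul_distrib]
    rw [Finset.prod_comm]
    refine Finset.prod_congr rfl fun e _ => ?_
    have h3 : ∀ j, linkAmp L e (permute p (fun j => lift L Finset.univ (J j)) j)
        = if J ((p (src e))⁻¹ j) e = J ((p (tgt e))⁻¹ j) e then
          ((Real.sqrt (L.coeff e (J ((p (src e))⁻¹ j) e)) : ℝ) : ℂ) else 0 := by
      intro j
      unfold linkAmp
      have h4 : ∀ m : Fin (L.dim e), (∀ (x : V) (h : x ∈ e.1),
          permute p (fun j => lift L Finset.univ (J j)) j ⟨x, Finset.mem_univ x⟩ ⟨e.1, e.2, h⟩ = m)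
          ↔ (J ((p (src e))⁻¹ j) e = m ∧ J ((p (tgt e))⁻¹ j) e = m) := by
        intro m
        constructor
        · intro h
          exact ⟨h (src e) (by rw [edge_eq e]; simp), h (tgt e) (by rw [edge_eq e]; simp)⟩
        · rintro ⟨ha, hb⟩ x hx
          rw [edge_eq e, Sym2.mem_iff] at hx
          rcases hx with rfl | rfl
          · exact ha
          · exact hb
      simp_rw [h4]
      by_cases h : J ((p (src e))⁻¹ j) e = J ((p (tgt e))⁻¹ j) e
      · rw [if_pos h, Finset.sum_eq_single (J ((p (src e))⁻¹ j) e), if_pos ⟨rfl, h.symm⟩]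
        · intro m _ hm
          exact if_neg fun hh => hm hh.1.symm
        · intro hm
          exact absurd (Finset.mem_univ _) hm
      · rw [if_neg h]
        apply Finset.sum_eq_zero
        intro m _
        rw [if_neg]
        rintro ⟨ha, hb⟩
        exact h (ha.trans hb.symm)
    simp_rw [h3]
    simp only [F]
    have h5 : (∀ j, J ((p (src e))⁻¹ j) e = J ((p (tgt e))⁻¹ j) e)
        ↔ ∀ j, J (((p (src e))⁻¹ * p (tgt e)) j) e = J j e := by
      constructor
      · intro h j
        rw [Equiv.Perm.mul_apply, h]
        simp
      · intro h j
        have := h ((p (tgt e))⁻¹ j)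
        simpa using this
    by_cases h : ∀ j, J ((p (src e))⁻¹ j) e = J ((p (tgt e))⁻¹ j) e
    · rw [if_pos (h5.1 h), Finset.prod_mul_distrib]
      simp only [h, if_true]
      rw [Equiv.prod_comp (p (tgt e))⁻¹
        (fun j => ((Real.sqrt (L.coeff e (J j e)) : ℝ) : ℂ)), ← Finset.prod_mul_distrib]
      refine Finset.prod_congr rfl fun j _ => ?_
      rw [← Complex.ofReal_mul, Real.mul_self_sqrt (L.coeff_nonneg e _)]
    · rw [if_neg fun hh => h (h5.2 hh)]
      push Not at h
      obtain ⟨j, hj⟩ := h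
      apply Finset.prod_eq_zero (Finset.mem_univ j)
      rw [if_neg hj, mul_zero]
  simp_rw [h2]
  rw [← (Equiv.piComm fun (_ : N) (e : G.edgeSet) => Fin (L.dim e)).symm.sum_comp]
  simp only [Equiv.piComm_symm, Equiv.piComm_apply, Function.swap]
  rw [← prod_sum_eq_sum_prod]
  unfold configWeight
  rw [Complex.ofReal_prod]
  refine Finset.prod_congr rfl fun e _ => ?_
  rw [← sum_prod_fixed (L.coeff e)]
  simp only [F]
  rw [Complex.ofReal_sum]
  refine Finset.sum_congr rfl fun i _ => ?_
  split_ifs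
  · rw [Complex.ofReal_prod]
  · rw [Complex.ofReal_zero]

/-! ### Joining basis labels -/

theorem sum_join (L : LinkStates G) {S A : Finset V} (hA : A ⊆ S) {M : Type*} [AddCommMonoid M]
    (F : (N → Idx L S) → M) :
    ∑ a : N → Idx L A, ∑ c : N → Idx L (S \ A), F (fun j => join L (a j) (c j))
      = ∑ I : N → Idx L S, F I := by
  rw [← Fintype.sum_prod_type']
  refine Fintype.sum_equiv
    { toFun := fun ac j => join L (ac.1 j) (ac.2 j)
      invFun := fun I => (fun j x => I j ⟨x.1, hA x.2⟩,
        fun j x => I j ⟨x.1, (Finset.mem_sdiff.1 x.2).1⟩)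
      left_inv := ?_
      right_inv := ?_ } _ _ ?_
  · rintro ⟨a, c⟩
    ext j x
    · simp [join]
    · have := (Finset.mem_sdiff.1 x.2).2
      simp [join, this]
  · intro I
    funext j x
    by_cases h : x.1 ∈ A <;> simp [join, h]
  · intro ac
    rfl

/-- The assignment of permutations to all vertices that is `σ` on `A`, the identity on the other
boundary vertices, and `q` on the bulk. -/
def extend (bdry A : Finset V) (σ : Equiv.Perm N)
    (q : ↥(Finset.univ \ bdry : Finset V) → Equiv.Perm N) : V → Equiv.Perm N :=
  fun x => if h : x ∈ bdry then (if x ∈ A then σ else 1)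
    else q ⟨x, Finset.mem_sdiff.2 ⟨Finset.mem_univ x, h⟩⟩

/-! ### The averaged replicated state -/

theorem prod_rtnVec (L : LinkStates G) (bdry : Finset V) (ψ : BulkTensors L bdry)
    (β β' : N → Idx L bdry) :
    ∏ j, (rtnVec L bdry ψ (β j) * star (rtnVec L bdry ψ (β' j)))
      = ∑ b : N → Idx L (Finset.univ \ bdry), ∑ b' : N → Idx L (Finset.univ \ bdry),
        (∏ j, (linkVec L (join L (β j) (b j)) * linkVec L (join L (β' j) (b' j)))) *
          ∏ x, ∏ j, (star (ψ x (b j x)) * ψ x (b' j x)) := by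
  unfold rtnVec
  simp only [star_sum, star_mul', star_linkVec, star_prod, star_star]
  rw [Finset.prod_mul_distrib, prod_sum_eq_sum_prod, prod_sum_eq_sum_prod, Finset.sum_mul_sum]
  refine Finset.sum_congr rfl fun b _ => Finset.sum_congr rfl fun b' _ => ?_
  rw [Finset.prod_comm (s := (Finset.univ : Finset ↥(Finset.univ \ bdry : Finset V)))]
  simp only [Finset.prod_mul_distrib]
  ring

theorem integrable_prod_rtnVec (L : LinkStates G) (bdry : Finset V)
    (β β' : N → Idx L bdry) :
    Integrable (fun ψ => ∏ j, (rtnVec L bdry ψ (β j) * star (rtnVec L bdry ψ (β' j))))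
      (tensorLaw L bdry) := by
  simp_rw [prod_rtnVec]
  exact integrable_finsetSum _ fun b _ => integrable_finsetSum _ fun b' _ =>
    (integrable_prod_bulk L bdry b b').const_mul _

/-- Averaging over the bulk tensors produces a sum over assignments `q` of permutations to the bulk
vertices; `p q` is any extension of `q` to all vertices. -/
theorem integral_prod_rtnVec (L : LinkStates G) (bdry : Finset V)
    (β β' : N → Idx L bdry) (p : (↥(Finset.univ \ bdry : Finset V) → Equiv.Perm N) → V →
      Equiv.Perm N) (hp : ∀ q x, p q x.1 = q x) :
    ∫ ψ, ∏ j, (rtnVec L bdry ψ (β j) * star (rtnVec L bdry ψ (β' j))) ∂(tensorLaw L bdry)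
      = ∑ q : ↥(Finset.univ \ bdry : Finset V) → Equiv.Perm N,
        ∑ b : N → Idx L (Finset.univ \ bdry),
          ∏ j, (linkVec L (join L (β j) (b j)) *
            linkVec L (join L (β' j) (permute (p q) b j))) := by
  classical
  simp_rw [prod_rtnVec]
  rw [integral_finsetSum _ fun b _ => integrable_finsetSum _ fun b' _ =>
    (integrable_prod_bulk L bdry b b').const_mul _, Finset.sum_comm]
  refine Finset.sum_congr rfl fun b _ => ?_
  rw [integral_finsetSum _ fun b' _ => (integrable_prod_bulk L bdry b b').const_mul _]
  -- Wick's formula at every bulk vertex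
  have h1 : ∀ b' : N → Idx L (Finset.univ \ bdry),
      ∫ ψ : BulkTensors L bdry, ∏ x, ∏ j, (star (ψ x (b j x)) * ψ x (b' j x))
        ∂(tensorLaw L bdry)
      = ∑ q : ↥(Finset.univ \ bdry : Finset V) → Equiv.Perm N,
          if b' = permute (p q) b then 1 else 0 := by
    intro b'
    unfold tensorLaw
    rw [integral_fintype_prod_eq_prod (f := fun x (φ : Leg L x.1 → ℂ) =>
      ∏ j, (star (φ (b j x)) * φ (b' j x)))]
    simp_rw [fun x : ↥(Finset.univ \ bdry : Finset V) =>
      integral_prod_star_mul (fun j => b j x) (fun j => b' j x)]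
    rw [prod_sum_eq_sum_prod]
    refine Finset.sum_congr rfl fun q _ => ?_
    split_ifs with h
    · subst h
      refine Finset.prod_eq_one fun x _ => if_pos fun j => ?_
      simp only [permute, hp]
    · have : ∃ x, ¬ ∀ j, b' j x = b ((q x)⁻¹ j) x := by
        by_contra hn
        push Not at hn
        apply h
        funext j x
        simp only [permute, hp]
        exact hn x j
      obtain ⟨x, hx⟩ := this
      exact Finset.prod_eq_zero (Finset.mem_univ x) (if_neg hx)
  simp_rw [integral_const_mul, h1, Finset.mul_sum]
  rw [Finset.sum_comm]
  refine Finset.sum_congr rfl fun q _ => ?_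
  simp

/-- The expectation value `tr(ρ_A^{⊗N} R_σ)` of the permutation `σ` of the replicas. -/
noncomputable def replicaTrace (L : LinkStates G) (bdry A : Finset V) (σ : Equiv.Perm N)
    (ψ : BulkTensors L bdry) : ℂ :=
  ∑ a : N → Idx L A, ∏ j, reducedState L bdry A ψ (a j) (a (σ⁻¹ j))

theorem replicaTrace_eq (L : LinkStates G) (bdry A : Finset V) (σ : Equiv.Perm N)
    (ψ : BulkTensors L bdry) :
    replicaTrace L bdry A σ ψ = ∑ a : N → Idx L A, ∑ c : N → Idx L (bdry \ A),
      ∏ j, (rtnVec L bdry ψ (join L (a j) (c j)) *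
        star (rtnVec L bdry ψ (join L (a (σ⁻¹ j)) (c j)))) := by
  unfold replicaTrace reducedState rtnState
  simp_rw [prod_sum_eq_sum_prod]
  rfl

theorem integrable_replicaTrace (L : LinkStates G) (bdry A : Finset V) (σ : Equiv.Perm N) :
    Integrable (replicaTrace L bdry A σ) (tensorLaw L bdry) := by
  have : replicaTrace L bdry A σ = fun ψ => _ := funext fun ψ => replicaTrace_eq L bdry A σ ψ
  rw [this]
  exact integrable_finsetSum _ fun a _ => integrable_finsetSum _ fun c _ =>
    integrable_prod_rtnVec L bdry _ _

/-- The average of the replica trace is the partition function of a spin model on the network, the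
spins being permutations of the replicas. -/
theorem integral_replicaTrace (L : LinkStates G) {bdry A : Finset V} (hA : A ⊆ bdry)
    (σ : Equiv.Perm N) :
    ∫ ψ, replicaTrace L bdry A σ ψ ∂(tensorLaw L bdry)
      = ((∑ q : ↥(Finset.univ \ bdry : Finset V) → Equiv.Perm N,
          configWeight L (extend bdry A σ q) : ℝ) : ℂ) := by
  classical
  simp_rw [replicaTrace_eq]
  rw [integral_finsetSum _ fun a _ => integrable_finsetSum _ fun c _ =>
    integrable_prod_rtnVec L bdry _ _]
  simp_rw [fun a : N → Idx L A => integral_finsetSum (μ := tensorLaw L bdry) Finset.univ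
    fun (c : N → Idx L (bdry \ A)) _ =>
      integrable_prod_rtnVec L bdry (fun j => join L (a j) (c j))
        (fun j => join L (a (σ⁻¹ j)) (c j))]
  simp_rw [fun (a : N → Idx L A) (c : N → Idx L (bdry \ A)) =>
    integral_prod_rtnVec L bdry (fun j => join L (a j) (c j))
        (fun j => join L (a (σ⁻¹ j)) (c j)) (extend bdry A σ) (fun q x => by
          simp [extend, (Finset.mem_sdiff.1 x.2).2])]
  push_cast
  simp_rw [← sum_linkVec_permute]
  -- permuting the replicas on `A` alone is the action of the boundary values of `extend`
  have h1 : ∀ (q : ↥(Finset.univ \ bdry : Finset V) → Equiv.Perm N) (a : N → Idx L A)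
      (c : N → Idx L (bdry \ A)) (j : N), join L (a (σ⁻¹ j)) (c j)
        = permute (extend bdry A σ q) (fun j => join L (a j) (c j)) j := by
    intro q a c j
    rw [← join_permute]
    congr 1
    · funext x
      simp [permute, extend, hA x.2]
    · funext x
      have := Finset.mem_sdiff.1 x.2
      simp [permute, extend, this.1, this.2]
  have h2 : ∀ (q : ↥(Finset.univ \ bdry : Finset V) → Equiv.Perm N) (a : N → Idx L A)
      (c : N → Idx L (bdry \ A)) (b : N → Idx L (Finset.univ \ bdry)) (j : N),
      join L (join L (a (σ⁻¹ j)) (c j)) (permute (extend bdry A σ q) b j)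
        = permute (extend bdry A σ q) (fun j => join L (join L (a j) (c j)) (b j)) j := by
    intro q a c b j
    rw [h1 q, join_permute]
  simp_rw [h2]
  have h3 : ∀ q : ↥(Finset.univ \ bdry : Finset V) → Equiv.Perm N,
      ∑ I : N → Idx L Finset.univ,
        ∏ j, (linkVec L (I j) * linkVec L (permute (extend bdry A σ q) I j))
      = ∑ a : N → Idx L A, ∑ c : N → Idx L (bdry \ A), ∑ b : N → Idx L (Finset.univ \ bdry),
          ∏ j, (linkVec L (join L (join L (a j) (c j)) (b j)) *
            linkVec L (permute (extend bdry A σ q)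
              (fun j => join L (join L (a j) (c j)) (b j)) j)) := by
    intro q
    rw [← sum_join L (Finset.subset_univ bdry), ← sum_join L hA]
  simp_rw [h3]
  exact (Finset.sum_congr rfl fun a _ => Finset.sum_comm).trans Finset.sum_comm

end Replica

/-! ### Traces of powers -/

section Trace

open scoped ComplexOrder

theorem sum_cons {I R : Type*} [Fintype I] [AddCommMonoid R] {m : ℕ}
    (F : (Fin (m + 1) → I) → R) :
    ∑ b, F b = ∑ z : I, ∑ a : Fin m → I, F (Fin.cons z a : Fin (m + 1) → I) := by
  rw [← (Fin.consEquiv fun _ : Fin (m + 1) => I).sum_comp, Fintype.sum_prod_type]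
  rfl

theorem matrix_pow_apply_eq_sum {I R : Type*} [Fintype I] [DecidableEq I] [CommSemiring R]
    (M : Matrix I I R) (m : ℕ) (x y : I) :
    (M ^ (m + 1)) x y = ∑ a : Fin m → I, ∏ j : Fin (m + 1),
      M ((Fin.cons x a : Fin (m + 1) → I) j) ((Fin.snoc a y : Fin (m + 1) → I) j) := by
  induction m generalizing x with
  | zero => simp [Fin.snoc]
  | succ m ih =>
    rw [pow_succ', Matrix.mul_apply, sum_cons]
    refine Finset.sum_congr rfl fun z _ => ?_
    rw [ih, Finset.mul_sum]
    refine Finset.sum_congr rfl fun a _ => ?_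
    have h : (Fin.snoc (Fin.cons z a : Fin (m + 1) → I) y : Fin (m + 2) → I)
        = Fin.cons z (Fin.snoc a y : Fin (m + 1) → I) :=
      (Fin.cons_snoc_eq_snoc_cons z a y).symm
    rw [Fin.prod_univ_succ (n := m + 1), h]
    simp only [Fin.cons_zero, Fin.cons_succ]

/-- The trace of a power as a contraction along the long cycle. -/
theorem trace_pow_eq_sum {I R : Type*} [Fintype I] [DecidableEq I] [CommSemiring R]
    (M : Matrix I I R) (m : ℕ) :
    (M ^ (m + 1)).trace = ∑ a : Fin (m + 1) → I, ∏ j, M (a j) (a ((finRotate (m + 1))⁻¹ j)) := by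
  rw [← Matrix.trace_transpose, Matrix.transpose_pow, Matrix.trace, sum_cons]
  refine Finset.sum_congr rfl fun x _ => ?_
  rw [Matrix.diag_apply, matrix_pow_apply_eq_sum]
  refine Finset.sum_congr rfl fun a _ => ?_
  rw [← Equiv.prod_comp (finRotate (m + 1)) fun j => M ((Fin.cons x a : Fin (m + 1) → I) j)
    ((Fin.cons x a : Fin (m + 1) → I) ((finRotate (m + 1))⁻¹ j))]
  refine Finset.prod_congr rfl fun j _ => ?_
  have h : (finRotate (m + 1))⁻¹ (finRotate (m + 1) j) = j := by
    rw [← Equiv.Perm.mul_apply, inv_mul_cancel, Equiv.Perm.one_apply]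
  rw [h, Matrix.transpose_apply, Fin.snoc_eq_cons_rotate]

theorem trace_pow_eq_sum_eigenvalues {I : Type*} [Fintype I] [DecidableEq I]
    {M : Matrix I I ℂ} (hM : M.IsHermitian) (k : ℕ) :
    (M ^ k).trace = ((∑ i, hM.eigenvalues₀ i ^ k : ℝ) : ℂ) := by
  have h1 := hM.conjStarAlgAut_star_eigenvectorUnitary
  have h2 := congrArg (fun X => (X ^ k).trace) h1
  simp only [← map_pow] at h2
  rw [Unitary.conjStarAlgAut_star_apply, Matrix.trace_mul_comm, ← mul_assoc,
    Unitary.mul_star_self_of_mem hM.eigenvectorUnitary.2, one_mul] at h2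
  rw [h2, Matrix.diagonal_pow, Matrix.trace_diagonal,
    ← (Fintype.equivOfCardEq (Fintype.card_fin (Fintype.card I))).symm.sum_comp
      (fun i => hM.eigenvalues₀ i ^ k)]
  push_cast
  rfl

/-- The eigenvalues of a positive semidefinite matrix beyond its rank vanish. -/
theorem eigenvalues₀_eq_zero_of_rank_le {I : Type*} [Fintype I] [DecidableEq I]
    {M : Matrix I I ℂ} (hM : M.PosSemidef) {i : Fin (Fintype.card I)} (h : M.rank ≤ i) :
    hM.isHermitian.eigenvalues₀ i = 0 := by
  set e := Fintype.equivOfCardEq (Fintype.card_fin (Fintype.card I))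
  have hev : ∀ j, hM.isHermitian.eigenvalues (e j) = hM.isHermitian.eigenvalues₀ j := fun j => by
    simp only [Matrix.IsHermitian.eigenvalues, e, Equiv.symm_apply_apply]
  by_contra hne
  have hpos : 0 < hM.isHermitian.eigenvalues₀ i :=
    lt_of_le_of_ne (hev i ▸ hM.eigenvalues_nonneg (e i)) (Ne.symm hne)
  rw [hM.isHermitian.rank_eq_card_non_zero_eigs, Fintype.card_subtype] at h
  -- the eigenvalues are in decreasing order, so that the first `i + 1` of them are positive
  have h1 : (Finset.Iic i).card ≤
      (Finset.univ.filter fun j => hM.isHermitian.eigenvalues j ≠ 0).card := by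
    refine Finset.card_le_card_of_injOn e ?_ e.injective.injOn
    intro j hj
    have hj' : j ≤ i := Finset.mem_Iic.1 hj
    have := hM.isHermitian.eigenvalues₀_antitone hj'
    have h2 : hM.isHermitian.eigenvalues₀ j ≠ 0 := (hpos.trans_le this).ne'
    simpa [hev] using h2
  rw [Fin.card_Iic] at h1
  omega

end Trace

/-! ### The rank of the reduced state -/

section Rank

open scoped ComplexOrder

/-- Two functions on `S`, one of the coordinates outside `out` and one of those in `out`, are
uncorrelated for the counting measure, if `S` is closed under recombining these coordinates. -/
theorem sum_mul_sum_cut {E R : Type*} [CommSemiring R] {κ : E → Type*}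
    (S : Finset (∀ e, κ e)) (out : E → Prop) [DecidablePred out]
    (hS : ∀ J ∈ S, ∀ K ∈ S, (fun e => if out e then K e else J e) ∈ S)
    (f g : (∀ e, κ e) → R)
    (hf : ∀ J ∈ S, ∀ K ∈ S, f (fun e => if out e then K e else J e) = f J)
    (hg : ∀ J ∈ S, ∀ K ∈ S, g (fun e => if out e then K e else J e) = g K) :
    (∑ J ∈ S, f J) * ∑ K ∈ S, g K = S.card * ∑ J ∈ S, f J * g J := by
  rw [Finset.sum_mul_sum, ← Finset.sum_product', Finset.card_eq_sum_ones, Nat.cast_sum,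
    mul_comm, Finset.sum_mul_sum, ← Finset.sum_product']
  -- both products are sums over pairs; exchange the coordinates in `out`
  refine Finset.sum_nbij'
    (fun x => (fun e => if out e then x.2 e else x.1 e, fun e => if out e then x.1 e else x.2 e))
    (fun x => (fun e => if out e then x.2 e else x.1 e, fun e => if out e then x.1 e else x.2 e))
    ?_ ?_ ?_ ?_ ?_
  · intro x hx
    rw [Finset.mem_product] at hx ⊢
    exact ⟨hS _ hx.1 _ hx.2, hS _ hx.2 _ hx.1⟩
  · intro x hx
    rw [Finset.mem_product] at hx ⊢
    exact ⟨hS _ hx.1 _ hx.2, hS _ hx.2 _ hx.1⟩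
  · intro x _
    ext e
    · by_cases h : out e <;> simp [h]
    · by_cases h : out e <;> simp [h]
  · intro x _
    ext e
    · by_cases h : out e <;> simp [h]
    · by_cases h : out e <;> simp [h]
  · intro x hx
    rw [Finset.mem_product] at hx
    rw [hf _ hx.1 _ hx.2, hg _ hx.1 _ hx.2, Nat.cast_one, mul_one]

variable {V : Type*} {G : SimpleGraph V}

theorem dim_pos (L : LinkStates G) (e : G.edgeSet) : 0 < L.dim e := by
  rw [Nat.pos_iff_ne_zero]
  intro h
  have h1 := L.sum_coeff e
  have : IsEmpty (Fin (L.dim e)) := by rw [h]; infer_instance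
  simp at h1

variable [Fintype V] [DecidableEq V] [DecidableRel G.Adj]

theorem mem_cutEdges {Γ : Finset V} {e : G.edgeSet} :
    e ∈ cutEdges G Γ ↔ ¬ (src e ∈ Γ ↔ tgt e ∈ Γ) := by
  simp only [cutEdges, Finset.mem_filter, Finset.mem_univ, true_and, edge_eq e, Sym2.eq_iff,
    Finset.mem_compl]
  constructor
  · rintro ⟨x, hx, y, hy, ⟨h1, h2⟩ | ⟨h1, h2⟩⟩ <;> rw [h1, h2] <;> tauto
  · intro h
    by_cases h1 : src e ∈ Γ
    · exact ⟨_, h1, _, fun h2 => h ⟨fun _ => h2, fun _ => h1⟩, Or.inl ⟨rfl, rfl⟩⟩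
    · refine ⟨_, ?_, _, h1, Or.inr ⟨rfl, rfl⟩⟩
      tauto

/-- The tensor network contracts to a product of a tensor supported in `Γ` and a tensor supported
outside `Γ`, joined by the edges crossing the cut. -/
theorem rank_reducedState_le (L : LinkStates G) {bdry A Γ : Finset V} (hA : A ⊆ bdry)
    (hΓ : IsCut bdry A Γ) (ψ : BulkTensors L bdry) :
    (reducedState L bdry A ψ).PosSemidef ∧
      (reducedState L bdry A ψ).rank ≤ cutDim L Γ := by
  classical
  have hAΓ : ∀ x ∈ A, x ∈ Γ := fun x hx => (Finset.mem_inter.1 (hΓ.symm ▸ hx : x ∈ Γ ∩ bdry)).1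
  have hcΓ : ∀ x ∈ bdry \ A, x ∉ Γ := fun x hx hxΓ => (Finset.mem_sdiff.1 hx).2
    (hΓ ▸ Finset.mem_inter.2 ⟨hxΓ, (Finset.mem_sdiff.1 hx).1⟩)
  let B : Matrix (Idx L A) (Idx L (bdry \ A)) ℂ := fun a c => rtnVec L bdry ψ (join L a c)
  have hB : reducedState L bdry A ψ = B * B.conjTranspose := by
    ext a a'
    rw [Matrix.mul_apply]
    rfl
  let out : G.edgeSet → Prop := fun e => src e ∉ Γ ∧ tgt e ∉ Γ
  -- the factors carried by the vertices and edges in `Γ`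
  let f : Idx L A → Lab L → ℂ := fun a J =>
    (if a = lift L A J then 1 else 0) *
      (∏ e, if out e then 1 else ((Real.sqrt (L.coeff e (J e)) : ℝ) : ℂ)) *
      ∏ x : ↥(Finset.univ \ bdry : Finset V), if x.1 ∈ Γ then
        star (ψ x (lift L (Finset.univ \ bdry) J x)) else 1
  -- the factors carried by the vertices and edges outside `Γ`
  let g : Idx L (bdry \ A) → Lab L → ℂ := fun c J =>
    (if c = lift L (bdry \ A) J then 1 else 0) *
      (∏ e, if out e then ((Real.sqrt (L.coeff e (J e)) : ℝ) : ℂ) else 1) *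
      ∏ x : ↥(Finset.univ \ bdry : Finset V), if x.1 ∈ Γ then 1 else
        star (ψ x (lift L (Finset.univ \ bdry) J x))
  have hBfg : ∀ a c, B a c = ∑ J, f a J * g c J := by
    intro a c
    simp only [B, rtnVec, linkVec_eq, Finset.mul_sum]
    rw [Finset.sum_comm]
    refine Finset.sum_congr rfl fun J _ => ?_
    have h1 : ∀ b : Idx L (Finset.univ \ bdry), join L (join L a c) b = lift L Finset.univ J ↔
        (b = lift L _ J ∧ a = lift L A J ∧ c = lift L _ J) := by
      intro b
      constructor
      · intro h
        refine ⟨?_, ?_, ?_⟩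
        · funext x
          have := congrFun h ⟨x.1, Finset.mem_univ _⟩
          simp only [join, (Finset.mem_sdiff.1 x.2).2, dif_neg, not_false_eq_true] at this
          exact this
        · funext x
          have := congrFun h ⟨x.1, Finset.mem_univ _⟩
          simp only [join, hA x.2, dif_pos, x.2] at this
          exact this
        · funext x
          have := congrFun h ⟨x.1, Finset.mem_univ _⟩
          simp only [join, (Finset.mem_sdiff.1 x.2).1, (Finset.mem_sdiff.1 x.2).2, dif_pos,
            dif_neg, not_false_eq_true] at this
          exact this
      · rintro ⟨rfl, rfl, rfl⟩
        funext x
        by_cases hx : x.1 ∈ bdry <;> by_cases hx' : x.1 ∈ A <;> simp [join, hx, hx'] <;> rfl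
    simp_rw [h1]
    by_cases hac : a = lift L A J ∧ c = lift L _ J
    · simp only [hac, and_self, and_true, mul_ite, mul_zero, Finset.sum_ite_eq', Finset.mem_univ,
        if_true, f, g, one_mul, sqrtWeight]
      rw [mul_mul_mul_comm, ← Finset.prod_mul_distrib, ← Finset.prod_mul_distrib, mul_comm]
      congr 1
      · refine Finset.prod_congr rfl fun e _ => ?_
        split_ifs <;> simp
      · refine Finset.prod_congr rfl fun e _ => ?_
        split_ifs <;> simp
    · have h2 : f a J * g c J = 0 := by
        simp only [f, g]
        by_cases ha : a = lift L A J
        · rw [if_neg fun hc : c = lift L _ J => hac ⟨ha, hc⟩]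
          simp
        · rw [if_neg ha]
          simp
      rw [h2]
      apply Finset.sum_eq_zero
      intro b _
      rw [if_neg fun h => hac h.2, mul_zero]
  -- labels of the edges crossing the cut, and the edge labels with prescribed values there
  let C := (e : cutEdges G Γ) → Fin (L.dim e.1)
  let S : C → Finset (Lab L) := fun s => Finset.univ.filter fun J =>
    (fun e : cutEdges G Γ => J e.1) = s
  have hedge : ∀ (e : G.edgeSet) (x : V), x ∈ e.1 → x = src e ∨ x = tgt e := by
    intro e x hx
    rw [edge_eq e, Sym2.mem_iff] at hx
    exact hx
  -- a recombination of `J` and `K` looks like `J` at the vertices of `Γ`, and like `K` elsewhere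
  have hmixΓ : ∀ (J K : Lab L) (T : Finset V) (x : T), x.1 ∈ Γ →
      lift L T (fun e => if out e then K e else J e) x = lift L T J x := by
    intro J K T x hx
    funext e
    have h1 : ¬ out ⟨e.1, e.2.1⟩ := by
      rintro ⟨h1, h2⟩
      rcases hedge ⟨e.1, e.2.1⟩ x.1 e.2.2 with h | h
      · exact h1 (h ▸ hx)
      · exact h2 (h ▸ hx)
    exact if_neg h1
  have hmixC : ∀ (s : C) (J K : Lab L), J ∈ S s → K ∈ S s → ∀ (T : Finset V) (x : T), x.1 ∉ Γ →
      lift L T (fun e => if out e then K e else J e) x = lift L T K x := by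
    intro s J K hJ hK T x hx
    funext e
    simp only [lift]
    by_cases h1 : out ⟨e.1, e.2.1⟩
    · exact if_pos h1
    · rw [if_neg h1]
      have hcut : (⟨e.1, e.2.1⟩ : G.edgeSet) ∈ cutEdges G Γ := by
        rw [mem_cutEdges]
        simp only [out] at h1
        rcases hedge ⟨e.1, e.2.1⟩ x.1 e.2.2 with h | h <;> rw [h] at hx <;> tauto
      have h2 := congrFun (Finset.mem_filter.1 hJ).2 ⟨_, hcut⟩
      have h3 := congrFun (Finset.mem_filter.1 hK).2 ⟨_, hcut⟩
      exact h2.trans h3.symm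
  have hkey : ∀ (a : Idx L A) (c : Idx L (bdry \ A)) (s : C),
      (∑ J ∈ S s, f a J) * ∑ K ∈ S s, g c K = (S s).card * ∑ J ∈ S s, f a J * g c J := by
    intro a c s
    refine sum_mul_sum_cut (S s) out ?_ (f a) (g c) ?_ ?_
    · intro J hJ K hK
      simp only [S, Finset.mem_filter, Finset.mem_univ, true_and] at hJ hK ⊢
      funext e
      by_cases h : out e.1
      · rw [if_pos h, ← hK]
      · rw [if_neg h, ← hJ]
    · intro J hJ K hK
      simp only [f]
      congr 1
      · congr 1
        · have : lift L A (fun e => if out e then K e else J e) = lift L A J :=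
            funext fun x => hmixΓ J K A x (hAΓ x.1 x.2)
          rw [this]
        · refine Finset.prod_congr rfl fun e _ => ?_
          by_cases h : out e
          · simp only [if_pos h]
          · simp only [if_neg h]
      · refine Finset.prod_congr rfl fun x _ => ?_
        by_cases h : x.1 ∈ Γ
        · simp only [if_pos h]
          rw [hmixΓ J K _ x h]
        · simp only [if_neg h]
    · intro J hJ K hK
      simp only [g]
      congr 1
      · congr 1
        · have : lift L (bdry \ A) (fun e => if out e then K e else J e) = lift L (bdry \ A) K :=
            funext fun x => hmixC s J K hJ hK _ x (hcΓ x.1 x.2)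
          rw [this]
        · refine Finset.prod_congr rfl fun e _ => ?_
          by_cases h : out e
          · simp only [if_pos h]
          · simp only [if_neg h]
      · refine Finset.prod_congr rfl fun x _ => ?_
        by_cases h : x.1 ∈ Γ
        · simp only [if_pos h]
        · simp only [if_neg h]
          rw [hmixC s J K hJ hK _ x h]
  let X : Matrix (Idx L A) C ℂ := fun a s => ∑ J ∈ S s, f a J
  let Y : Matrix C (Idx L (bdry \ A)) ℂ := fun s c => ((S s).card : ℂ)⁻¹ * ∑ K ∈ S s, g c K
  have hXY : B = X * Y := by
    ext a c
    rw [hBfg, Matrix.mul_apply, ← Finset.sum_fiberwise Finset.univ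
      (fun (J : Lab L) (e : cutEdges G Γ) => J e.1)]
    refine Finset.sum_congr rfl fun s _ => ?_
    simp only [X, Y]
    rw [mul_left_comm, hkey]
    rcases Nat.eq_zero_or_pos (S s).card with h | h
    · have h' : Finset.univ.filter (fun J : Lab L => (fun e : cutEdges G Γ => J e.1) = s) = ∅ :=
        Finset.card_eq_zero.1 h
      simp [S, h']
    · rw [inv_mul_cancel_left₀ (by exact_mod_cast h.ne')]
  refine ⟨hB ▸ Matrix.posSemidef_self_mul_conjTranspose B, ?_⟩
  rw [hB, Matrix.rank_self_mul_conjTranspose, hXY]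
  calc (X * Y).rank ≤ X.rank := Matrix.rank_mul_le_left X Y
    _ ≤ Fintype.card C := Matrix.rank_le_card_width X
    _ = cutDim L Γ := by
      simp only [C, Fintype.card_pi, Fintype.card_fin, cutDim]
      exact Finset.prod_coe_sort (cutEdges G Γ) (fun e => L.dim e)

theorem cutDim_pos (L : LinkStates G) (Γ : Finset V) : 0 < cutDim L Γ :=
  Finset.prod_pos fun e _ => dim_pos L e

theorem exists_minCut (G : SimpleGraph V) [DecidableRel G.Adj] {bdry A : Finset V}
    (hA : A ⊆ bdry) : ∃ Γ, IsMinCut G bdry A Γ := by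
  classical
  obtain ⟨Γ, h1, h2⟩ := Finset.exists_min_image
    (Finset.univ.filter fun Γ : Finset V => IsCut bdry A Γ) (fun Γ => (cutEdges G Γ).card)
    ⟨A, Finset.mem_filter.2 ⟨Finset.mem_univ _, Finset.inter_eq_left.2 hA⟩⟩
  simp only [Finset.mem_filter, Finset.mem_univ, true_and] at h1 h2
  exact ⟨Γ, h1, fun Γ' h => h2 Γ' h⟩

theorem exists_minCutDim_eq (L : LinkStates G) {bdry A : Finset V} (hA : A ⊆ bdry) :
    ∃ Γ, IsMinCut G bdry A Γ ∧ minCutDim L bdry A = cutDim L Γ := by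
  obtain ⟨Γ, h⟩ := exists_minCut G hA
  exact Nat.sInf_mem (s := {d : ℕ | ∃ Γ : Finset V, IsMinCut G bdry A Γ ∧ d = cutDim L Γ})
    ⟨_, Γ, h, rfl⟩

theorem integral_pow_empirical {d : ℕ} (hd : 0 < d) (s : ℕ → ℝ) (m : ℕ) :
    ∫ z, z ^ (m + 1) ∂(empirical d s) = (d : ℝ) ^ m * ∑ i ∈ Finset.range d, s i ^ (m + 1) := by
  unfold empirical
  rw [integral_smul_measure, integral_finsetSum_measure
    (fun i _ => integrable_dirac enorm_lt_top)]
  simp only [integral_dirac, ENNReal.toReal_inv, ENNReal.toReal_natCast, mul_pow, smul_eq_mul]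
  rw [← Finset.mul_sum, ← mul_assoc, pow_succ', inv_mul_cancel_left₀ (by exact_mod_cast hd.ne')]

/-- Up to its normalization, the random moment is the replica trace of the long cycle. The rank
bound ensures that no nonzero eigenvalue is lost by truncating the spectrum at `minCutDim`. -/
theorem boundaryMoment_eq (L : LinkStates G) {bdry A : Finset V} (hA : A ⊆ bdry) (m : ℕ)
    (ψ : BulkTensors L bdry) :
    (boundaryMoment L bdry A (m + 1) ψ : ℂ)
      = (minCutDim L bdry A : ℂ) ^ m * replicaTrace L bdry A (finRotate (m + 1)) ψ := by
  classical
  obtain ⟨Γ, hΓ, hd⟩ := exists_minCutDim_eq L hA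
  obtain ⟨hpsd, hrank⟩ := rank_reducedState_le L hA hΓ.1 ψ
  rw [← hd] at hrank
  unfold boundaryMoment boundaryMeasure
  rw [integral_pow_empirical (hd ▸ cutDim_pos L Γ), replicaTrace, ← trace_pow_eq_sum,
    trace_pow_eq_sum_eigenvalues (reducedState_isHermitian L bdry A ψ)]
  set d := minCutDim L bdry A
  set n := Fintype.card (Idx L A)
  have h1 : ∑ i ∈ Finset.range d, spec L bdry A ψ i ^ (m + 1)
      = ∑ i ∈ Finset.range (max d n), spec L bdry A ψ i ^ (m + 1) := by
    refine Finset.sum_subset (Finset.range_mono (le_max_left d n)) fun i _ hi => ?_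
    rw [Finset.mem_range, not_lt] at hi
    have : spec L bdry A ψ i = 0 := by
      unfold spec
      split_ifs with h
      · exact eigenvalues₀_eq_zero_of_rank_le hpsd (i := ⟨i, h⟩) (hrank.trans hi)
      · rfl
    rw [this, zero_pow (Nat.succ_ne_zero m)]
  have h2 : ∑ i ∈ Finset.range n, spec L bdry A ψ i ^ (m + 1)
      = ∑ i ∈ Finset.range (max d n), spec L bdry A ψ i ^ (m + 1) := by
    refine Finset.sum_subset (Finset.range_mono (le_max_right d n)) fun i _ hi => ?_
    rw [Finset.mem_range] at hi
    rw [spec, dif_neg hi, zero_pow (Nat.succ_ne_zero m)]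
  rw [h1, ← h2, Finset.sum_range]
  have h3 : ∀ i : Fin n, spec L bdry A ψ i
      = (reducedState_isHermitian L bdry A ψ).eigenvalues₀ i := fun i => dif_pos i.2
  simp_rw [h3]
  push_cast
  rfl

end Rank

/-! ### Height functions -/

section Heights

variable {V : Type*} {N : Type*}

/-- The boundary condition: `σ` on `A` and the identity on the other boundary vertices. -/
def IsBdryConfig (bdry A : Finset V) (σ : Equiv.Perm N) (p : V → Equiv.Perm N) : Prop :=
  (∀ x ∈ A, p x = σ) ∧ ∀ x ∈ bdry, x ∉ A → p x = 1

variable [Fintype N] {σ : Equiv.Perm N} {p : V → Equiv.Perm N} {bdry A : Finset V}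

/-- The distance of the spin at `x` from the identity, truncated at `|σ|`, as a height function. -/
noncomputable def lowerHeight (σ : Equiv.Perm N) (p : V → Equiv.Perm N) (x : V) : ℕ :=
  min (permLen (p x)) (permLen σ)

/-- The distance of the spin at `x` from `σ`, turned upside down into a height function with value
`|σ|` where the spin is `σ`; the truncated subtraction keeps it nonnegative. -/
noncomputable def upperHeight (σ : Equiv.Perm N) (p : V → Equiv.Perm N) (x : V) : ℕ :=
  permLen σ - permLen ((p x)⁻¹ * σ)

theorem permLen_le_add (α β : Equiv.Perm N) :
    permLen α ≤ permLen β + permLen (α⁻¹ * β) := by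
  have h := permLen_mul_le β (α⁻¹ * β)⁻¹
  rwa [permLen_inv, mul_inv_rev, inv_inv, mul_inv_cancel_left] at h

theorem permLen_inv_mul_comm (α β : Equiv.Perm N) : permLen (α⁻¹ * β) = permLen (β⁻¹ * α) := by
  rw [← permLen_inv, mul_inv_rev, inv_inv]

theorem permLen_triangle (α β γ : Equiv.Perm N) :
    permLen (α⁻¹ * γ) ≤ permLen (α⁻¹ * β) + permLen (β⁻¹ * γ) := by
  have h := permLen_mul_le (α⁻¹ * β) (β⁻¹ * γ)
  rwa [mul_assoc, mul_inv_cancel_left] at h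

theorem lowerHeight_bound (σ : Equiv.Perm N) (p : V → Equiv.Perm N)
    {G : SimpleGraph V} (e : G.edgeSet) :
    lowerHeight σ p (src e) ≤ lowerHeight σ p (tgt e)
        + permLen ((p (src e))⁻¹ * p (tgt e)) ∧
      lowerHeight σ p (tgt e) ≤ lowerHeight σ p (src e)
        + permLen ((p (src e))⁻¹ * p (tgt e)) := by
  have h1 := permLen_le_add (p (src e)) (p (tgt e))
  have h2 := permLen_le_add (p (tgt e)) (p (src e))
  rw [permLen_inv_mul_comm] at h2
  unfold lowerHeight
  omega

theorem upperHeight_bound (σ : Equiv.Perm N) (p : V → Equiv.Perm N)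
    {G : SimpleGraph V} (e : G.edgeSet) :
    upperHeight σ p (src e) ≤ upperHeight σ p (tgt e)
        + permLen ((p (src e))⁻¹ * p (tgt e)) ∧
      upperHeight σ p (tgt e) ≤ upperHeight σ p (src e)
        + permLen ((p (src e))⁻¹ * p (tgt e)) := by
  have h1 := permLen_triangle (p (src e)) (p (tgt e)) σ
  have h2 := permLen_triangle (p (tgt e)) (p (src e)) σ
  rw [permLen_inv_mul_comm (p (tgt e)) (p (src e))] at h2
  unfold upperHeight
  omega

theorem lowerHeight_of_mem (hp : IsBdryConfig bdry A σ p) :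
    ∀ x ∈ A, lowerHeight σ p x = permLen σ := fun x hx => by
  rw [lowerHeight, hp.1 x hx, min_self]

theorem lowerHeight_of_not_mem (hp : IsBdryConfig bdry A σ p) :
    ∀ x ∈ bdry, x ∉ A → lowerHeight σ p x = 0 := fun x hx hxA => by
  rw [lowerHeight, hp.2 x hx hxA, permLen_one, Nat.zero_min]

theorem upperHeight_of_mem (hp : IsBdryConfig bdry A σ p) :
    ∀ x ∈ A, upperHeight σ p x = permLen σ := fun x hx => by
  rw [upperHeight, hp.1 x hx, inv_mul_cancel, permLen_one, Nat.sub_zero]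

theorem upperHeight_of_not_mem (hp : IsBdryConfig bdry A σ p) :
    ∀ x ∈ bdry, x ∉ A → upperHeight σ p x = 0 := fun x hx hxA => by
  rw [upperHeight, hp.2 x hx hxA, inv_one, one_mul, Nat.sub_self]

end Heights

/-! ### The domain wall configurations -/

section Wall

variable {V : Type*} [DecidableEq V] {N : Type*}

/-- The configuration that is `σ` on `S`, `π` on `B \ S` and the identity elsewhere. -/
def wall (S B : Finset V) (σ π : Equiv.Perm N) : V → Equiv.Perm N :=
  fun x => if x ∈ S then σ else if x ∈ B then π else 1

variable {σ : Equiv.Perm N} {bdry A : Finset V}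

theorem isBdryConfig_wall {S B : Finset V} (π : Equiv.Perm N) (hS : IsCut bdry A S)
    (hB : IsCut bdry A B) : IsBdryConfig bdry A σ (wall S B σ π) := by
  constructor
  · intro x hx
    rw [← show S ∩ bdry = A from hS] at hx
    rw [wall, if_pos (Finset.mem_inter.1 hx).1]
  · intro x hx hxA
    have h1 : x ∉ S := fun h => hxA (by
      rw [← show S ∩ bdry = A from hS]
      exact Finset.mem_inter.2 ⟨h, hx⟩)
    have h2 : x ∉ B := fun h => hxA (by
      rw [← show B ∩ bdry = A from hB]
      exact Finset.mem_inter.2 ⟨h, hx⟩)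
    rw [wall, if_neg h1, if_neg h2]

variable [Fintype V] {G : SimpleGraph V} [DecidableRel G.Adj]

/-- An edge function of the relative permutation sees only the edges crossing the two cuts. -/
theorem prod_wall {M : Type*} [CommMonoid M] (Φ : G.edgeSet → Equiv.Perm N → M)
    (hinv : ∀ e π, Φ e π⁻¹ = Φ e π) (hone : ∀ e, Φ e 1 = 1) {S B : Finset V} (hSB : S ⊆ B)
    (hd : Disjoint (cutEdges G S) (cutEdges G B)) (σ π : Equiv.Perm N) :
    ∏ e, Φ e ((wall S B σ π (src e))⁻¹ * wall S B σ π (tgt e))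
      = (∏ e ∈ cutEdges G S, Φ e (σ⁻¹ * π)) * ∏ e ∈ cutEdges G B, Φ e π := by
  classical
  rw [← Finset.prod_subset (Finset.subset_univ (cutEdges G S ∪ cutEdges G B)),
    Finset.prod_union hd]
  · congr 1
    · refine Finset.prod_congr rfl fun e he => ?_
      have h1 := Finset.disjoint_left.1 hd he
      rw [mem_cutEdges] at he h1
      have k1 := @hSB (src e)
      have k2 := @hSB (tgt e)
      by_cases a : src e ∈ S
      · have c : tgt e ∉ S := fun c => he (by simp [a, c])
        have d : tgt e ∈ B := by tauto
        simp [wall, a, c, d]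
      · have c : tgt e ∈ S := by tauto
        have d : src e ∈ B := by tauto
        have := hinv e (σ⁻¹ * π)
        rw [mul_inv_rev, inv_inv] at this
        simpa [wall, a, c, d] using this
    · refine Finset.prod_congr rfl fun e he => ?_
      have h1 := Finset.disjoint_right.1 hd he
      rw [mem_cutEdges] at he h1
      have k1 := @hSB (src e)
      have k2 := @hSB (tgt e)
      by_cases a : src e ∈ B
      · have c : tgt e ∉ B := fun c => he (by simp [a, c])
        have c' : tgt e ∉ S := fun h => c (k2 h)
        have d : src e ∉ S := by tauto
        simp [wall, a, c, c', d, hinv]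
      · have c : tgt e ∈ B := by tauto
        have a' : src e ∉ S := fun h => a (k1 h)
        have d : tgt e ∉ S := by tauto
        simp [wall, a, c, a', d]
  · intro e _ he
    rw [Finset.mem_union, mem_cutEdges, mem_cutEdges] at he
    have : wall S B σ π (src e) = wall S B σ π (tgt e) := by
      have h1 : src e ∈ S ↔ tgt e ∈ S := by tauto
      have h2 : src e ∈ B ↔ tgt e ∈ B := by tauto
      simp only [wall, h1, h2]
    rw [this, inv_mul_cancel, hone]

theorem prod_wall_self {M : Type*} [CommMonoid M] (Φ : G.edgeSet → Equiv.Perm N → M)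
    (hinv : ∀ e π, Φ e π⁻¹ = Φ e π) (hone : ∀ e, Φ e 1 = 1) (Γ : Finset V)
    (σ π : Equiv.Perm N) :
    ∏ e, Φ e ((wall Γ Γ σ π (src e))⁻¹ * wall Γ Γ σ π (tgt e))
      = ∏ e ∈ cutEdges G Γ, Φ e σ := by
  rw [← Finset.prod_subset (Finset.subset_univ (cutEdges G Γ))]
  · refine Finset.prod_congr rfl fun e he => ?_
    rw [mem_cutEdges] at he
    by_cases a : src e ∈ Γ
    · have c : tgt e ∉ Γ := fun c => he (by simp [a, c])
      simp [wall, a, c, hinv]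
    · have c : tgt e ∈ Γ := by tauto
      simp [wall, a, c]
  · intro e _ he
    rw [mem_cutEdges, not_not] at he
    have : wall Γ Γ σ π (src e) = wall Γ Γ σ π (tgt e) := by
      simp only [wall, he]
    rw [this, inv_mul_cancel, hone]

end Wall

/-! ### Spin configurations of minimal energy -/

section Energy

variable {V : Type*} {G : SimpleGraph V}

theorem eq_of_connected (hG : G.Connected) {α : Type*} {f : V → α}
    (hf : ∀ e : G.edgeSet, f (src e) = f (tgt e)) (x y : V) : f x = f y := by
  obtain ⟨w⟩ := hG.preconnected x y
  induction w with
  | nil => rfl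
  | cons h _ ih =>
    refine Eq.trans ?_ ih
    have he := edge_eq (G := G) ⟨s(_, _), h⟩
    rcases Sym2.eq_iff.1 he with ⟨h1, h2⟩ | ⟨h1, h2⟩
    · exact (congrArg f h1).trans ((hf _).trans (congrArg f h2).symm)
    · exact (congrArg f h1).trans ((hf _).symm.trans (congrArg f h2).symm)

variable {N : Type*} [Fintype N] [Fintype V] [DecidableRel G.Adj]

/-- The energy of an assignment of permutations to the vertices: the sum over the edges of the
Cayley distance between the spins at their ends. -/
noncomputable def energy (G : SimpleGraph V) [DecidableRel G.Adj] (p : V → Equiv.Perm N) : ℕ :=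
  ∑ e : G.edgeSet, permLen ((p (src e))⁻¹ * p (tgt e))

/-- The energy as a product, so that `prod_wall` applies to it. -/
theorem energy_eq_toAdd (p : V → Equiv.Perm N) : energy G p = Multiplicative.toAdd
    (∏ e : G.edgeSet, Multiplicative.ofAdd (permLen ((p (src e))⁻¹ * p (tgt e)))) := by
  rw [← ofAdd_sum]
  rfl

variable [DecidableEq V]

theorem card_cutEdges (Γ : Finset V) :
    (cutEdges G Γ).card = ∑ e : G.edgeSet, if (src e ∈ Γ ↔ tgt e ∈ Γ) then 0 else 1 := by
  rw [Finset.card_eq_sum_ones, ← Finset.sum_subset (Finset.subset_univ (cutEdges G Γ))]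
  · refine Finset.sum_congr rfl fun e he => ?_
    rw [if_neg (mem_cutEdges.1 he)]
  · intro e _ he
    rw [mem_cutEdges, not_not] at he
    rw [if_pos he]

theorem isMinCut_of_card_le {bdry A Γ Γ' : Finset V} (h : IsMinCut G bdry A Γ)
    (h' : IsCut bdry A Γ') (hc : (cutEdges G Γ').card ≤ (cutEdges G Γ).card) :
    IsMinCut G bdry A Γ' :=
  ⟨h', fun _ hΓ => hc.trans (h.2 _ hΓ)⟩

theorem sum_not_iff_lt {a b r : ℕ} (ha : a ≤ r) (hb : b ≤ r) :
    (∑ j ∈ Finset.range r, if (j < a ↔ j < b) then 0 else 1) = (a - b) + (b - a) := by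
  have h : ∀ j, (if (j < a ↔ j < b) then 0 else 1)
      = if j ∈ Finset.Ico (min a b) (max a b) then 1 else 0 := by
    intro j
    simp only [Finset.mem_Ico]
    split_ifs <;> omega
  simp_rw [h]
  rw [← Finset.sum_filter, ← Finset.card_eq_sum_ones]
  have h2 : (Finset.range r).filter (fun j => j ∈ Finset.Ico (min a b) (max a b))
      = Finset.Ico (min a b) (max a b) := by
    ext j
    simp only [Finset.mem_filter, Finset.mem_range, Finset.mem_Ico]
    omega
  rw [h2, Nat.card_Ico]
  omega

variable {bdry A : Finset V} {σ : Equiv.Perm N} {p : V → Equiv.Perm N}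

theorem isCut_level {h : V → ℕ} {r : ℕ} (hA : A ⊆ bdry) (h1 : ∀ x ∈ A, h x = r)
    (h0 : ∀ x ∈ bdry, x ∉ A → h x = 0) {j : ℕ} (hj : j < r) :
    IsCut bdry A (Finset.univ.filter fun x => j < h x) := by
  ext x
  simp only [Finset.mem_inter, Finset.mem_filter, Finset.mem_univ, true_and]
  constructor
  · rintro ⟨hx, hb⟩
    by_contra hn
    rw [h0 x hb hn] at hx
    exact Nat.not_lt_zero _ hx
  · exact fun hx => ⟨by rw [h1 x hx]; exact hj, hA hx⟩

/-- An edge crosses as many superlevel sets as the heights of its ends differ; one of the two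
truncated differences is the absolute value and the other one vanishes. -/
theorem sum_card_level {h : V → ℕ} {r : ℕ} (hr : ∀ x, h x ≤ r) :
    ∑ j ∈ Finset.range r, (cutEdges G (Finset.univ.filter fun x => j < h x)).card
      = ∑ e : G.edgeSet, ((h (src e) - h (tgt e)) + (h (tgt e) - h (src e))) := by
  simp_rw [card_cutEdges]
  rw [Finset.sum_comm]
  refine Finset.sum_congr rfl fun e _ => ?_
  rw [← sum_not_iff_lt (hr (src e)) (hr (tgt e))]
  simp

/-- The superlevel sets of a height function that drops from `r` on `A` to `0` on the rest of the
boundary are `r` cuts, and an edge crosses at most `w e` of them. So `∑ e, w e` is at least `r`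
times the size of a minimal cut, and in the case of equality all superlevel sets are minimal cuts. -/
theorem isMinCut_level_of_sum_le {h : V → ℕ} {r : ℕ} {w : G.edgeSet → ℕ} {Γ : Finset V}
    (hA : A ⊆ bdry) (hΓ : IsMinCut G bdry A Γ) (h1 : ∀ x ∈ A, h x = r)
    (h0 : ∀ x ∈ bdry, x ∉ A → h x = 0)
    (hr : ∀ x, h x ≤ r)
    (hw : ∀ e, h (src e) ≤ h (tgt e) + w e ∧ h (tgt e) ≤ h (src e) + w e)
    (hle : ∑ e, w e ≤ r * (cutEdges G Γ).card) :
    (∀ j < r, IsMinCut G bdry A (Finset.univ.filter fun x => j < h x)) ∧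
      ∀ e, h (src e) = h (tgt e) → w e = 0 := by
  have e1 : ∀ j ∈ Finset.range r, (cutEdges G Γ).card
      ≤ (cutEdges G (Finset.univ.filter fun x => j < h x)).card :=
    fun j hj => hΓ.2 _ (isCut_level hA h1 h0 (Finset.mem_range.1 hj))
  have e2 : ∀ e ∈ (Finset.univ : Finset G.edgeSet),
      ((h (src e) - h (tgt e)) + (h (tgt e) - h (src e))) ≤ w e :=
    fun e _ => by have := hw e; omega
  have s1 := Finset.sum_le_sum e1
  have s2 := Finset.sum_le_sum e2
  have s3 := sum_card_level (G := G) hr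
  have s4 : ∑ j ∈ Finset.range r, (cutEdges G Γ).card = r * (cutEdges G Γ).card := by simp
  have t1 := (Finset.sum_eq_sum_iff_of_le e1).1 (by omega)
  have t2 := (Finset.sum_eq_sum_iff_of_le e2).1 (by omega)
  refine ⟨fun j hj => isMinCut_of_card_le hΓ (isCut_level hA h1 h0 hj)
    (t1 j (Finset.mem_range.2 hj)).ge, fun e he => ?_⟩
  rw [← t2 e (Finset.mem_univ e), he]
  simp

/-- If every minimal cut lies between `S` and `B`, then a configuration of minimal energy is `σ` on
`S` and the identity outside `B`. -/
theorem eq_of_energy_le {Γ S B : Finset V} (hG : G.Connected) (hb : bdry.Nonempty) (hA : A ⊆ bdry)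
    (hΓ : IsMinCut G bdry A Γ)
    (hSB : ∀ Γ', IsMinCut G bdry A Γ' → S ⊆ Γ' ∧ Γ' ⊆ B)
    (hp : IsBdryConfig bdry A σ p) (hle : energy G p ≤ permLen σ * (cutEdges G Γ).card) :
    (∀ x ∈ S, p x = σ) ∧ ∀ x, x ∉ B → p x = 1 := by
  have hl := (isMinCut_level_of_sum_le hA hΓ (lowerHeight_of_mem hp) (lowerHeight_of_not_mem hp)
    (fun _ => min_le_right _ _) (lowerHeight_bound σ p) hle).1
  have hu := (isMinCut_level_of_sum_le hA hΓ (upperHeight_of_mem hp) (upperHeight_of_not_mem hp)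
    (fun _ => Nat.sub_le _ _) (upperHeight_bound σ p) hle).1
  rcases Nat.eq_zero_or_pos (permLen σ) with h0 | hpos
  · -- then `σ = 1` and the energy vanishes, so that the configuration is constant
    have hσ := permLen_eq_zero h0
    rw [h0, zero_mul, Nat.le_zero, energy, Finset.sum_eq_zero_iff] at hle
    obtain ⟨y, hy⟩ := hb
    have hy1 : p y = 1 := by
      by_cases hyA : y ∈ A
      · rw [hp.1 y hyA, hσ]
      · exact hp.2 y hy hyA
    have h1 : ∀ x, p x = 1 := fun x => by
      rw [← hy1]
      exact eq_of_connected hG (fun e => inv_mul_eq_one.1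
        (permLen_eq_zero (hle e (Finset.mem_univ e)))) x y
    exact ⟨fun x _ => by rw [h1, hσ], fun x _ => h1 x⟩
  -- the top level of `upperHeight` is the set where `p = σ`, the bottom level of `lowerHeight` is
  -- the set where `p ≠ 1`, and both are minimal cuts
  constructor
  · intro x hx
    have h1 := (hSB _ (hu (permLen σ - 1) (by omega))).1 hx
    have h1' := (Finset.mem_filter.1 h1).2
    unfold upperHeight at h1'
    have h2 := permLen_eq_zero (π := (p x)⁻¹ * σ) (by omega)
    exact (inv_mul_eq_one.1 h2)
  · intro x hx
    have h1 : ¬ 0 < lowerHeight σ p x := by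
      intro h1
      exact hx ((hSB _ (hl 0 hpos)).2 (by simpa using h1))
    apply permLen_eq_zero
    unfold lowerHeight at h1
    omega

theorem eq_of_energy_le_of_unique {Γ : Finset V} (hG : G.Connected) (hb : bdry.Nonempty)
    (hA : A ⊆ bdry) (hΓ : ∀ Γ', IsMinCut G bdry A Γ' ↔ Γ' = Γ)
    (hp : IsBdryConfig bdry A σ p) (hle : energy G p ≤ permLen σ * (cutEdges G Γ).card) (x : V) :
    p x = if x ∈ Γ then σ else 1 := by
  have h := eq_of_energy_le hG hb hA ((hΓ Γ).2 rfl) (S := Γ) (B := Γ)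
    (fun Γ' h => by rw [(hΓ Γ').1 h]; exact ⟨le_rfl, le_rfl⟩) hp hle
  split_ifs with hx
  · exact h.1 x hx
  · exact h.2 x hx

/-- The union and the intersection of two minimal cuts are minimal cuts, by submodularity of the cut
function. -/
theorem isMinCut_union_inter {Γ₁ Γ₂ : Finset V} (h₁ : IsMinCut G bdry A Γ₁)
    (h₂ : IsMinCut G bdry A Γ₂) :
    IsMinCut G bdry A (Γ₁ ∪ Γ₂) ∧ IsMinCut G bdry A (Γ₁ ∩ Γ₂) := by
  have hc := (h₁.2 _ h₂.1).antisymm (h₂.2 _ h₁.1)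
  have hu : IsCut bdry A (Γ₁ ∪ Γ₂) := by
    rw [IsCut, Finset.union_inter_distrib_right, h₁.1, h₂.1, Finset.union_self]
  have hi : IsCut bdry A (Γ₁ ∩ Γ₂) := by
    rw [IsCut, Finset.inter_inter_distrib_right, h₁.1, h₂.1, Finset.inter_self]
  have hsub : (cutEdges G (Γ₁ ∪ Γ₂)).card + (cutEdges G (Γ₁ ∩ Γ₂)).card
      ≤ (cutEdges G Γ₁).card + (cutEdges G Γ₂).card := by
    simp_rw [card_cutEdges]
    rw [← Finset.sum_add_distrib, ← Finset.sum_add_distrib]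
    refine Finset.sum_le_sum fun e _ => ?_
    simp only [Finset.mem_union, Finset.mem_inter]
    by_cases a : src e ∈ Γ₁ <;> by_cases b : src e ∈ Γ₂ <;> by_cases c : tgt e ∈ Γ₁ <;>
      by_cases d : tgt e ∈ Γ₂ <;> simp [a, b, c, d]
  have h3 := h₁.2 _ hu
  have h4 := h₁.2 _ hi
  exact ⟨isMinCut_of_card_le h₁ hu (by omega), isMinCut_of_card_le h₁ hi (by omega)⟩

theorem subset_or_subset_of_two {Γ₁ Γ₂ : Finset V}
    (h : ∀ Γ', IsMinCut G bdry A Γ' ↔ Γ' = Γ₁ ∨ Γ' = Γ₂) : Γ₁ ⊆ Γ₂ ∨ Γ₂ ⊆ Γ₁ := by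
  have h1 := (isMinCut_union_inter ((h Γ₁).2 (Or.inl rfl)) ((h Γ₂).2 (Or.inr rfl))).2
  rcases (h _).1 h1 with h2 | h2
  · exact Or.inl (Finset.inter_eq_left.1 h2)
  · exact Or.inr (Finset.inter_eq_right.1 h2)

/-- If there are two minimal cuts, then they are crossed by some edge. -/
theorem card_cutEdges_pos {Γ₁ Γ₂ : Finset V} (hG : G.Connected) (hb : bdry.Nonempty)
    (hne : Γ₁ ≠ Γ₂) (h₁ : IsMinCut G bdry A Γ₁) (h₂ : IsMinCut G bdry A Γ₂) :
    0 < (cutEdges G Γ₁).card := by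
  by_contra hn
  have hc := (h₁.2 _ h₂.1).antisymm (h₂.2 _ h₁.1)
  have key : ∀ Γ : Finset V, (cutEdges G Γ).card = 0 → ∀ x y, (x ∈ Γ) = (y ∈ Γ) := by
    intro Γ h0 x y
    refine eq_of_connected hG (f := fun x => x ∈ Γ) (fun e => ?_) x y
    by_contra he
    have : e ∈ cutEdges G Γ := mem_cutEdges.2 fun h => he (propext h)
    rw [Finset.card_eq_zero.1 h0] at this
    exact Finset.notMem_empty _ this
  obtain ⟨y, hy⟩ := hb
  apply hne
  have hA : y ∈ Γ₁ ↔ y ∈ Γ₂ := by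
    have e1 := h₁.1
    have e2 := h₂.1
    unfold IsCut at e1 e2
    have := (congrArg (y ∈ ·) (e1.trans e2.symm)).to_iff
    simpa [hy] using this
  ext x
  rw [key Γ₁ (by omega) x y, key Γ₂ (by omega) x y, hA]

/-- With exactly two minimal cuts `S ⊂ B`, a configuration of minimal energy is constant between
them: otherwise one could move one of the cuts across a part of `B \ S`. -/
theorem exists_eq_of_energy_le_of_two {S B : Finset V} (hG : G.Connected) (hb : bdry.Nonempty)
    (hA : A ⊆ bdry) (hSB : S ⊆ B) (hne : S ≠ B)
    (h : ∀ Γ', IsMinCut G bdry A Γ' ↔ Γ' = S ∨ Γ' = B)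
    (hp : IsBdryConfig bdry A σ p) (hle : energy G p ≤ permLen σ * (cutEdges G S).card) :
    ∃ π, ∀ x, p x = if x ∈ S then σ else if x ∈ B then π else 1 := by
  classical
  have hS := (h S).2 (Or.inl rfl)
  have hB := (h B).2 (Or.inr rfl)
  have h1 := eq_of_energy_le hG hb hA hS (S := S) (B := B)
    (fun Γ' h' => by
      rcases (h Γ').1 h' with rfl | rfl
      · exact ⟨le_rfl, hSB⟩
      · exact ⟨hSB, le_rfl⟩) hp hle
  obtain ⟨hl, hw⟩ := isMinCut_level_of_sum_le hA hS (lowerHeight_of_mem hp)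
    (lowerHeight_of_not_mem hp) (fun _ => min_le_right _ _) (lowerHeight_bound σ p) hle
  obtain ⟨x₀, hx₀B, hx₀S⟩ : ∃ x, x ∈ B ∧ x ∉ S := by
    by_contra hn
    push Not at hn
    exact hne (hSB.antisymm hn)
  -- the height is constant between the cuts, so that edges between them have no energy
  have hconst : ∀ x y, x ∈ B → x ∉ S → y ∈ B → y ∉ S → ∀ j < permLen σ,
      j < lowerHeight σ p x → j < lowerHeight σ p y := by
    intro x y hxB hxS hyB hyS j hj hjx
    have hx : x ∈ Finset.univ.filter fun x => j < lowerHeight σ p x := by simpa using hjx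
    have hy : y ∈ Finset.univ.filter fun x => j < lowerHeight σ p x := by
      rcases (h _).1 (hl j hj) with h2 | h2
      · rw [h2] at hx
        exact absurd hx hxS
      · rw [h2]
        exact hyB
    exact (Finset.mem_filter.1 hy).2
  have hheight : ∀ x y, x ∈ B → x ∉ S → y ∈ B → y ∉ S →
      lowerHeight σ p x ≤ lowerHeight σ p y := by
    intro x y hxB hxS hyB hyS
    by_contra hn
    have h3 : lowerHeight σ p x ≤ permLen σ := min_le_right _ _
    exact lt_irrefl _ (hconst x y hxB hxS hyB hyS (lowerHeight σ p y) (by omega) (by omega))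
  have hedge : ∀ e : G.edgeSet, src e ∈ B → src e ∉ S → tgt e ∈ B → tgt e ∉ S →
      p (src e) = p (tgt e) := fun e a b c d =>
    inv_mul_eq_one.1 (permLen_eq_zero (hw e (le_antisymm (hheight _ _ a b c d)
      (hheight _ _ c d a b))))
  -- add to `S` the part of `B \ S` where the spin is `p x₀`, or the rest of `B \ S`
  let Γ := Finset.univ.filter fun x => x ∈ S ∨ (x ∈ B ∧ p x = p x₀)
  let Γ' := Finset.univ.filter fun x => x ∈ S ∨ (x ∈ B ∧ p x ≠ p x₀)
  have hmem : ∀ x, x ∈ bdry → (x ∈ S ↔ x ∈ B) := by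
    intro x hx
    have := (congrArg (x ∈ ·) ((show S ∩ bdry = A from hS.1).trans
      (show B ∩ bdry = A from hB.1).symm)).to_iff
    simpa [hx] using this
  have hcut : ∀ T : Finset V, S ⊆ T → T ⊆ B → IsCut bdry A T := by
    intro T h1 h2
    rw [IsCut, ← show S ∩ bdry = A from hS.1]
    ext x
    simp only [Finset.mem_inter, and_congr_left_iff]
    exact fun hx => ⟨fun hT => (hmem x hx).2 (h2 hT), fun hT => h1 hT⟩
  have hΓ : IsCut bdry A Γ := hcut Γ (fun x hx => by simp [Γ, hx]) (fun x hx => by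
    rcases (Finset.mem_filter.1 hx).2 with h2 | h2
    · exact hSB h2
    · exact h2.1)
  have hΓ' : IsCut bdry A Γ' := hcut Γ' (fun x hx => by simp [Γ', hx]) (fun x hx => by
    rcases (Finset.mem_filter.1 hx).2 with h2 | h2
    · exact hSB h2
    · exact h2.1)
  -- no edge joins the two parts of `B \ S`
  have hsum : (cutEdges G Γ).card + (cutEdges G Γ').card
      = (cutEdges G S).card + (cutEdges G B).card := by
    simp_rw [card_cutEdges]
    rw [← Finset.sum_add_distrib, ← Finset.sum_add_distrib]
    refine Finset.sum_congr rfl fun e _ => ?_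
    have hs : ∀ x, (x ∈ S ∧ x ∈ B) ∨ (x ∉ S ∧ x ∈ B) ∨ (x ∉ S ∧ x ∉ B) := fun x => by
      have := @hSB x
      tauto
    simp only [Γ, Γ', Finset.mem_filter, Finset.mem_univ, true_and]
    by_cases hM : (src e ∉ S ∧ src e ∈ B) ∧ (tgt e ∉ S ∧ tgt e ∈ B)
    · obtain ⟨⟨a, b⟩, c, d⟩ := hM
      simp [a, b, c, d, hedge e b a d c]
    · rcases hs (src e) with ⟨a, b⟩ | ⟨a, b⟩ | ⟨a, b⟩ <;>
        rcases hs (tgt e) with ⟨c, d⟩ | ⟨c, d⟩ | ⟨c, d⟩ <;>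
        by_cases u : p (src e) = p x₀ <;> by_cases v : p (tgt e) = p x₀ <;>
        simp [a, b, c, d, u, v] at hM ⊢
  have hm : IsMinCut G bdry A Γ := by
    refine isMinCut_of_card_le hS hΓ ?_
    have := hS.2 _ hΓ'
    have := hB.2 _ hS.1
    omega
  have hΓB : Γ = B := by
    refine ((h Γ).1 hm).resolve_left fun h2 => hx₀S ?_
    rw [← h2]
    simp [Γ, hx₀B]
  refine ⟨p x₀, fun x => ?_⟩
  split_ifs with hxS hxB
  · exact h1.1 x hxS
  · rw [← hΓB] at hxB
    exact ((Finset.mem_filter.1 hxB).2.resolve_left hxS).2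
  · exact h1.2 x hxB

theorem energy_wall {S B : Finset V} (hSB : S ⊆ B)
    (hd : Disjoint (cutEdges G S) (cutEdges G B)) (σ π : Equiv.Perm N) :
    energy G (wall S B σ π) = (cutEdges G S).card * permLen (σ⁻¹ * π)
      + (cutEdges G B).card * permLen π := by
  rw [energy_eq_toAdd, prod_wall (fun _ π => Multiplicative.ofAdd (permLen π))
    (fun _ π => by rw [permLen_inv]) (fun _ => by rw [permLen_one]; rfl) hSB hd]
  simp

/-- With exactly two minimal cuts, which share no edge, the configurations of minimal energy are
domain walls with a permutation on a geodesic between the two boundary values. -/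
theorem exists_geodesic_of_energy_le {S B : Finset V} (hG : G.Connected) (hb : bdry.Nonempty)
    (hA : A ⊆ bdry) (hSB : S ⊆ B) (hne : S ≠ B)
    (h : ∀ Γ', IsMinCut G bdry A Γ' ↔ Γ' = S ∨ Γ' = B)
    (hd : Disjoint (cutEdges G S) (cutEdges G B))
    (hp : IsBdryConfig bdry A σ p) (hle : energy G p ≤ permLen σ * (cutEdges G S).card) :
    ∃ π, p = wall S B σ π ∧ permLen π + permLen (π⁻¹ * σ) ≤ permLen σ := by
  obtain ⟨π, hπ⟩ := exists_eq_of_energy_le_of_two hG hb hA hSB hne h hp hle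
  have hS := (h S).2 (Or.inl rfl)
  have hB := (h B).2 (Or.inr rfl)
  have hpos := card_cutEdges_pos hG hb hne hS hB
  have hc := (hS.2 _ hB.1).antisymm (hB.2 _ hS.1)
  have hwall : p = wall S B σ π := funext hπ
  refine ⟨π, hwall, ?_⟩
  rw [hwall, energy_wall hSB hd, ← hc, ← mul_add, mul_comm (permLen σ)] at hle
  have := Nat.le_of_mul_le_mul_left hle hpos
  rw [permLen_inv_mul_comm] at this
  omega

end Energy

/-! ### Two independent families of replicas -/

section Extend

variable {N N' : Type*} {V : Type*} [Fintype V] [DecidableEq V]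

theorem extend_sumCongr (bdry A : Finset V) (α : Equiv.Perm N) (β : Equiv.Perm N')
    (q : ↥(Finset.univ \ bdry : Finset V) → Equiv.Perm N)
    (q' : ↥(Finset.univ \ bdry : Finset V) → Equiv.Perm N') :
    extend bdry A (Equiv.Perm.sumCongr α β) (fun x => Equiv.Perm.sumCongr (q x) (q' x))
      = fun x => Equiv.Perm.sumCongr (extend bdry A α q x) (extend bdry A β q' x) := by
  funext x
  unfold extend
  split_ifs
  · rfl
  · exact Equiv.Perm.sumCongr_one.symm
  · rfl

theorem extend_of_mem_bulk (bdry A : Finset V) (σ : Equiv.Perm N)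
    (q : ↥(Finset.univ \ bdry : Finset V) → Equiv.Perm N)
    (x : ↥(Finset.univ \ bdry : Finset V)) : extend bdry A σ q x.1 = q x := by
  simp [extend, (Finset.mem_sdiff.1 x.2).2]

theorem isBdryConfig_extend {bdry A : Finset V} (hA : A ⊆ bdry) (σ : Equiv.Perm N)
    (q : ↥(Finset.univ \ bdry : Finset V) → Equiv.Perm N) :
    IsBdryConfig bdry A σ (extend bdry A σ q) :=
  ⟨fun x hx => by simp [extend, hA hx, hx], fun x hx hxA => by simp [extend, hx, hxA]⟩

theorem extend_restrict {bdry A : Finset V} {σ : Equiv.Perm N} {p : V → Equiv.Perm N}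
    (hp : IsBdryConfig bdry A σ p) : extend bdry A σ (fun x => p x.1) = p := by
  funext x
  unfold extend
  split_ifs with h1 h2
  · exact (hp.1 x h2).symm
  · exact (hp.2 x h1 h2).symm
  · rfl

end Extend

section SumReplica

variable {N N' : Type*}

theorem fixSub_sumCongr_inl (α : Equiv.Perm N) (β : Equiv.Perm N') :
    (fun i : N ⊕ N' => if i.isLeft then (1 : ℝ) else 0) ∈ fixSub (Equiv.Perm.sumCongr α β) := by
  rintro (i | i) <;> rfl

variable [Fintype N] [Fintype N']

theorem permLen_sumCongr (α : Equiv.Perm N) (β : Equiv.Perm N') :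
    permLen (Equiv.Perm.sumCongr α β) = permLen α + permLen β := by
  let F : fixSub (Equiv.Perm.sumCongr α β) ≃ₗ[ℝ] fixSub α × fixSub β :=
    { toFun := fun f => (⟨fun i => f.1 (Sum.inl i), fun i => f.2 (Sum.inl i)⟩,
        ⟨fun i => f.1 (Sum.inr i), fun i => f.2 (Sum.inr i)⟩)
      map_add' := fun _ _ => rfl
      map_smul' := fun _ _ => rfl
      invFun := fun g => ⟨Sum.elim g.1.1 g.2.1, by
        rintro (i | i)
        · exact g.1.2 i
        · exact g.2.2 i⟩
      left_inv := fun f => by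
        ext i
        rcases i with i | i <;> rfl
      right_inv := fun g => rfl }
  have h := F.finrank_eq
  rw [Module.finrank_prod] at h
  have h1 := permLen_add (Equiv.Perm.sumCongr α β)
  have h2 := permLen_add α
  have h3 := permLen_add β
  rw [Fintype.card_sum] at h1
  omega

/-- A permutation whose cycles are contained in those of `α ⊕ β` acts separately on the two
summands. -/
theorem exists_sumCongr_eq {α : Equiv.Perm N} {β : Equiv.Perm N'} {π : Equiv.Perm (N ⊕ N')}
    (h : fixSub (Equiv.Perm.sumCongr α β) ≤ fixSub π) :
    ∃ g : Equiv.Perm N × Equiv.Perm N', Equiv.Perm.sumCongr g.1 g.2 = π := by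
  have h1 := h (fixSub_sumCongr_inl α β)
  obtain ⟨g, hg⟩ := Equiv.Perm.mem_sumCongrHom_range_of_perm_mapsTo_inl (σ := π) (by
    rintro _ ⟨i, rfl⟩
    have h2 := h1 (Sum.inl i)
    simp only [Sum.isLeft_inl, if_true] at h2
    rcases hi : π (Sum.inl i) with j | j
    · exact ⟨j, rfl⟩
    · rw [hi] at h2
      simp at h2)
  exact ⟨g, hg⟩

variable [DecidableEq N] [DecidableEq N']

theorem cycProd_sumCongr {R ι : Type*} [CommSemiring R] [Fintype ι] (w : ι → R)
    (α : Equiv.Perm N) (β : Equiv.Perm N') :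
    cycProd (fun l => ∑ m, w m ^ l) (Equiv.Perm.sumCongr α β)
      = cycProd (fun l => ∑ m, w m ^ l) α * cycProd (fun l => ∑ m, w m ^ l) β := by
  classical
  rw [← sum_prod_fixed, ← sum_prod_fixed, ← sum_prod_fixed, Finset.sum_mul_sum,
    ← (Equiv.sumArrowEquivProdArrow N N' ι).symm.sum_comp, Fintype.sum_prod_type]
  refine Finset.sum_congr rfl fun i _ => Finset.sum_congr rfl fun i' _ => ?_
  have h : (∀ j, (Equiv.sumArrowEquivProdArrow N N' ι).symm (i, i')
      (Equiv.Perm.sumCongr α β j) = (Equiv.sumArrowEquivProdArrow N N' ι).symm (i, i') j)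
      ↔ (∀ j, i (α j) = i j) ∧ ∀ j, i' (β j) = i' j := by
    rw [Sum.forall]
    rfl
  by_cases h1 : ∀ j, i (α j) = i j
  · by_cases h2 : ∀ j, i' (β j) = i' j
    · rw [if_pos (h.2 ⟨h1, h2⟩), if_pos h1, if_pos h2, Fintype.prod_sum_type]
      rfl
    · rw [if_neg fun hh => h2 (h.1 hh).2, if_neg h2, mul_zero]
  · rw [if_neg fun hh => h1 (h.1 hh).1, if_neg h1, zero_mul]

variable {V : Type*} [Fintype V] {G : SimpleGraph V} [DecidableRel G.Adj]

theorem configWeight_sumCongr (L : LinkStates G) (p : V → Equiv.Perm N) (q : V → Equiv.Perm N') :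
    configWeight L (fun x => Equiv.Perm.sumCongr (p x) (q x))
      = configWeight L p * configWeight L q := by
  unfold configWeight
  rw [← Finset.prod_mul_distrib]
  refine Finset.prod_congr rfl fun e _ => ?_
  rw [← cycProd_sumCongr, Equiv.Perm.sumCongr_inv, Equiv.Perm.sumCongr_mul]

variable [DecidableEq V]

theorem replicaTrace_sumCongr (L : LinkStates G) (bdry A : Finset V) (α : Equiv.Perm N)
    (β : Equiv.Perm N') (ψ : BulkTensors L bdry) :
    replicaTrace L bdry A (Equiv.Perm.sumCongr α β) ψ
      = replicaTrace L bdry A α ψ * replicaTrace L bdry A β ψ := by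
  unfold replicaTrace
  rw [Finset.sum_mul_sum, ← (Equiv.sumArrowEquivProdArrow N N' (Idx L A)).symm.sum_comp,
    Fintype.sum_prod_type]
  refine Finset.sum_congr rfl fun a _ => Finset.sum_congr rfl fun a' _ => ?_
  rw [Fintype.prod_sum_type, Equiv.Perm.sumCongr_inv]
  rfl

/-! ### Mean and variance of the moments -/

theorem integrable_boundaryMoment (L : LinkStates G) {bdry A : Finset V} (hA : A ⊆ bdry)
    (m : ℕ) : Integrable (boundaryMoment L bdry A (m + 1)) (tensorLaw L bdry) := by
  have h := ((integrable_replicaTrace L bdry A (finRotate (m + 1))).const_mul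
    ((minCutDim L bdry A : ℂ) ^ m)).re
  refine h.congr (ae_of_all _ fun ψ => ?_)
  simp only [← boundaryMoment_eq L hA]
  exact Complex.ofReal_re _

theorem sq_boundaryMoment (L : LinkStates G) {bdry A : Finset V} (hA : A ⊆ bdry) (m : ℕ)
    (ψ : BulkTensors L bdry) : ((boundaryMoment L bdry A (m + 1) ψ ^ 2 : ℝ) : ℂ)
      = (minCutDim L bdry A : ℂ) ^ (2 * m) * replicaTrace L bdry A
        (Equiv.Perm.sumCongr (finRotate (m + 1)) (finRotate (m + 1))) ψ := by
  rw [replicaTrace_sumCongr, Complex.ofReal_pow, boundaryMoment_eq L hA]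
  ring

theorem memLp_boundaryMoment (L : LinkStates G) {bdry A : Finset V} (hA : A ⊆ bdry)
    (m : ℕ) : MemLp (boundaryMoment L bdry A (m + 1)) 2 (tensorLaw L bdry) := by
  rw [memLp_two_iff_integrable_sq (integrable_boundaryMoment L hA m).aestronglyMeasurable]
  have h := ((integrable_replicaTrace L bdry A
    (Equiv.Perm.sumCongr (finRotate (m + 1)) (finRotate (m + 1)))).const_mul
    ((minCutDim L bdry A : ℂ) ^ (2 * m))).re
  refine h.congr (ae_of_all _ fun ψ => ?_)
  simp only [← sq_boundaryMoment L hA]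
  exact Complex.ofReal_re _

theorem meanMoment_eq (L : LinkStates G) {bdry A : Finset V} (hA : A ⊆ bdry) (m : ℕ) :
    meanMoment L bdry A (m + 1) = ∑ q : ↥(Finset.univ \ bdry : Finset V) →
      Equiv.Perm (Fin (m + 1)), (minCutDim L bdry A : ℝ) ^ m *
        configWeight L (extend bdry A (finRotate (m + 1)) q) := by
  rw [← Complex.ofReal_inj, meanMoment, ← integral_complex_ofReal]
  simp_rw [boundaryMoment_eq L hA]
  rw [integral_const_mul, integral_replicaTrace L hA, ← Finset.mul_sum]
  push_cast
  rfl

instance (L : LinkStates G) (bdry : Finset V) : IsProbabilityMeasure (tensorLaw L bdry) := by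
  unfold tensorLaw
  infer_instance

open scoped Classical in
/-- Only the configurations that couple the two families of replicas contribute to the
variance. -/
theorem varMoment_eq (L : LinkStates G) {bdry A : Finset V} (hA : A ⊆ bdry) (m : ℕ) :
    varMoment L bdry A (m + 1) = ∑ Q ∈ Finset.univ.filter
      (fun Q : ↥(Finset.univ \ bdry : Finset V) → Equiv.Perm (Fin (m + 1) ⊕ Fin (m + 1)) =>
        ¬ ∀ x, ∃ g : Equiv.Perm (Fin (m + 1)) × Equiv.Perm (Fin (m + 1)),
          Equiv.Perm.sumCongr g.1 g.2 = Q x),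
      (minCutDim L bdry A : ℝ) ^ (2 * m) * configWeight L
        (extend bdry A (Equiv.Perm.sumCongr (finRotate (m + 1)) (finRotate (m + 1))) Q) := by
  have h1 : varMoment L bdry A (m + 1)
      = ∫ ψ, boundaryMoment L bdry A (m + 1) ψ ^ 2 ∂(tensorLaw L bdry)
        - meanMoment L bdry A (m + 1) ^ 2 := by
    have h2 := variance_eq_sub (memLp_boundaryMoment L hA m)
    rw [variance_eq_integral (integrable_boundaryMoment L hA m).aemeasurable] at h2
    exact h2
  have h3 : ∫ ψ, boundaryMoment L bdry A (m + 1) ψ ^ 2 ∂(tensorLaw L bdry)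
      = ∑ Q : ↥(Finset.univ \ bdry : Finset V) → Equiv.Perm (Fin (m + 1) ⊕ Fin (m + 1)),
        (minCutDim L bdry A : ℝ) ^ (2 * m) * configWeight L
          (extend bdry A (Equiv.Perm.sumCongr (finRotate (m + 1)) (finRotate (m + 1))) Q) := by
    rw [← Complex.ofReal_inj, ← integral_complex_ofReal]
    simp_rw [sq_boundaryMoment L hA]
    rw [integral_const_mul, integral_replicaTrace L hA, ← Finset.mul_sum]
    push_cast
    rfl
  -- the square of the mean consists of the decoupled configurations
  have h4 : meanMoment L bdry A (m + 1) ^ 2 = ∑ Q ∈ Finset.univ.filter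
      (fun Q : ↥(Finset.univ \ bdry : Finset V) → Equiv.Perm (Fin (m + 1) ⊕ Fin (m + 1)) =>
        ∀ x, ∃ g : Equiv.Perm (Fin (m + 1)) × Equiv.Perm (Fin (m + 1)),
          Equiv.Perm.sumCongr g.1 g.2 = Q x),
      (minCutDim L bdry A : ℝ) ^ (2 * m) * configWeight L
        (extend bdry A (Equiv.Perm.sumCongr (finRotate (m + 1)) (finRotate (m + 1))) Q) := by
    rw [sq, meanMoment_eq L hA, Finset.sum_mul_sum, ← Finset.sum_product']
    refine Finset.sum_bij (fun qq _ x => Equiv.Perm.sumCongr (qq.1 x) (qq.2 x)) ?_ ?_ ?_ ?_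
    · intro qq _
      simp only [Finset.mem_filter, Finset.mem_univ, true_and]
      exact fun x => ⟨(qq.1 x, qq.2 x), rfl⟩
    · intro a _ b _ hab
      have h5 : ∀ x, a.1 x = b.1 x ∧ a.2 x = b.2 x := fun x => by
        have h6 := @Equiv.Perm.sumCongrHom_injective (Fin (m + 1)) (Fin (m + 1))
          (a.1 x, a.2 x) (b.1 x, b.2 x) (congrFun hab x)
        exact Prod.mk.inj h6
      exact Prod.ext (funext fun x => (h5 x).1) (funext fun x => (h5 x).2)
    · intro Q hQ
      choose g hg using (Finset.mem_filter.1 hQ).2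
      exact ⟨(fun x => (g x).1, fun x => (g x).2), by simp, funext hg⟩
    · intro qq _
      rw [extend_sumCongr, configWeight_sumCongr]
      ring
  rw [h1, h3, h4, ← Finset.sum_filter_add_sum_filter_not Finset.univ
    (fun Q : ↥(Finset.univ \ bdry : Finset V) → Equiv.Perm (Fin (m + 1) ⊕ Fin (m + 1)) =>
        ∀ x, ∃ g : Equiv.Perm (Fin (m + 1)) × Equiv.Perm (Fin (m + 1)),
          Equiv.Perm.sumCongr g.1 g.2 = Q x), add_sub_cancel_left]

end SumReplica

/-! ### Rescaled weights -/

section Asymp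

theorem cycProd_congr {N M : Type*} [Fintype N] [CommMonoid M] {f g : ℕ → M}
    (h : ∀ l, f (l + 1) = g (l + 1)) (π : Equiv.Perm N) : cycProd f π = cycProd g π := by
  classical
  unfold cycProd
  refine Finset.prod_congr rfl fun q _ => ?_
  have h1 : 0 < (Finset.univ.filter fun i => Quotient.mk _ i = q).card := by
    induction q using Quotient.ind with
    | _ i => exact Finset.card_pos.2 ⟨i, by simp⟩
  obtain ⟨l, hl⟩ := Nat.exists_eq_succ_of_ne_zero h1.ne'
  rw [hl]
  exact h l

theorem tendsto_cycProd {N : Type*} [Fintype N] {f : ℕ → ℕ → ℝ} {g : ℕ → ℝ}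
    (h : ∀ l, Tendsto (fun n => f n l) atTop (𝓝 (g l))) (π : Equiv.Perm N) :
    Tendsto (fun n => cycProd (f n) π) atTop (𝓝 (cycProd g π)) :=
  tendsto_finsetProd _ fun _ _ => h _

variable {V : Type*} {G : SimpleGraph V}

/-- The moment of the rescaled entanglement spectrum of a link state. -/
noncomputable def linkMoment (L : LinkStates G) (e : G.edgeSet) (k : ℕ) : ℝ :=
  ∫ z, z ^ k ∂(linkMeasure L e)

theorem linkMoment_succ (L : LinkStates G) (e : G.edgeSet) (m : ℕ) :
    linkMoment L e (m + 1) = (L.dim e : ℝ) ^ m * ∑ i, L.coeff e i ^ (m + 1) := by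
  unfold linkMoment linkMeasure
  rw [integral_pow_empirical (dim_pos L e), Finset.sum_range]
  congr 1
  refine Finset.sum_congr rfl fun i _ => ?_
  rw [dif_pos i.2]

variable {N : Type*} [Fintype N]

/-- Rescaling `tr Λ^l` by `D_e^(l - 1)` for each cycle extracts a factor `D_e^(-|g|)`. -/
theorem cycProd_coeff (L : LinkStates G) (e : G.edgeSet) (g : Equiv.Perm N) :
    cycProd (fun l => ∑ m, L.coeff e m ^ l) g
      = ((L.dim e : ℝ) ^ permLen g)⁻¹ * cycProd (linkMoment L e) g := by
  rw [← inv_pow, ← cycProd_pow, ← cycProd_mul]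
  refine cycProd_congr (fun l => ?_) g
  have : (L.dim e : ℝ) ≠ 0 := by exact_mod_cast (dim_pos L e).ne'
  rw [linkMoment_succ, Nat.add_sub_cancel, inv_pow, inv_mul_cancel_left₀ (pow_ne_zero _ this)]

theorem cycProd_coeff_inv (L : LinkStates G) (e : G.edgeSet) (g : Equiv.Perm N) :
    cycProd (fun l => ∑ m, L.coeff e m ^ l) g⁻¹ = cycProd (fun l => ∑ m, L.coeff e m ^ l) g :=
  cycProd_inv _ g

theorem cycProd_coeff_one (L : LinkStates G) (e : G.edgeSet) :
    cycProd (fun l => ∑ m, L.coeff e m ^ l) (1 : Equiv.Perm N) = 1 :=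
  cycProd_one _ (by simp [L.sum_coeff])

variable [Fintype V] [DecidableRel G.Adj]

variable {L : ℕ → LinkStates G} {D : ℕ → ℝ} {μ : G.edgeSet → Measure ℝ}

theorem configWeight_isBigO (hL : BoundedSpectralVariation L D μ) (p : V → Equiv.Perm N) :
    (fun n => configWeight (L n) p) =O[atTop] fun n => (D n ^ energy G p)⁻¹ := by
  unfold configWeight energy
  simp_rw [cycProd_coeff]
  simp_rw [← Finset.prod_pow_eq_pow_sum, ← Finset.prod_inv_distrib]
  refine IsBigO.finsetProd fun e _ => ?_
  have h1 : (fun n => cycProd (linkMoment (L n) e) ((p (src e))⁻¹ * p (tgt e)))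
      =O[atTop] fun _ => (1 : ℝ) :=
    (tendsto_cycProd (fun l => hL.moments e l) _).isBigO_one ℝ
  simpa using (((hL.dim_theta e).pow _).inv.isBigO).mul h1

variable [DecidableEq V]

theorem prod_cycProd_coeff (L : LinkStates G) (Γ : Finset V) (g : Equiv.Perm N) :
    ∏ e ∈ cutEdges G Γ, cycProd (fun l => ∑ m, L.coeff e m ^ l) g
      = ((cutDim L Γ : ℝ) ^ permLen g)⁻¹ *
        cycProd (fun l => ∏ e ∈ cutEdges G Γ, linkMoment L e l) g := by
  simp_rw [cycProd_coeff]
  rw [Finset.prod_mul_distrib, cycProd_finset_prod, Finset.prod_inv_distrib,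
    Finset.prod_pow, cutDim, Nat.cast_prod]

theorem configWeight_wall (L : LinkStates G) {S B : Finset V} (hSB : S ⊆ B)
    (hd : Disjoint (cutEdges G S) (cutEdges G B)) (σ π : Equiv.Perm N) :
    configWeight L (wall S B σ π) =
      (((cutDim L S : ℝ) ^ permLen (σ⁻¹ * π))⁻¹ *
        cycProd (fun l => ∏ e ∈ cutEdges G S, linkMoment L e l) (σ⁻¹ * π)) *
      (((cutDim L B : ℝ) ^ permLen π)⁻¹ *
        cycProd (fun l => ∏ e ∈ cutEdges G B, linkMoment L e l) π) := by
  rw [← prod_cycProd_coeff, ← prod_cycProd_coeff]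
  exact prod_wall (fun e g => cycProd (fun l => ∑ m, L.coeff e m ^ l) g)
    (fun e g => cycProd_coeff_inv L e g) (fun e => cycProd_coeff_one L e) hSB hd σ π

theorem configWeight_wall_self (L : LinkStates G) (Γ : Finset V) (σ π : Equiv.Perm N) :
    configWeight L (wall Γ Γ σ π) = ((cutDim L Γ : ℝ) ^ permLen σ)⁻¹ *
        cycProd (fun l => ∏ e ∈ cutEdges G Γ, linkMoment L e l) σ := by
  rw [← prod_cycProd_coeff]
  exact prod_wall_self (fun e g => cycProd (fun l => ∑ m, L.coeff e m ^ l) g)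
    (fun e g => cycProd_coeff_inv L e g) (fun e => cycProd_coeff_one L e) Γ σ π

theorem cutMoment_eq (hL : BoundedSpectralVariation L D μ) (Γ : Finset V) (k : ℕ) :
    cutMoment μ Γ k = ∏ e ∈ cutEdges G Γ, ∫ z, z ^ k ∂(μ e) := by
  have := hL.prob
  unfold cutMoment cutMeasure
  rw [integral_map (by fun_prop) (by fun_prop)]
  simp_rw [← Finset.prod_pow]
  rw [integral_fintype_prod_eq_prod (f := fun _ z => z ^ k)]
  exact Finset.prod_coe_sort (cutEdges G Γ) (fun e => ∫ z, z ^ k ∂(μ e))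

theorem tendsto_prod_linkMoment (hL : BoundedSpectralVariation L D μ) (Γ : Finset V) (k : ℕ) :
    Tendsto (fun n => ∏ e ∈ cutEdges G Γ, linkMoment (L n) e k) atTop (𝓝 (cutMoment μ Γ k)) := by
  rw [cutMoment_eq hL]
  exact tendsto_finsetProd _ fun e _ => hL.moments e k

theorem cutDim_isTheta (hL : BoundedSpectralVariation L D μ) (Γ : Finset V) :
    (fun n => (cutDim (L n) Γ : ℝ)) =Θ[atTop] fun n => D n ^ (cutEdges G Γ).card := by
  unfold cutDim
  push_cast
  simp_rw [← Finset.prod_const]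
  exact IsTheta.finsetProd fun e _ => hL.dim_theta e

theorem minCutDim_le {L : LinkStates G} {bdry A Γ : Finset V} (h : IsMinCut G bdry A Γ) :
    minCutDim L bdry A ≤ cutDim L Γ :=
  Nat.sInf_le ⟨Γ, h, rfl⟩

theorem minCutDim_isBigO (hL : BoundedSpectralVariation L D μ) {bdry A Γ : Finset V}
    (h : IsMinCut G bdry A Γ) :
    (fun n => (minCutDim (L n) bdry A : ℝ)) =O[atTop] fun n => D n ^ (cutEdges G Γ).card := by
  refine IsBigO.trans ?_ (cutDim_isTheta hL Γ).isBigO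
  refine IsBigO.of_bound 1 (Eventually.of_forall fun n => ?_)
  simpa using (minCutDim_le h : minCutDim (L n) bdry A ≤ cutDim (L n) Γ)

/-- The contribution of a configuration whose energy exceeds the minimum is of order `1 / D`. -/
theorem term_isBigO (hD : Tendsto D atTop atTop) (hL : BoundedSpectralVariation L D μ)
    {bdry A Γ : Finset V} (h : IsMinCut G bdry A Γ) {r : ℕ} {p : V → Equiv.Perm N}
    (hp : r * (cutEdges G Γ).card < energy G p) :
    (fun n => (minCutDim (L n) bdry A : ℝ) ^ r * configWeight (L n) p)
      =O[atTop] fun n => 1 / D n := by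
  refine (((minCutDim_isBigO hL h).pow r).mul (configWeight_isBigO hL p)).trans ?_
  refine IsBigO.of_bound 1 ?_
  filter_upwards [hD.eventually_ge_atTop 1] with n hn
  have h0 : 0 < D n := by linarith
  rw [Real.norm_of_nonneg (by positivity), Real.norm_of_nonneg (by positivity), one_mul, ← pow_mul,
    mul_inv_le_iff₀ (by positivity), one_div, le_inv_mul_iff₀ h0, ← pow_succ']
  exact pow_le_pow_right₀ hn (by rw [mul_comm _ r]; exact hp)

theorem term_tendsto_zero (hD : Tendsto D atTop atTop) (hL : BoundedSpectralVariation L D μ)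
    {bdry A Γ : Finset V} (h : IsMinCut G bdry A Γ) {r : ℕ} {p : V → Equiv.Perm N}
    (hp : r * (cutEdges G Γ).card < energy G p) :
    Tendsto (fun n => (minCutDim (L n) bdry A : ℝ) ^ r * configWeight (L n) p) atTop (𝓝 0) := by
  refine (term_isBigO hD hL h hp).trans_tendsto ?_
  simp_rw [one_div]
  exact hD.inv_tendsto_atTop

/-- If in every configuration of minimal energy the cycles of the spins are contained in those of
the boundary value `τ ⊕ τ`, then such configurations do not couple the two families of replicas, and the
variance is of order `1 / D`. -/
theorem varMoment_isBigO (hD : Tendsto D atTop atTop) (hL : BoundedSpectralVariation L D μ)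
    {bdry A Γ : Finset V} (hA : A ⊆ bdry) (h : IsMinCut G bdry A Γ) (m : ℕ)
    (hmin : ∀ p : V → Equiv.Perm (Fin (m + 1) ⊕ Fin (m + 1)),
      IsBdryConfig bdry A (Equiv.Perm.sumCongr (finRotate (m + 1)) (finRotate (m + 1))) p →
      energy G p ≤ permLen (Equiv.Perm.sumCongr (finRotate (m + 1)) (finRotate (m + 1)))
        * (cutEdges G Γ).card →
      ∀ x, fixSub (Equiv.Perm.sumCongr (finRotate (m + 1)) (finRotate (m + 1))) ≤ fixSub (p x)) :
    (fun n => varMoment (L n) bdry A (m + 1)) =O[atTop] fun n => 1 / D n := by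
  classical
  simp_rw [fun n => varMoment_eq (L n) hA m]
  refine IsBigO.fun_sum fun Q hQ => term_isBigO hD hL h ?_
  by_contra hn
  rw [not_lt] at hn
  refine (Finset.mem_filter.1 hQ).2 fun x => ?_
  have h1 := hmin _ (isBdryConfig_extend hA _ Q)
    (by rw [permLen_sumCongr, permLen_finRotate]; linarith) x.1
  rw [extend_of_mem_bulk] at h1
  exact exists_sumCongr_eq h1

/-! ### One minimal cut -/

section Unique

variable {bdry A Γ : Finset V}

theorem minCutDim_of_unique (L : LinkStates G) (hA : A ⊆ bdry)
    (hΓ : ∀ Γ', IsMinCut G bdry A Γ' ↔ Γ' = Γ) : minCutDim L bdry A = cutDim L Γ := by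
  obtain ⟨Γ', h, h'⟩ := exists_minCutDim_eq L hA
  rw [h', (hΓ Γ').1 h]

theorem varMoment_isBigO_of_unique (hG : G.Connected) (hb : bdry.Nonempty) (hA : A ⊆ bdry)
    (hD : Tendsto D atTop atTop) (hL : BoundedSpectralVariation L D μ)
    (hΓ : ∀ Γ', IsMinCut G bdry A Γ' ↔ Γ' = Γ) (m : ℕ) :
    (fun n => varMoment (L n) bdry A (m + 1)) =O[atTop] fun n => 1 / D n := by
  refine varMoment_isBigO hD hL hA ((hΓ Γ).2 rfl) m fun p hp hle x => ?_
  rw [eq_of_energy_le_of_unique hG hb hA hΓ hp hle x]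
  split_ifs
  · exact le_rfl
  · rw [fixSub_one]
    exact le_top

theorem tendsto_meanMoment_of_unique (hG : G.Connected) (hb : bdry.Nonempty) (hA : A ⊆ bdry)
    (hD : Tendsto D atTop atTop) (hL : BoundedSpectralVariation L D μ)
    (hΓ : ∀ Γ', IsMinCut G bdry A Γ' ↔ Γ' = Γ) (m : ℕ) :
    Tendsto (fun n => meanMoment (L n) bdry A (m + 1)) atTop (𝓝 (cutMoment μ Γ (m + 1))) := by
  classical
  have hmin := (hΓ Γ).2 rfl
  set τ := finRotate (m + 1) with hτ
  let q₀ : ↥(Finset.univ \ bdry : Finset V) → Equiv.Perm (Fin (m + 1)) :=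
    fun x => wall Γ Γ τ 1 x.1
  have hq₀ : extend bdry A τ q₀ = wall Γ Γ τ 1 :=
    extend_restrict (isBdryConfig_wall 1 hmin.1 hmin.1)
  simp_rw [fun n => meanMoment_eq (L n) hA m]
  simp_rw [← Finset.add_sum_erase Finset.univ _ (Finset.mem_univ q₀)]
  rw [← add_zero (cutMoment μ Γ (m + 1))]
  refine Tendsto.add ?_ ?_
  · have h1 : ∀ n, (minCutDim (L n) bdry A : ℝ) ^ m * configWeight (L n) (extend bdry A τ q₀)
        = ∏ e ∈ cutEdges G Γ, linkMoment (L n) e (m + 1) := by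
      intro n
      have h2 : (cutDim (L n) Γ : ℝ) ≠ 0 := by exact_mod_cast (cutDim_pos (L n) Γ).ne'
      rw [hq₀, configWeight_wall_self, minCutDim_of_unique (L n) hA hΓ, permLen_finRotate,
        mul_inv_cancel_left₀ (pow_ne_zero _ h2), cycProd_finRotate]
    exact (tendsto_prod_linkMoment hL Γ (m + 1)).congr fun n => (h1 n).symm
  · rw [← Finset.sum_const_zero (s := Finset.univ.erase q₀)]
    refine tendsto_finsetSum _ fun q hq => term_tendsto_zero hD hL hmin ?_
    by_contra hn
    rw [not_lt] at hn
    apply (Finset.mem_erase.1 hq).1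
    funext x
    have h1 := eq_of_energy_le_of_unique hG hb hA hΓ (isBdryConfig_extend hA τ q)
      (by rw [hτ, permLen_finRotate]; exact hn) x.1
    rw [extend_of_mem_bulk] at h1
    rw [h1]
    simp only [q₀, wall]
    split_ifs <;> rfl

end Unique

/-! ### Two minimal cuts -/

section Two

variable {bdry A S B : Finset V}

theorem varMoment_isBigO_of_two (hG : G.Connected) (hb : bdry.Nonempty) (hA : A ⊆ bdry)
    (hD : Tendsto D atTop atTop) (hL : BoundedSpectralVariation L D μ) (hSB : S ⊆ B) (hne : S ≠ B)
    (h : ∀ Γ', IsMinCut G bdry A Γ' ↔ Γ' = S ∨ Γ' = B)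
    (hd : Disjoint (cutEdges G S) (cutEdges G B)) (m : ℕ) :
    (fun n => varMoment (L n) bdry A (m + 1)) =O[atTop] fun n => 1 / D n := by
  refine varMoment_isBigO hD hL hA ((h S).2 (Or.inl rfl)) m fun p hp hle x => ?_
  obtain ⟨π, hπ, hgeo⟩ := exists_geodesic_of_energy_le hG hb hA hSB hne h hd hp hle
  have h2 := fixSub_le_of_permLen_mul (α := π)
    (β := π⁻¹ * Equiv.Perm.sumCongr (finRotate (m + 1)) (finRotate (m + 1)))
    (by rw [mul_inv_cancel_left]; exact hgeo)
  rw [mul_inv_cancel_left] at h2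
  rw [hπ]
  unfold wall
  split_ifs
  · exact le_rfl
  · exact h2
  · rw [fixSub_one]
    exact le_top

/-- The domain walls with a non-crossing `π` between the cuts carry the limit. The limits `s` and
`b` of the ratios stay free here, since either of the two given cuts may be the inner one. -/
theorem tendsto_meanMoment_of_two (hG : G.Connected) (hb : bdry.Nonempty) (hA : A ⊆ bdry)
    (hD : Tendsto D atTop atTop) (hL : BoundedSpectralVariation L D μ) (hSB : S ⊆ B) (hne : S ≠ B)
    (h : ∀ Γ', IsMinCut G bdry A Γ' ↔ Γ' = S ∨ Γ' = B)
    (hd : Disjoint (cutEdges G S) (cutEdges G B)) {s b : ℝ}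
    (hs : Tendsto (fun n => (minCutDim (L n) bdry A : ℝ) / cutDim (L n) S) atTop (𝓝 s))
    (hb' : Tendsto (fun n => (minCutDim (L n) bdry A : ℝ) / cutDim (L n) B) atTop (𝓝 b))
    (m : ℕ) :
    Tendsto (fun n => meanMoment (L n) bdry A (m + 1)) atTop (𝓝 (∑ π ∈ NC (m + 1),
      (s ^ permLen ((finRotate (m + 1))⁻¹ * π) *
        cycProd (cutMoment μ S) ((finRotate (m + 1))⁻¹ * π)) *
      (b ^ permLen π * cycProd (cutMoment μ B) π))) := by
  classical
  have hS := (h S).2 (Or.inl rfl)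
  have hB := (h B).2 (Or.inr rfl)
  set τ := finRotate (m + 1) with hτ
  let Q : Equiv.Perm (Fin (m + 1)) → ↥(Finset.univ \ bdry : Finset V) →
    Equiv.Perm (Fin (m + 1)) := fun π x => wall S B τ π x.1
  have hQ : ∀ π, extend bdry A τ (Q π) = wall S B τ π := fun π =>
    extend_restrict (isBdryConfig_wall π hS.1 hB.1)
  -- `π` is the spin at a vertex between the cuts; such a vertex is in the bulk
  obtain ⟨x₀, hx₀B, hx₀S⟩ : ∃ x, x ∈ B ∧ x ∉ S := by
    by_contra hn
    push Not at hn
    exact hne (hSB.antisymm hn)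
  have hinj : Function.Injective Q := by
    intro π π' hππ'
    have h1 : wall S B τ π x₀ = wall S B τ π' x₀ := by rw [← hQ, ← hQ, hππ']
    simpa [wall, hx₀B, hx₀S] using h1
  simp_rw [fun n => meanMoment_eq (L n) hA m]
  simp_rw [← Finset.sum_sdiff (Finset.subset_univ ((NC (m + 1)).image Q)),
    Finset.sum_image (hinj.injOn)]
  refine Eq.subst (motive := fun l => Tendsto _ _ (𝓝 l)) (zero_add _) (Tendsto.add ?_ ?_)
  · rw [← Finset.sum_const_zero (s := Finset.univ \ (NC (m + 1)).image Q)]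
    refine tendsto_finsetSum _ fun q hq => term_tendsto_zero hD hL hS ?_
    by_contra hn
    rw [not_lt] at hn
    obtain ⟨π, hπ, hgeo⟩ := exists_geodesic_of_energy_le hG hb hA hSB hne h hd
      (isBdryConfig_extend hA τ q) (by rw [hτ, permLen_finRotate]; exact hn)
    rw [hτ, permLen_finRotate] at hgeo
    refine (Finset.mem_sdiff.1 hq).2 (Finset.mem_image.2 ⟨π, mem_NC_of_geodesic hgeo, ?_⟩)
    funext x
    rw [← extend_of_mem_bulk bdry A τ q, hπ]
  · refine tendsto_finsetSum _ fun π hπ => ?_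
    have hlen : permLen (τ⁻¹ * π) + permLen π = m := by
      rw [permLen_inv_mul_comm, add_comm]
      exact mem_NC_iff.1 hπ
    have h1 : ∀ n, (minCutDim (L n) bdry A : ℝ) ^ m * configWeight (L n) (extend bdry A τ (Q π))
        = (((minCutDim (L n) bdry A : ℝ) / cutDim (L n) S) ^ permLen (τ⁻¹ * π) *
            cycProd (fun l => ∏ e ∈ cutEdges G S, linkMoment (L n) e l) (τ⁻¹ * π)) *
          (((minCutDim (L n) bdry A : ℝ) / cutDim (L n) B) ^ permLen π *
            cycProd (fun l => ∏ e ∈ cutEdges G B, linkMoment (L n) e l) π) := by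
      intro n
      rw [hQ, configWeight_wall _ hSB hd, div_pow, div_pow]
      have h2 : (minCutDim (L n) bdry A : ℝ) ^ m = (minCutDim (L n) bdry A : ℝ) ^
          permLen (τ⁻¹ * π) * (minCutDim (L n) bdry A : ℝ) ^ permLen π := by
        rw [← pow_add, hlen]
      rw [h2]
      ring
    refine Tendsto.congr (fun n => (h1 n).symm) ?_
    exact ((hs.pow _).mul (tendsto_cycProd (fun l => tendsto_prod_linkMoment hL S l) _)).mul
      ((hb'.pow _).mul (tendsto_cycProd (fun l => tendsto_prod_linkMoment hL B l) _))

end Two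

end Asymp

/-! ### Ratios of cut dimensions and the Kreweras complement -/

section Limit

variable {V : Type*} [Fintype V] [DecidableEq V] {G : SimpleGraph V} [DecidableRel G.Adj]
  {L : ℕ → LinkStates G} {D : ℕ → ℝ} {μ : G.edgeSet → Measure ℝ} {bdry A Γ₁ Γ₂ : Finset V} {t : ℝ}

theorem minCutDim_of_two (L : LinkStates G) (hA : A ⊆ bdry)
    (h : ∀ Γ', IsMinCut G bdry A Γ' ↔ Γ' = Γ₁ ∨ Γ' = Γ₂) :
    minCutDim L bdry A = min (cutDim L Γ₁) (cutDim L Γ₂) := by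
  obtain ⟨Γ, hΓ, hd⟩ := exists_minCutDim_eq L hA
  have h1 := minCutDim_le (L := L) ((h Γ₁).2 (Or.inl rfl))
  have h2 := minCutDim_le (L := L) ((h Γ₂).2 (Or.inr rfl))
  rcases (h Γ).1 hΓ with rfl | rfl <;> omega

/-- All bond dimensions are of order `D`, so the ratio of the dimensions of two minimal cuts does
not tend to zero. -/
theorem ratio_limit_pos (hL : BoundedSpectralVariation L D μ)
    (h₁ : IsMinCut G bdry A Γ₁) (h₂ : IsMinCut G bdry A Γ₂)
    (ht : Tendsto (fun n => (cutDim (L n) Γ₁ : ℝ) / cutDim (L n) Γ₂) atTop (𝓝 t)) : 0 < t := by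
  have hc := (h₁.2 _ h₂.1).antisymm (h₂.2 _ h₁.1)
  have h3 := cutDim_isTheta hL Γ₂
  rw [← hc] at h3
  obtain ⟨C, hC⟩ := (h3.trans (cutDim_isTheta hL Γ₁).symm).isBigO.bound
  have h4 : 1 ≤ C * t := by
    refine ge_of_tendsto (ht.const_mul C) ?_
    filter_upwards [hC] with n hn
    have h5 : (0 : ℝ) < cutDim (L n) Γ₂ := by exact_mod_cast cutDim_pos (L n) Γ₂
    rw [Real.norm_of_nonneg (by positivity), Real.norm_of_nonneg (by positivity)] at hn
    rw [← mul_div_assoc, le_div_iff₀ h5, one_mul]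
    exact hn
  have h5 : 0 ≤ t := ge_of_tendsto ht (Eventually.of_forall fun n => by positivity)
  rcases h5.eq_or_lt with h6 | h6
  · rw [← h6, mul_zero] at h4
    linarith
  · exact h6

theorem tendsto_minCutDim_div (hA : A ⊆ bdry) (hL : BoundedSpectralVariation L D μ)
    (h : ∀ Γ', IsMinCut G bdry A Γ' ↔ Γ' = Γ₁ ∨ Γ' = Γ₂)
    (ht : Tendsto (fun n => (cutDim (L n) Γ₁ : ℝ) / cutDim (L n) Γ₂) atTop (𝓝 t)) (ht1 : t ≤ 1) :
    Tendsto (fun n => (minCutDim (L n) bdry A : ℝ) / cutDim (L n) Γ₁) atTop (𝓝 1) ∧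
      Tendsto (fun n => (minCutDim (L n) bdry A : ℝ) / cutDim (L n) Γ₂) atTop (𝓝 t) := by
  have hpos := ratio_limit_pos hL ((h Γ₁).2 (Or.inl rfl)) ((h Γ₂).2 (Or.inr rfl)) ht
  have p1 : ∀ n, (0 : ℝ) < cutDim (L n) Γ₁ := fun n => by exact_mod_cast cutDim_pos (L n) Γ₁
  have p2 : ∀ n, (0 : ℝ) < cutDim (L n) Γ₂ := fun n => by exact_mod_cast cutDim_pos (L n) Γ₂
  constructor
  · have h1 := (tendsto_const_nhds (x := (1 : ℝ))).min (ht.inv₀ hpos.ne')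
    rw [min_eq_left ((one_le_inv₀ hpos).2 ht1)] at h1
    refine h1.congr fun n => ?_
    rw [minCutDim_of_two (L n) hA h, Nat.cast_min, ← min_div_div_right (p1 n).le,
      div_self (p1 n).ne', inv_div]
  · have h1 := ht.min (tendsto_const_nhds (x := (1 : ℝ)))
    rw [min_eq_left ht1] at h1
    refine h1.congr fun n => ?_
    rw [minCutDim_of_two (L n) hA h, Nat.cast_min, ← min_div_div_right (p2 n).le,
      div_self (p2 n).ne']

/-- The Kreweras complement `π ↦ π⁻¹ τ` permutes the non-crossing partitions, and it exchanges the
two factors of the summand up to conjugation and inversion, which do not change the cycle type. -/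
theorem sum_NC_kreweras {m : ℕ} (t : ℝ) (f g : ℕ → ℝ) :
    ∑ π ∈ NC (m + 1), (t ^ permLen ((finRotate (m + 1))⁻¹ * π) *
        cycProd f ((finRotate (m + 1))⁻¹ * π)) * (1 ^ permLen π * cycProd g π)
      = ∑ π ∈ NC (m + 1), (1 ^ permLen ((finRotate (m + 1))⁻¹ * π) *
        cycProd g ((finRotate (m + 1))⁻¹ * π)) * (t ^ permLen π * cycProd f π) := by
  set τ := finRotate (m + 1) with hτ
  have hconj : ∀ π : Equiv.Perm (Fin (m + 1)), IsConj (τ * π⁻¹) (τ⁻¹ * π)⁻¹ := fun π =>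
    isConj_iff.2 ⟨τ⁻¹ * τ * π⁻¹, by group⟩
  have hlen : ∀ π : Equiv.Perm (Fin (m + 1)), permLen (τ * π⁻¹) = permLen (τ⁻¹ * π) := fun π => by
    rw [permLen_conj (hconj π), permLen_inv]
  have hNC : ∀ π ∈ NC (m + 1), τ * π⁻¹ ∈ NC (m + 1) := by
    intro π hπ
    have h1 := mem_NC_iff.1 hπ
    rw [mem_NC_iff, hlen, permLen_inv_mul_comm]
    rw [← hτ] at h1 ⊢
    rw [mul_inv_rev, inv_inv, mul_assoc, inv_mul_cancel, mul_one]
    omega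
  refine Finset.sum_bij' (fun π _ => π⁻¹ * τ) (fun π _ => τ * π⁻¹) ?_ ?_ ?_ ?_ ?_
  · intro π hπ
    have h1 := mem_NC_iff.1 hπ
    rw [mem_NC_iff]
    rw [← hτ] at h1 ⊢
    rw [mul_inv_rev, inv_inv, mul_assoc]
    have h2 : permLen (τ⁻¹ * (π * τ)) = permLen π :=
      permLen_conj (isConj_iff.2 ⟨τ, by group⟩)
    rw [h2]
    omega
  · exact hNC
  · intro π _
    group
  · intro π _
    group
  · intro π _
    have h1 : IsConj (τ⁻¹ * (π⁻¹ * τ)) π⁻¹ := isConj_iff.2 ⟨τ, by group⟩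
    have h2 : π⁻¹ * τ = (τ⁻¹ * π)⁻¹ := by group
    rw [permLen_conj h1, cycProd_conj g h1, h2, permLen_inv, permLen_inv, cycProd_inv, cycProd_inv,
      one_pow]
    ring

end Limit

end RTN

theorem mainTheorem6 {V : Type*} [Fintype V] [DecidableEq V]
    (G : SimpleGraph V) [DecidableRel G.Adj] (hG : G.Connected)
    (bdry A : Finset V) (hbdry : bdry.Nonempty) (hA : A ⊆ bdry)
    (D : ℕ → ℝ) (hD : Tendsto D atTop atTop)
    (L : ℕ → RTN.LinkStates G) (μ : G.edgeSet → Measure ℝ)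
    (hL : RTN.BoundedSpectralVariation L D μ) :
    ∀ k : ℕ, 1 ≤ k →
      -- the moments are square integrable, so that mean and variance are meaningful
      (∀ n, MemLp (RTN.boundaryMoment (L n) bdry A k) 2 (RTN.tensorLaw (L n) bdry)) ∧
      -- a unique minimal cut
      (∀ Γ : Finset V,
        (∀ Γ' : Finset V, RTN.IsMinCut G bdry A Γ' ↔ Γ' = Γ) →
        Tendsto (fun n => RTN.meanMoment (L n) bdry A k) atTop (𝓝 (RTN.cutMoment μ Γ k)) ∧
        (fun n => RTN.varMoment (L n) bdry A k) =O[atTop] (fun n => 1 / D n)) ∧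
      -- exactly two minimal cuts, which do not intersect
      (∀ (Γ₁ Γ₂ : Finset V) (t : ℝ), Γ₁ ≠ Γ₂ →
        (∀ Γ' : Finset V, RTN.IsMinCut G bdry A Γ' ↔ Γ' = Γ₁ ∨ Γ' = Γ₂) →
        Disjoint (RTN.cutEdges G Γ₁) (RTN.cutEdges G Γ₂) →
        Tendsto (fun n => (RTN.cutDim (L n) Γ₁ : ℝ) / (RTN.cutDim (L n) Γ₂ : ℝ)) atTop (𝓝 t) →
        t ≤ 1 →
        Tendsto (fun n => RTN.meanMoment (L n) bdry A k) atTop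
          (𝓝 (∑ π ∈ RTN.NC k, t ^ RTN.cayleyDist π 1 *
            RTN.permProd (RTN.cutMoment μ Γ₁) ((finRotate k)⁻¹ * π) *
            RTN.permProd (RTN.cutMoment μ Γ₂) π)) ∧
        (fun n => RTN.varMoment (L n) bdry A k) =O[atTop] (fun n => 1 / D n)) := by
  intro k hk
  obtain ⟨m, rfl⟩ : ∃ m, k = m + 1 := ⟨k - 1, by omega⟩
  refine ⟨fun n => RTN.memLp_boundaryMoment (L n) hA m, fun Γ hΓ =>
    ⟨RTN.tendsto_meanMoment_of_unique hG hbdry hA hD hL hΓ m,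
      RTN.varMoment_isBigO_of_unique hG hbdry hA hD hL hΓ m⟩, fun Γ₁ Γ₂ t hne h hd ht ht1 => ?_⟩
  obtain ⟨r1, r2⟩ := RTN.tendsto_minCutDim_div hA hL h ht ht1
  have hsum : ∑ π ∈ RTN.NC (m + 1), t ^ RTN.cayleyDist π 1 *
      RTN.permProd (RTN.cutMoment μ Γ₁) ((finRotate (m + 1))⁻¹ * π) *
      RTN.permProd (RTN.cutMoment μ Γ₂) π
      = ∑ π ∈ RTN.NC (m + 1), (1 ^ RTN.permLen ((finRotate (m + 1))⁻¹ * π) *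
        RTN.cycProd (RTN.cutMoment μ Γ₁) ((finRotate (m + 1))⁻¹ * π)) *
        (t ^ RTN.permLen π * RTN.cycProd (RTN.cutMoment μ Γ₂) π) := by
    refine Finset.sum_congr rfl fun π _ => ?_
    rw [RTN.cayleyDist_eq_permLen, mul_one, RTN.permLen_inv, RTN.permProd_eq_cycProd,
      RTN.permProd_eq_cycProd, one_pow]
    ring
  rw [hsum]
  rcases RTN.subset_or_subset_of_two h with hs | hs
  · exact ⟨RTN.tendsto_meanMoment_of_two hG hbdry hA hD hL hs hne h hd r1 r2 m,
      RTN.varMoment_isBigO_of_two hG hbdry hA hD hL hs hne h hd m⟩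
  · have h' : ∀ Γ' : Finset V, RTN.IsMinCut G bdry A Γ' ↔ Γ' = Γ₂ ∨ Γ' = Γ₁ := fun Γ' => by
      rw [h Γ', or_comm]
    rw [← RTN.sum_NC_kreweras]
    exact ⟨RTN.tendsto_meanMoment_of_two hG hbdry hA hD hL hs hne.symm h' hd.symm r2 r1 m,
      RTN.varMoment_isBigO_of_two hG hbdry hA hD hL hs hne.symm h' hd.symm m⟩
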